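/- Let $m\ge 1$ and let $M$ be a connected, complete $m$-dimensional minimal immersed submanifold of $\mathbb{R}^n$: $M$ is a connected smooth $m$-manifold with a smooth immersion $\varphi:M\to\mathbb{R}^n$ whose mean curvature vector vanishes identically, and $M$ is complete in the Riemannian distance $\mathrm{dist}_M$ of the metric induced by $\varphi$. Fix a point $p\in M$ and an exhaustion $K_1\subset K_2\subset\cdots$ of $M$ by compact sets (with $K_i\subset\operatorname{int}K_{i+1}$ and $\bigcup_i K_i=M$), put $\rho(x)=\mathrm{dist}_M(p,x)$, and let $$b_i=\inf\{\rho(x)^2\,\mathrm{Ric}(x)(\nu,\nu)\;:\;x\in M\setminus K_i,\ \nu\in T_xM,\ |\nu|=1\}\in[-\infty,\infty],\qquad b(M)=\lim_{i\to\infty}b_i,$$ where $\mathrm{Ric}$ is the Ricci curvature of the induced metric; the limit exists because the sequence $(b_i)$ is non-decreasing. If $b(M)>-1$, then $M$ is properly immersed, that is, $\varphi$ is a proper map, and $M$ is $C^\infty$-diffeomorphic to the interior of a compact smooth manifold $\overline{M}$ with (possibly empty) boundary. -/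

import Mathlib

open Set Filter Topology Manifold Bundle
open scoped ContDiff

noncomputable section

/-! ### Curvature of a metric given by its matrix in coordinates on `ℝᵐ` -/

/-- The partial derivative `∂ᵢ f (y)` of a real function on `ℝᵐ`. -/
def partialD {m : ℕ} (i : Fin m) (f : EuclideanSpace ℝ (Fin m) → ℝ)
    (y : EuclideanSpace ℝ (Fin m)) : ℝ :=
  fderiv ℝ f y (EuclideanSpace.single i 1)

/-- The Christoffel symbols `Γᵏᵢⱼ = ½ ∑ₗ gᵏˡ (∂ᵢ gⱼₗ + ∂ⱼ gᵢₗ - ∂ₗ gᵢⱼ)` of the metric `g`. -/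
def christoffel {m : ℕ} (g : EuclideanSpace ℝ (Fin m) → Matrix (Fin m) (Fin m) ℝ)
    (k i j : Fin m) (y : EuclideanSpace ℝ (Fin m)) : ℝ :=
  (1 / 2 : ℝ) * ∑ l, (g y)⁻¹ k l *
    (partialD i (fun z => g z j l) y + partialD j (fun z => g z i l) y
      - partialD l (fun z => g z i j) y)

/-- The components of the Riemann tensor, `R(∂ᵢ, ∂ⱼ) ∂ₖ = ∑ₗ (riemannCoord g l k i j) ∂ₗ`,
where `R(X, Y) Z = ∇_X ∇_Y Z - ∇_Y ∇_X Z - ∇_[X,Y] Z`. -/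
def riemannCoord {m : ℕ} (g : EuclideanSpace ℝ (Fin m) → Matrix (Fin m) (Fin m) ℝ)
    (l k i j : Fin m) (y : EuclideanSpace ℝ (Fin m)) : ℝ :=
  partialD i (christoffel g l j k) y - partialD j (christoffel g l i k) y
    + ∑ q, (christoffel g l i q y * christoffel g q j k y
      - christoffel g l j q y * christoffel g q i k y)

/-- The components `Ric(∂ⱼ, ∂ₖ) = trace (X ↦ R(X, ∂ⱼ) ∂ₖ)` of the Ricci tensor
(positive on round spheres). -/
def ricciCoord {m : ℕ} (g : EuclideanSpace ℝ (Fin m) → Matrix (Fin m) (Fin m) ℝ)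
    (j k : Fin m) (y : EuclideanSpace ℝ (Fin m)) : ℝ :=
  ∑ i, riemannCoord g i k i j y

/-! ### Ricci curvature of a Riemannian manifold -/

section Riemannian

variable {m : ℕ} {M : Type*} [TopologicalSpace M] [ChartedSpace (EuclideanSpace ℝ (Fin m)) M]

/-- The `i`-th coordinate vector field, at the point with coordinates `y`, of the preferred chart
at `x₀`. -/
def coordVec (x₀ : M) (i : Fin m) (y : EuclideanSpace ℝ (Fin m)) :
    TangentSpace (𝓡 m) ((extChartAt (𝓡 m) x₀).symm y) :=
  mfderiv 𝓘(ℝ, EuclideanSpace ℝ (Fin m)) (𝓡 m) (extChartAt (𝓡 m) x₀).symm y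
    (EuclideanSpace.single i (1 : ℝ) : EuclideanSpace ℝ (Fin m))

/-- The matrix `gᵢⱼ = ⟨∂ᵢ, ∂ⱼ⟩` of the Riemannian metric in the preferred chart at `x₀`. -/
def metricCoord [RiemannianBundle (fun x : M => TangentSpace (𝓡 m) x)]
    (x₀ : M) (y : EuclideanSpace ℝ (Fin m)) : Matrix (Fin m) (Fin m) ℝ :=
  Matrix.of fun i j => inner ℝ (coordVec x₀ i y) (coordVec x₀ j y)

/-- The components of a tangent vector at `x` in the preferred chart at `x`: a tangent vector at
`x` is by definition the vector of these components. -/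
def tangentCoord {x : M} (v : TangentSpace (𝓡 m) x) (i : Fin m) : ℝ :=
  (show EuclideanSpace ℝ (Fin m) from v) i

/-- The Ricci curvature `Ric(x)(v, w)`. -/
def ricci [RiemannianBundle (fun x : M => TangentSpace (𝓡 m) x)]
    (x : M) (v w : TangentSpace (𝓡 m) x) : ℝ :=
  ∑ j, ∑ k, ricciCoord (metricCoord x) j k (extChartAt (𝓡 m) x x)
    * tangentCoord v j * tangentCoord w k

/-! ### Isometric immersions into `ℝⁿ` -/

variable {n : ℕ}

/-- The differential `dφ(x) : T_x M → ℝⁿ`. -/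
def differential (φ : M → EuclideanSpace ℝ (Fin n)) (x : M) :
    TangentSpace (𝓡 m) x →L[ℝ] EuclideanSpace ℝ (Fin n) :=
  mfderiv (𝓡 m) 𝓘(ℝ, EuclideanSpace ℝ (Fin n)) φ x

/-- `φ` is a smooth isometric immersion: the metric of `M` is the one induced by `φ`
(in particular every `dφ(x)` is injective). -/
def IsIsometricImmersion [RiemannianBundle (fun x : M => TangentSpace (𝓡 m) x)]
    (φ : M → EuclideanSpace ℝ (Fin n)) : Prop :=
  ContMDiff (𝓡 m) 𝓘(ℝ, EuclideanSpace ℝ (Fin n)) ∞ φ ∧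
    ∀ (x : M) (v w : TangentSpace (𝓡 m) x),
      inner ℝ (differential (m := m) φ x v) (differential (m := m) φ x w) = inner ℝ v w

/-- The second fundamental form `α(x)(v, w)`: the component normal to `dφ(T_x M)` of the second
derivative of `φ` in a chart (the normal component does not depend on the chart). -/
def secondFundamentalForm (φ : M → EuclideanSpace ℝ (Fin n)) (x : M)
    (v w : TangentSpace (𝓡 m) x) : EuclideanSpace ℝ (Fin n) :=
  ((differential (m := m) φ x).toLinearMap.range)ᗮ.starProjection
    (fderiv ℝ (fderiv ℝ (φ ∘ (extChartAt (𝓡 m) x).symm)) (extChartAt (𝓡 m) x x)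
      (show EuclideanSpace ℝ (Fin m) from v) (show EuclideanSpace ℝ (Fin m) from w))

/-- The immersion is minimal: its mean curvature vector, the trace of the second fundamental form
(up to the factor `1 / m`), vanishes at every point. -/
def IsMinimalImmersion [RiemannianBundle (fun x : M => TangentSpace (𝓡 m) x)]
    (φ : M → EuclideanSpace ℝ (Fin n)) : Prop :=
  ∀ (x : M) (e : OrthonormalBasis (Fin m) ℝ (TangentSpace (𝓡 m) x)),
    ∑ i, secondFundamentalForm φ x (e i) (e i) = 0

end Riemannian

/-! ### The number `b(M)` -/

section Decay

variable {m : ℕ} {M : Type*} [MetricSpace M] [ChartedSpace (EuclideanSpace ℝ (Fin m)) M]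
  [RiemannianBundle (fun x : M => TangentSpace (𝓡 m) x)]

/-- `bᵢ = inf {ρ(x)² Ric(x)(ν, ν) : |ν| = 1, x ∈ M \ Kᵢ}`, where `ρ(x) = dist(p, x)`; it is an
extended real number. -/
def ricciDecaySeq (p : M) (K : CompactExhaustion M) (i : ℕ) : EReal :=
  sInf {t : EReal | ∃ (x : M) (ν : TangentSpace (𝓡 m) x),
    x ∉ K i ∧ ‖ν‖ = 1 ∧ t = ((dist p x ^ 2 * ricci x ν ν : ℝ) : EReal)}

/-- `b(M) = lim bᵢ`, computed with the base point `p` and the exhaustion `K`. -/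
def ricciDecay (p : M) (K : CompactExhaustion M) : EReal :=
  limUnder atTop (ricciDecaySeq (m := m) p K)

theorem ricciDecaySeq_mono (p : M) (K : CompactExhaustion M) :
    Monotone (ricciDecaySeq (m := m) p K) := by
  intro i j hij
  apply sInf_le_sInf
  rintro t ⟨x, ν, hx, hν, rfl⟩
  exact ⟨x, ν, fun h => hx (K.subset hij h), hν, rfl⟩

/-- The limit that defines `b(M)` exists. -/
theorem tendsto_ricciDecaySeq (p : M) (K : CompactExhaustion M) :
    Tendsto (ricciDecaySeq (m := m) p K) atTop (𝓝 (ricciDecay (m := m) p K)) :=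
  tendsto_nhds_limUnder ⟨_, tendsto_atTop_iSup (ricciDecaySeq_mono p K)⟩

end Decay

/-! ### Interiors of compact manifolds with boundary -/

/-- `M` is `C^∞`-diffeomorphic to the interior of a compact smooth (Hausdorff) `m`-dimensional
manifold with (possibly empty) boundary. -/
def IsInteriorOfCompactManifold.{u} (m : ℕ) [NeZero m] (M : Type u) [TopologicalSpace M]
    [ChartedSpace (EuclideanSpace ℝ (Fin m)) M] : Prop :=
  ∃ (N : Type u) (_ : TopologicalSpace N) (_ : ChartedSpace (EuclideanHalfSpace m) N)
    (U : TopologicalSpace.Opens N),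
    IsManifold (𝓡∂ m) ∞ N ∧ T2Space N ∧ CompactSpace N ∧
      (U : Set N) = (𝓡∂ m).interior N ∧ Nonempty (M ≃ₘ⟮𝓡 m, 𝓡∂ m⟯ U)

end

/-!
Let `α` be the second fundamental form, `ρ` the distance to `p` and `f = ½|φ - φ(p)|²`.

For a minimal immersion the traced Gauss equation reads `Ric(ν, ν) = -∑ₐ |α(ν, eₐ)|²`
(`ricci_eq_neg_sum`). Hence the hypothesis `b(M) > -1` gives `|α(ν, ν)|² ≤ -Ric(ν, ν) ≤ q / ρ²`
with a constant `q < 1`, outside a compact set. The Hessian of `f` is `|v|² + ⟨φ - φ(p), α(v,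
v)⟩`, and `|φ - φ(p)| ≤ ρ`, so it is bounded below by `l = 1 - √q > 0` there
(`exists_hessian_lower_bound`).

Integrated along minimal geodesics, this bound makes `|∇f|` grow at least linearly in `ρ`
(`exists_linear_lower_bound`). Geodesics are avoided: the flow of `∇f`, run backwards for a time
`s`, contracts lengths by the factor `exp (-l s)`, and the triangle inequality between two points
and their images gives `l dist(z, x) ≤ |∇f(z)| + |∇f(x)|` as `s → 0`
(`mul_dist_le_norm_add_norm`).

The gradient of `f` is the tangential part of `φ - φ(p)`, so `|∇f| ≤ |φ - φ(p)|`. Thus `φ` is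
proper (`isProperMap_of_linear_lower_bound`), and `f` is a proper function without critical points
outside a compact set. A manifold with such a function is the interior of a compact manifold with
boundary (`isInteriorOfCompactManifold_of_proper`): a multiple of the gradient is complete, and
moving points along its flow, for times that depend on `f`, maps the manifold diffeomorphically
onto a sublevel set `{f < a}` of a regular value, whose closure `{f ≤ a}` is a manifold with
boundary (`hasAdaptedCharts_sublevel`).

The argument rests on three general facts that are established from scratch: the smooth dependence
of flows on initial conditions, by the inverse function theorem in a space of continuous curves
(`exists_smooth_local_flow`, `exists_smooth_flow`); the compactness of closed balls in a complete
Riemannian manifold (`properSpace_of_complete`); and the Gauss equation for the coordinate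
expression of the curvature tensor (`sum_gram_mul_riemannCoord`).
-/

noncomputable section

/-! ### Superposition operators on spaces of continuous functions -/

section Nemytskii

universe u

variable {K : Type*} [TopologicalSpace K] [CompactSpace K]

/-- Pointwise application of a continuous bilinear map `B` to continuous functions. -/
def pointwiseBilin (K : Type*) [TopologicalSpace K] [CompactSpace K] {V E F : Type*}
    [NormedAddCommGroup V] [NormedSpace ℝ V]
    [NormedAddCommGroup E] [NormedSpace ℝ E] [NormedAddCommGroup F] [NormedSpace ℝ F]
    (B : V →L[ℝ] E →L[ℝ] F) : C(K, V) →L[ℝ] C(K, E) →L[ℝ] C(K, F) :=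
  LinearMap.mkContinuous₂
    (LinearMap.mk₂ ℝ (fun (A : C(K, V)) (h : C(K, E)) =>
        (⟨fun t => B (A t) (h t), by fun_prop⟩ : C(K, F)))
      (fun A B h => by ext t; simp) (fun c A h => by ext t; simp)
      (fun A h k => by ext t; simp) (fun c A h => by ext t; simp)) ‖B‖
    (fun A h => by
      rw [ContinuousMap.norm_le _ (by positivity)]
      intro t
      refine (B.le_opNorm₂ (A t) (h t)).trans ?_
      gcongr
      · exact A.norm_coe_le_norm t
      · exact h.norm_coe_le_norm t)

theorem pointwiseBilin_apply {V E F : Type*} [NormedAddCommGroup V] [NormedSpace ℝ V]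
    [NormedAddCommGroup E] [NormedSpace ℝ E] [NormedAddCommGroup F] [NormedSpace ℝ F]
    (B : V →L[ℝ] E →L[ℝ] F) (A : C(K, V)) (h : C(K, E)) (t : K) :
    pointwiseBilin K B A h t = B (A t) (h t) := rfl

/-- The superposition operator `γ ↦ v ∘ γ` is differentiable, with derivative `h ↦ (v' ∘ γ) h`. -/
theorem hasFDerivAt_superposition {E F : Type*} [NormedAddCommGroup E] [NormedSpace ℝ E]
    [NormedAddCommGroup F] [NormedSpace ℝ F] {v : C(E, F)} (hv : ContDiff ℝ 1 v) (γ : C(K, E)) :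
    HasFDerivAt (fun γ : C(K, E) => v.comp γ)
      (pointwiseBilin K (.id ℝ (E →L[ℝ] F)) ((ContinuousMap.mk (fderiv ℝ v)
        (hv.continuous_fderiv one_ne_zero)).comp γ)) γ := by
  rw [hasFDerivAt_iff_isLittleO_nhds_zero, Asymptotics.isLittleO_iff]
  intro c hc
  have hcont : Continuous fun γ : C(K, E) => (ContinuousMap.mk (fderiv ℝ v)
      (hv.continuous_fderiv one_ne_zero)).comp γ := ContinuousMap.continuous_postcomp _
  obtain ⟨δ, hδ, hδ'⟩ := (Metric.continuousAt_iff (α := C(K, E)) (β := C(K, E →L[ℝ] F))).1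
    hcont.continuousAt c hc
  filter_upwards [Metric.ball_mem_nhds (0 : C(K, E)) hδ] with h hh
  rw [mem_ball_zero_iff] at hh
  rw [ContinuousMap.norm_le _ (by positivity)]
  intro t
  have key : ∀ z ∈ segment ℝ (γ t) (γ t + h t), ‖fderiv ℝ v z - fderiv ℝ v (γ t)‖ ≤ c := by
    intro z hz
    rw [segment_eq_image'] at hz
    obtain ⟨θ, hθ, rfl⟩ := hz
    have h1 : dist (γ + θ • h) γ < δ := by
      rw [dist_eq_norm, add_sub_cancel_left, norm_smul, Real.norm_of_nonneg hθ.1]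
      exact (mul_le_of_le_one_left (norm_nonneg _) hθ.2).trans_lt hh
    have h2 := hδ' h1
    have h3 := (ContinuousMap.dist_lt_iff hc).1 h2 t
    rw [dist_eq_norm] at h3
    simpa using h3.le
  have := (convex_segment (𝕜 := ℝ) (γ t) (γ t + h t)).norm_image_sub_le_of_norm_hasFDerivWithin_le'
    (fun z hz => ((hv.differentiable one_ne_zero) z).hasFDerivAt.hasFDerivWithinAt) key
    (left_mem_segment ℝ _ _) (right_mem_segment ℝ _ _)
  rw [add_sub_cancel_left] at this
  refine le_trans ?_ (this.trans (mul_le_mul_of_nonneg_left (h.norm_coe_le_norm t) hc.le))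
  simp [pointwiseBilin_apply]

theorem contDiff_superposition_nat (n : ℕ) {E F : Type u} [NormedAddCommGroup E] [NormedSpace ℝ E]
    [NormedAddCommGroup F] [NormedSpace ℝ F] {v : C(E, F)} (hv : ContDiff ℝ n v) :
    ContDiff ℝ n (fun γ : C(K, E) => v.comp γ) := by
  induction n generalizing F with
  | zero =>
    simp only [CharP.cast_eq_zero, contDiff_zero]
    exact ContinuousMap.continuous_postcomp _
  | succ n ih =>
    have hv1 : ContDiff ℝ 1 v := hv.of_le (by norm_cast; omega)
    have hv' : ContDiff ℝ n (fderiv ℝ v) := hv.fderiv_right (by norm_cast)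
    rw [Nat.cast_succ, contDiff_succ_iff_hasFDerivAt]
    exact ⟨_, (pointwiseBilin K (.id ℝ (E →L[ℝ] F))).contDiff.comp
      (ih (v := ⟨fderiv ℝ v, hv'.continuous⟩) hv'),
      hasFDerivAt_superposition hv1⟩

/-- Composition with a smooth map is a smooth operation on spaces of continuous functions. -/
theorem contDiff_superposition {E F : Type u} [NormedAddCommGroup E] [NormedSpace ℝ E]
    [NormedAddCommGroup F] [NormedSpace ℝ F] {v : C(E, F)} (hv : ContDiff ℝ ∞ v) :
    ContDiff ℝ ∞ (fun γ : C(K, E) => v.comp γ) :=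
  contDiff_infty.2 fun n => contDiff_superposition_nat n (hv.of_le (by exact_mod_cast le_top))

end Nemytskii

/-! ### Local flows of smooth vector fields in Banach spaces -/

section LocalFlow

variable {E : Type*} [NormedAddCommGroup E] [NormedSpace ℝ E] [CompleteSpace E]

/-- Integration from `0`, on continuous functions on `[-1, 1]`. -/
def integralOp (E : Type*) [NormedAddCommGroup E] [NormedSpace ℝ E] [CompleteSpace E] :
    C(Icc (-1 : ℝ) 1, E) →L[ℝ] C(Icc (-1 : ℝ) 1, E) :=
  LinearMap.mkContinuous
    { toFun := fun γ => ⟨fun t => ∫ τ in (0 : ℝ)..t, IccExtend (by norm_num) γ τ, by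
        have : Continuous (IccExtend (by norm_num : (-1 : ℝ) ≤ 1) γ) := γ.continuous.Icc_extend'
        exact (intervalIntegral.continuous_primitive
          (fun a b => this.intervalIntegrable a b) 0).comp continuous_subtype_val⟩
      map_add' := fun γ η => by
        ext t
        simp only [ContinuousMap.coe_mk, ContinuousMap.add_apply]
        rw [← intervalIntegral.integral_add]
        · rfl
        · exact (γ.continuous.Icc_extend' (h := by norm_num)).intervalIntegrable _ _
        · exact (η.continuous.Icc_extend' (h := by norm_num)).intervalIntegrable _ _
      map_smul' := fun c γ => by
        ext t
        simp only [ContinuousMap.coe_mk, ContinuousMap.smul_apply, RingHom.id_apply]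
        rw [← intervalIntegral.integral_smul]
        rfl } 1 (fun γ => by
      rw [ContinuousMap.norm_le _ (by positivity)]
      intro t
      simp only [LinearMap.coe_mk, AddHom.coe_mk, ContinuousMap.coe_mk, one_mul]
      have := intervalIntegral.norm_integral_le_of_norm_le_const (a := 0) (b := (t : ℝ))
        (f := IccExtend (by norm_num : (-1 : ℝ) ≤ 1) γ) (C := ‖γ‖)
        (fun τ _ => γ.norm_coe_le_norm _)
      refine this.trans (mul_le_of_le_one_right (norm_nonneg _) ?_)
      rw [sub_zero, abs_le]
      exact t.2)

theorem integralOp_apply (γ : C(Icc (-1 : ℝ) 1, E)) (t : Icc (-1 : ℝ) 1) :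
    integralOp E γ t = ∫ τ in (0 : ℝ)..t, IccExtend (by norm_num) γ τ := rfl

/-- The map `(s, x, γ) ↦ (s, x, γ - x - s ∫ v ∘ γ)`; the zeros of the last component are the
solutions of `γ' = s v(γ)` with `γ 0 = x`. -/
def picardMap (v : C(E, E))
    (z : (ℝ × E) × C(Icc (-1 : ℝ) 1, E)) : (ℝ × E) × C(Icc (-1 : ℝ) 1, E) :=
  (z.1, z.2 - ContinuousMap.const _ z.1.2
    - z.1.1 • integralOp E (v.comp z.2))

/-- Constant functions, as a continuous linear map. -/
def constOp (E : Type*) [NormedAddCommGroup E] [NormedSpace ℝ E] :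
    E →L[ℝ] C(Icc (-1 : ℝ) 1, E) :=
  LinearMap.mkContinuous
    { toFun := fun x => ContinuousMap.const _ x
      map_add' := fun x y => by ext t; simp
      map_smul' := fun c x => by ext t; simp } 1 (fun x => by
      rw [ContinuousMap.norm_le _ (by positivity)]
      intro t; simp)

theorem contDiff_picardMap {v : C(E, E)} (hv : ContDiff ℝ ∞ v) : ContDiff ℝ ∞ (picardMap v) := by
  have h1 := (contDiff_superposition (K := Icc (-1 : ℝ) 1) hv).comp
    (contDiff_snd : ContDiff ℝ ∞ (fun z : (ℝ × E) × C(Icc (-1 : ℝ) 1, E) => z.2))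
  have h2 : ContDiff ℝ ∞ (fun z : (ℝ × E) × C(Icc (-1 : ℝ) 1, E) => constOp E z.1.2) :=
    (constOp E).contDiff.comp (by fun_prop)
  have h3 := (integralOp E).contDiff.comp h1
  have h4 : ContDiff ℝ ∞ (fun z : (ℝ × E) × C(Icc (-1 : ℝ) 1, E) => z.1.1) := by fun_prop
  exact contDiff_fst.prodMk ((contDiff_snd.sub h2).sub (h4.smul h3))

/-- At speed `s = 0` and the constant solution, the derivative of the Picard map is invertible, so
the inverse function theorem provides solutions that depend smoothly on `(s, x)`. -/
theorem hasFDerivAt_picardMap {v : C(E, E)} (hv : ContDiff ℝ ∞ v) (x₀ : E) :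
    ∃ A : ((ℝ × E) × C(Icc (-1 : ℝ) 1, E)) ≃L[ℝ] ((ℝ × E) × C(Icc (-1 : ℝ) 1, E)),
      HasFDerivAt (picardMap v)
        (A : ((ℝ × E) × C(Icc (-1 : ℝ) 1, E)) →L[ℝ] ((ℝ × E) × C(Icc (-1 : ℝ) 1, E)))
        ((0, x₀), ContinuousMap.const _ x₀) := by
  set z₀ : (ℝ × E) × C(Icc (-1 : ℝ) 1, E) := ((0, x₀), ContinuousMap.const _ x₀)
  have h1 := ((contDiff_superposition (K := Icc (-1 : ℝ) 1) hv).comp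
    (contDiff_snd : ContDiff ℝ ∞ (fun z : (ℝ × E) × C(Icc (-1 : ℝ) 1, E) => z.2)))
  have h3 := (((integralOp E).contDiff.comp h1).differentiable (by simp) z₀).hasFDerivAt
  have h4 : HasFDerivAt (fun z : (ℝ × E) × C(Icc (-1 : ℝ) 1, E) => z.1.1)
    ((ContinuousLinearMap.fst ℝ ℝ E).comp (ContinuousLinearMap.fst ℝ (ℝ × E) _)) z₀ :=
    ((ContinuousLinearMap.fst ℝ ℝ E).comp
      (ContinuousLinearMap.fst ℝ (ℝ × E) C(Icc (-1 : ℝ) 1, E))).hasFDerivAt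
  have h2 : HasFDerivAt (fun z : (ℝ × E) × C(Icc (-1 : ℝ) 1, E) => constOp E z.1.2)
    ((constOp E).comp ((ContinuousLinearMap.snd ℝ ℝ E).comp
      (ContinuousLinearMap.fst ℝ (ℝ × E) _))) z₀ :=
    ((constOp E).comp ((ContinuousLinearMap.snd ℝ ℝ E).comp
      (ContinuousLinearMap.fst ℝ (ℝ × E) C(Icc (-1 : ℝ) 1, E)))).hasFDerivAt
  have h5 := (hasFDerivAt_fst (𝕜 := ℝ) (p := z₀)).prodMk
    (((hasFDerivAt_snd (𝕜 := ℝ) (p := z₀)).sub h2).sub (h4.smul h3))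
  let w : C(Icc (-1 : ℝ) 1, E) := integralOp E (v.comp z₀.2)
  refine ⟨ContinuousLinearEquiv.skewProd (ContinuousLinearEquiv.refl ℝ _)
    (ContinuousLinearEquiv.refl ℝ _) (-(constOp E).comp (ContinuousLinearMap.snd ℝ ℝ E)
      - (ContinuousLinearMap.fst ℝ ℝ E).smulRight w), ?_⟩
  refine h5.congr_fderiv ?_
  ext1
  · ext z <;> simp [z₀, w]
  · ext z <;> simp [z₀, w]

/-- A smooth vector field on a Banach space has, near every point, a smooth local flow. With
`ψ(s, x)` the solution of `γ' = s v(γ)`, `γ 0 = x` on `[-1, 1]`, the flow is `F(s, x) = ψ(s, x) 1`: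
all times are reached at parameter `1`, so that smoothness in `(s, x)` gives smoothness in time. -/
theorem exists_smooth_local_flow {v : E → E} (hv : ContDiff ℝ ∞ v) (x₀ : E) :
    ∃ ε > 0, ∃ U ∈ 𝓝 x₀, ∃ F : ℝ × E → E, IsOpen U ∧ ContDiffOn ℝ ∞ F (Ioo (-ε) ε ×ˢ U) ∧
      (∀ x ∈ U, F (0, x) = x) ∧
      ∀ x ∈ U, ∀ t ∈ Ioo (-ε) ε, HasDerivAt (fun s => F (s, x)) (v (F (t, x))) t := by
  lift v to C(E, E) using hv.continuous
  set z₀ : (ℝ × E) × C(Icc (-1 : ℝ) 1, E) := ((0, x₀), ContinuousMap.const _ x₀) with hz₀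
  obtain ⟨A, hA⟩ := hasFDerivAt_picardMap hv x₀
  have hP := contDiff_picardMap hv
  set Φ := hP.contDiffAt.toOpenPartialHomeomorph (picardMap v) hA (by simp)
  have hΦ : (Φ : _ → _) = picardMap v := rfl
  have hO : IsOpen (fderiv ℝ (picardMap v) ⁻¹' range
      (fun e : ((ℝ × E) × C(Icc (-1 : ℝ) 1, E)) ≃L[ℝ] ((ℝ × E) × C(Icc (-1 : ℝ) 1, E)) =>
        (e : ((ℝ × E) × C(Icc (-1 : ℝ) 1, E)) →L[ℝ] ((ℝ × E) × C(Icc (-1 : ℝ) 1, E))))) :=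
    ContinuousLinearEquiv.isOpen.preimage (hP.continuous_fderiv (by simp))
  have hmem : z₀ ∈ Φ.source := hP.contDiffAt.mem_toOpenPartialHomeomorph_source hA (by simp)
  obtain ⟨r, hr, hball⟩ := Metric.isOpen_iff.1 (Φ.open_source.inter hO) z₀ ⟨hmem, A, hA.fderiv.symm⟩
  have hPz₀ : picardMap v z₀ = ((0, x₀), 0) := by simp [picardMap, hz₀]
  have htarget : ((0, x₀), 0) ∈ Φ.target := by
    have := Φ.map_source hmem
    rwa [hΦ, hPz₀] at this
  have hsymm0 : Φ.symm ((0, x₀), 0) = z₀ := by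
    rw [← hPz₀, ← hΦ, Φ.left_inv hmem]
  -- points `u = (s, x)` near `(0, x₀)` at which the inverse of `picardMap v` stays close to `z₀`
  have hnear : ∀ᶠ u : ℝ × E in 𝓝 (0, x₀),
      ((u, 0) : (ℝ × E) × C(Icc (-1 : ℝ) 1, E)) ∈ Φ.target ∧ Φ.symm (u, 0) ∈ Metric.ball z₀ r := by
    have hc : ContinuousAt
        (fun u : ℝ × E => ((u, 0) : (ℝ × E) × C(Icc (-1 : ℝ) 1, E))) (0, x₀) := by
      fun_prop
    refine (hc.eventually (Φ.open_target.mem_nhds htarget)).and ?_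
    have h2 : ContinuousAt Φ.symm ((0, x₀), 0) := Φ.continuousAt_symm htarget
    have h3 : Tendsto (fun u : ℝ × E => Φ.symm (u, 0)) (𝓝 (0, x₀)) (𝓝 z₀) := by
      rw [← hsymm0]; exact h2.tendsto.comp hc
    exact h3 (Metric.ball_mem_nhds _ hr)
  obtain ⟨ε, hε, hεball⟩ := Metric.eventually_nhds_iff_ball.1 hnear
  set ψ : ℝ × E → C(Icc (-1 : ℝ) 1, E) := fun u => (Φ.symm (u, 0)).2 with hψ
  have hu : ∀ {s : ℝ} {x : E}, s ∈ Ioo (-ε) ε → x ∈ Metric.ball x₀ ε →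
      ((s, x) : ℝ × E) ∈ Metric.ball ((0 : ℝ), x₀) ε := fun {s x} hs hx => by
    rw [← ball_prod_same, Real.ball_eq_Ioo]
    exact ⟨by simpa using hs, hx⟩
  have hψeq : ∀ u ∈ Metric.ball ((0 : ℝ), x₀) ε, Φ.symm (u, 0) = (u, ψ u) := by
    intro u h
    have h1 := Φ.right_inv (hεball u h).1
    rw [hΦ] at h1
    have h2 := congrArg Prod.fst h1
    exact Prod.ext h2 rfl
  have hsol : ∀ u ∈ Metric.ball ((0 : ℝ), x₀) ε, ψ u - ContinuousMap.const _ u.2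
      - u.1 • integralOp E (v.comp (ψ u)) = 0 := by
    intro u h
    have h1 := Φ.right_inv (hεball u h).1
    rw [hΦ, hψeq u h] at h1
    exact congrArg Prod.snd h1
  have hψball : ∀ u ∈ Metric.ball ((0 : ℝ), x₀) ε,
      ψ u ∈ Metric.ball (ContinuousMap.const _ x₀) r := by
    intro u h
    have h1 := (hεball u h).2
    rw [hψeq u h, hz₀, ← ball_prod_same] at h1
    exact h1.2
  have hubr : ∀ u ∈ Metric.ball ((0 : ℝ), x₀) ε, u ∈ Metric.ball ((0 : ℝ), x₀) r := by
    intro u h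
    have h1 := (hεball u h).2
    rw [hψeq u h, hz₀, ← ball_prod_same] at h1
    exact h1.1
  have huniq : ∀ u ∈ Metric.ball ((0 : ℝ), x₀) ε, ∀ γ ∈ Metric.ball (ContinuousMap.const _ x₀) r,
      γ - ContinuousMap.const _ u.2 - u.1 • integralOp E (v.comp γ) = 0 → γ = ψ u := by
    intro u h γ hγ h0
    have hm : ∀ η ∈ Metric.ball (ContinuousMap.const _ x₀) r, (u, η) ∈ Φ.source := fun η hη =>
      (hball (by rw [hz₀, ← ball_prod_same]; exact ⟨hubr u h, hη⟩)).1
    have h1 := Φ.injOn (hm γ hγ) (hm _ (hψball u h)) (by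
      rw [hΦ]; simp only [picardMap]; rw [h0, hsol u h])
    exact congrArg Prod.snd h1
  have hval : ∀ u ∈ Metric.ball ((0 : ℝ), x₀) ε, ∀ t : Icc (-1 : ℝ) 1, ψ u t = u.2 +
      u.1 • ∫ τ in (0 : ℝ)..t, IccExtend (by norm_num) (v.comp (ψ u)) τ := by
    intro u h t
    have := congrArg (fun γ : C(Icc (-1 : ℝ) 1, E) => γ t) (hsol u h)
    simp only [ContinuousMap.sub_apply, ContinuousMap.const_apply, ContinuousMap.smul_apply,
      integralOp_apply, ContinuousMap.zero_apply] at this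
    rw [sub_sub, sub_eq_zero] at this
    exact this
  -- rescaling time by `t` turns the solution for the speed `s` into the one for the speed `t * s`
  have hscale : ∀ s ∈ Ioo (-ε) ε, ∀ x ∈ Metric.ball x₀ ε, ∀ t : Icc (-1 : ℝ) 1,
      ψ ((t : ℝ) * s, x) ⟨1, by norm_num⟩ = ψ (s, x) t := by
    intro s hs x hx t
    have hts : (t : ℝ) * s ∈ Ioo (-ε) ε := by
      rw [mem_Ioo, ← abs_lt] at hs ⊢
      rw [abs_mul]
      exact (mul_le_of_le_one_left (abs_nonneg _) (abs_le.2 t.2)).trans_lt hs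
    have hmt : ∀ τ : Icc (-1 : ℝ) 1, (t : ℝ) * τ ∈ Icc (-1 : ℝ) 1 := fun τ => by
      rw [mem_Icc, ← abs_le, abs_mul]
      exact mul_le_one₀ (abs_le.2 t.2) (abs_nonneg _) (abs_le.2 τ.2)
    let γ : C(Icc (-1 : ℝ) 1, E) := ⟨fun τ => ψ (s, x) ⟨(t : ℝ) * τ, hmt τ⟩, by fun_prop⟩
    have hγ : γ = ψ ((t : ℝ) * s, x) := by
      refine huniq _ (hu hts hx) γ ?_ ?_
      · rw [Metric.mem_ball, ContinuousMap.dist_lt_iff hr]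
        intro τ
        exact (ContinuousMap.dist_lt_iff hr).1 (hψball _ (hu hs hx)) ⟨(t : ℝ) * τ, hmt τ⟩
      · ext τ
        simp only [ContinuousMap.sub_apply, ContinuousMap.const_apply, ContinuousMap.smul_apply,
          integralOp_apply, ContinuousMap.zero_apply]
        rw [sub_sub, sub_eq_zero]
        change ψ (s, x) ⟨(t : ℝ) * τ, hmt τ⟩ = _
        rw [hval _ (hu hs hx)]
        simp only
        congr 1
        rw [mul_comm (t : ℝ) s, mul_smul]
        congr 1
        have := intervalIntegral.smul_integral_comp_mul_left (a := 0) (b := (τ : ℝ))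
          (fun τ => IccExtend (by norm_num : (-1 : ℝ) ≤ 1) (v.comp (ψ (s, x))) τ) (t : ℝ)
        rw [mul_zero] at this
        rw [← this]
        congr 1
        refine intervalIntegral.integral_congr fun σ hσ => ?_
        have hσ' : σ ∈ Icc (-1 : ℝ) 1 := by
          have h0 : uIcc (0 : ℝ) τ ⊆ Icc (-1) 1 :=
            ordConnected_Icc.uIcc_subset (by norm_num) τ.2
          exact h0 hσ
        rw [IccExtend_of_mem _ _ (hmt ⟨σ, hσ'⟩), IccExtend_of_mem _ _ hσ']
        rfl
    rw [← hγ]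
    simp [γ]
  refine ⟨ε, hε, Metric.ball x₀ ε, Metric.ball_mem_nhds _ hε, fun u => ψ u ⟨1, by norm_num⟩,
    Metric.isOpen_ball, ?_, ?_, ?_⟩
  · rintro ⟨s, x⟩ ⟨hs, hx⟩
    have hb := hu hs hx
    obtain ⟨B, hB⟩ := (hball (hεball _ hb).2).2
    have h1 : ContDiffAt ℝ ∞ Φ.symm ((s, x), 0) := by
      refine Φ.contDiffAt_symm (f₀' := B) (hεball _ hb).1 ?_ hP.contDiffAt
      simp only at hB
      rw [hB]
      exact (hP.differentiable (by simp) _).hasFDerivAt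
    have h2 : ContDiffAt ℝ ∞ ψ (s, x) := by
      have h3 : ContDiffAt ℝ ∞
          (fun u : ℝ × E => ((u, 0) : (ℝ × E) × C(Icc (-1 : ℝ) 1, E))) (s, x) := by fun_prop
      exact contDiffAt_snd.comp _ (h1.comp (s, x) h3)
    exact ((ContinuousMap.evalCLM ℝ (⟨1, by norm_num⟩ : Icc (-1 : ℝ) 1)).contDiff.contDiffAt.comp
      _ h2).contDiffWithinAt
  · intro x hx
    have h0 := hval _ (hu (s := 0) ⟨by linarith, hε⟩ hx) ⟨1, by norm_num⟩
    simpa using h0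
  · intro x hx t ht
    obtain ⟨s, hs1, hs2⟩ := exists_between (abs_lt.2 ht)
    have hs0 : 0 < s := (abs_nonneg t).trans_lt hs1
    have hs : s ∈ Ioo (-ε) ε := ⟨by linarith, hs2⟩
    have hts : t / s ∈ Ioo (-1 : ℝ) 1 := by
      rw [mem_Ioo, ← abs_lt, abs_div, abs_of_pos hs0, div_lt_one hs0]; exact hs1
    set w := IccExtend (by norm_num : (-1 : ℝ) ≤ 1) (v.comp (ψ (s, x))) with hw
    have hwc : Continuous w := (v.comp (ψ (s, x))).continuous.Icc_extend'
    have h1 : HasDerivAt (fun τ : ℝ => x + s • ∫ τ in (0 : ℝ)..τ, w τ) (s • w (t / s)) (t / s) :=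
      ((intervalIntegral.integral_hasDerivAt_right (hwc.intervalIntegrable _ _)
        (hwc.stronglyMeasurableAtFilter _ _) hwc.continuousAt).const_smul s).const_add x
    have h2 : HasDerivAt (fun σ : ℝ => σ / s) (1 / s) t := (hasDerivAt_id t).div_const s
    have h3 := h1.scomp t h2
    have hFt : ∀ σ : ℝ, ∀ hσ : σ / s ∈ Ioo (-1 : ℝ) 1, ψ (σ, x) ⟨1, by norm_num⟩ =
        ψ (s, x) ⟨σ / s, Ioo_subset_Icc_self hσ⟩ := fun σ hσ => by
      have := hscale s hs x hx ⟨σ / s, Ioo_subset_Icc_self hσ⟩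
      simp only [div_mul_cancel₀ _ hs0.ne'] at this
      exact this
    have h4 : (1 / s) • s • w (t / s) = v (ψ (t, x) ⟨1, by norm_num⟩) := by
      rw [smul_smul, one_div, inv_mul_cancel₀ hs0.ne', one_smul, hw,
        IccExtend_of_mem _ _ (Ioo_subset_Icc_self hts), hFt t hts]
      rfl
    rw [h4] at h3
    refine h3.congr_of_eventuallyEq ?_
    have : ∀ᶠ σ in 𝓝 t, σ / s ∈ Ioo (-1 : ℝ) 1 :=
      (continuous_id.div_const s).continuousAt.eventually (Ioo_mem_nhds hts.1 hts.2)
    filter_upwards [this] with σ hσ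
    rw [hFt σ hσ, hval _ (hu hs hx)]
    rfl

end LocalFlow

/-! ### Flows of compactly supported vector fields on manifolds -/

section ManifoldFlow

variable {E : Type*} [NormedAddCommGroup E] [NormedSpace ℝ E] [FiniteDimensional ℝ E]
  {M : Type*} [TopologicalSpace M] [ChartedSpace E M] [IsManifold 𝓘(ℝ, E) ∞ M]
  {V : (x : M) → TangentSpace 𝓘(ℝ, E) x}

omit [FiniteDimensional ℝ E] in
/-- The components of a smooth vector field in a chart are smooth. -/
theorem contDiffOn_chart_vectorField
    (hV : ContMDiff 𝓘(ℝ, E) 𝓘(ℝ, E).tangent ∞ (fun x => (⟨x, V x⟩ : TangentBundle 𝓘(ℝ, E) M)))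
    (x₀ : M) :
    ContDiffOn ℝ ∞ (fun y => (mfderiv 𝓘(ℝ, E) 𝓘(ℝ, E) (extChartAt 𝓘(ℝ, E) x₀)
      ((extChartAt 𝓘(ℝ, E) x₀).symm y) (V ((extChartAt 𝓘(ℝ, E) x₀).symm y)) : E))
      (extChartAt 𝓘(ℝ, E) x₀).target := by
  have h1 : ContMDiffOn 𝓘(ℝ, E) 𝓘(ℝ, E) ∞ (extChartAt 𝓘(ℝ, E) x₀) (chartAt E x₀).source :=
    contMDiffOn_extChartAt
  have h2 := h1.contMDiffOn_tangentMapWithin (m := ∞) (by simp)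
    (chartAt E x₀).open_source.uniqueMDiffOn
  have h3 : ContMDiffOn 𝓘(ℝ, E) 𝓘(ℝ, E) ∞ (extChartAt 𝓘(ℝ, E) x₀).symm
    (extChartAt 𝓘(ℝ, E) x₀).target := contMDiffOn_extChartAt_symm x₀
  have h4 := hV.comp_contMDiffOn h3
  have h5 := h2.comp h4 (fun y hy => by
    simpa using (extChartAt 𝓘(ℝ, E) x₀).map_target hy)
  have h6 := contMDiff_snd_tangentBundle_modelSpace E 𝓘(ℝ, E) (n := ∞)
  have h7 := (h6.comp_contMDiffOn h5).contDiffOn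
  refine h7.congr fun y hy => ?_
  have hs : (extChartAt 𝓘(ℝ, E) x₀).symm y ∈ (chartAt E x₀).source := by
    simpa using (extChartAt 𝓘(ℝ, E) x₀).map_target hy
  exact congrArg (fun A => (A (V ((extChartAt 𝓘(ℝ, E) x₀).symm y)) : E))
    (mfderivWithin_of_isOpen (I := 𝓘(ℝ, E)) (I' := 𝓘(ℝ, E)) (f := extChartAt 𝓘(ℝ, E) x₀)
      (chartAt E x₀).open_source hs).symm

/-- A smooth vector field on a manifold has, near every point, a smooth local flow. -/
theorem exists_smooth_local_flow_manifold
    (hV : ContMDiff 𝓘(ℝ, E) 𝓘(ℝ, E).tangent ∞ (fun x => (⟨x, V x⟩ : TangentBundle 𝓘(ℝ, E) M)))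
    (x₀ : M) :
    ∃ ε > 0, ∃ U ∈ 𝓝 x₀, ∃ F : ℝ × M → M, IsOpen U ∧
      ContMDiffOn (𝓘(ℝ, ℝ).prod 𝓘(ℝ, E)) 𝓘(ℝ, E) ∞ F (Ioo (-ε) ε ×ˢ U) ∧
      (∀ x ∈ U, F (0, x) = x) ∧
      ∀ x ∈ U, IsMIntegralCurveOn (fun t => F (t, x)) V (Ioo (-ε) ε) := by
  have : CompleteSpace E := FiniteDimensional.complete ℝ E
  set e := extChartAt 𝓘(ℝ, E) x₀ with he
  set w : E → E := fun y => mfderiv 𝓘(ℝ, E) 𝓘(ℝ, E) e (e.symm y) (V (e.symm y)) with hw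
  have hwd : ContDiffOn ℝ ∞ w e.target := contDiffOn_chart_vectorField hV x₀
  have htgt : IsOpen e.target := isOpen_extChartAt_target x₀
  have hx₀ : x₀ ∈ e.source := mem_extChartAt_source x₀
  have hy₀ : e x₀ ∈ e.target := e.map_source hx₀
  obtain ⟨R, hR, hRt⟩ := Metric.nhds_basis_closedBall.mem_iff.1 (htgt.mem_nhds hy₀)
  let χ : ContDiffBump (e x₀) := ⟨R / 2, R, by positivity, by linarith⟩
  have hv : ContDiff ℝ ∞ (fun y => χ y • w y) := by
    rw [contDiff_iff_contDiffAt]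
    intro y
    by_cases hy : y ∈ e.target
    · exact χ.contDiff.contDiffAt.smul (hwd.contDiffAt (htgt.mem_nhds hy))
    · have : y ∉ tsupport χ := fun h => hy (hRt (by rwa [χ.tsupport_eq] at h))
      refine contDiffAt_const (c := (0 : E)) |>.congr_of_eventuallyEq ?_
      filter_upwards [(isClosed_tsupport χ).isOpen_compl.mem_nhds this] with z hz
      rw [image_eq_zero_of_notMem_tsupport hz, zero_smul]
  obtain ⟨ε, hε, U, hU, F, hUo, hF, hF0, hFd⟩ := exists_smooth_local_flow hv (e x₀)
  have hFc : ContinuousAt F (0, e x₀) :=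
    (hF.contDiffAt (prod_mem_nhds (Ioo_mem_nhds (by linarith) hε) hU)).continuousAt
  have hnear : ∀ᶠ z in 𝓝 ((0 : ℝ), e x₀), F z ∈ Metric.ball (e x₀) (R / 2) := by
    refine hFc.eventually (Metric.isOpen_ball.mem_nhds ?_)
    rw [hF0 _ (mem_of_mem_nhds hU)]
    exact Metric.mem_ball_self (by positivity)
  rw [nhds_prod_eq] at hnear
  obtain ⟨T, hT, U', hU', hTU⟩ := Filter.mem_prod_iff.1 hnear
  obtain ⟨δ, hδ, hδT⟩ := Metric.mem_nhds_iff.1 hT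
  rw [Real.ball_eq_Ioo, zero_sub, zero_add] at hδT
  obtain ⟨U'', hU''s, hU''o, hU''m⟩ := mem_nhds_iff.1 (inter_mem hU hU')
  set ε' := min ε δ
  have hε' : 0 < ε' := lt_min hε hδ
  have hsub1 : Ioo (-ε') ε' ⊆ Ioo (-ε) ε :=
    Ioo_subset_Ioo (neg_le_neg (min_le_left _ _)) (min_le_left _ _)
  have hsub2 : Ioo (-ε') ε' ⊆ T := (Ioo_subset_Ioo (neg_le_neg (min_le_right _ _))
    (min_le_right _ _)).trans hδT
  have hball : ∀ t ∈ Ioo (-ε') ε', ∀ y ∈ U'', F (t, y) ∈ Metric.ball (e x₀) (R / 2) :=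
    fun t ht y hy => hTU (mk_mem_prod (hsub2 ht) (hU''s hy).2)
  have hballt : Metric.ball (e x₀) (R / 2) ⊆ e.target := fun y hy =>
    hRt (Metric.ball_subset_closedBall (Metric.ball_subset_ball (by linarith) hy))
  have hUM : IsOpen (e.source ∩ e ⁻¹' U'') := by
    rw [he, extChartAt_source]
    exact (contMDiffOn_extChartAt (n := ∞) (I := 𝓘(ℝ, E))).continuousOn.isOpen_inter_preimage
      (chartAt E x₀).open_source hU''o
  refine ⟨ε', hε', e.source ∩ e ⁻¹' U'', hUM.mem_nhds ⟨hx₀, hU''m⟩,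
    fun z => e.symm (F (z.1, e z.2)), hUM, ?_, ?_, ?_⟩
  · have h1 : ContMDiffOn (𝓘(ℝ, ℝ).prod 𝓘(ℝ, E)) 𝓘(ℝ, ℝ × E) ∞ (fun z : ℝ × M => (z.1, e z.2))
        (Ioo (-ε') ε' ×ˢ (e.source ∩ e ⁻¹' U'')) := by
      have h2 : ContMDiffOn (𝓘(ℝ, ℝ).prod 𝓘(ℝ, E)) 𝓘(ℝ, E) ∞ (fun z : ℝ × M => e z.2)
          (Ioo (-ε') ε' ×ˢ (e.source ∩ e ⁻¹' U'')) :=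
        (contMDiffOn_extChartAt (n := ∞) (I := 𝓘(ℝ, E)) (x := x₀)).comp contMDiffOn_snd
          (fun z hz => by simpa [he] using hz.2.1)
      have h3 : ContMDiffOn (𝓘(ℝ, ℝ).prod 𝓘(ℝ, E)) 𝓘(ℝ, ℝ) ∞ (fun z : ℝ × M => z.1)
          (Ioo (-ε') ε' ×ˢ (e.source ∩ e ⁻¹' U'')) := contMDiffOn_fst
      exact h3.prodMk_space h2
    have h2 : ContMDiffOn 𝓘(ℝ, ℝ × E) 𝓘(ℝ, E) ∞ F (Ioo (-ε) ε ×ˢ U) := hF.contMDiffOn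
    have h3 := h2.comp h1 (fun z hz => ⟨hsub1 hz.1, (hU''s hz.2.2).1⟩)
    exact (contMDiffOn_extChartAt_symm (n := ∞) (I := 𝓘(ℝ, E)) x₀).comp h3
      (fun z hz => hballt (hball _ hz.1 _ hz.2.2))
  · intro x hx
    simp only
    rw [hF0 _ (hU''s hx.2).1, e.left_inv hx.1]
  · intro x hx t ht
    refine HasMFDerivAt.hasMFDerivWithinAt ?_
    have hb := hball t ht _ hx.2
    have h1 := hFd (e x) (hU''s hx.2).1 t (hsub1 ht)
    have hχ : χ (F (t, e x)) = 1 := χ.one_of_mem_closedBall (Metric.ball_subset_closedBall hb)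
    rw [hχ, one_smul] at h1
    have h2 : MDifferentiableAt 𝓘(ℝ, E) 𝓘(ℝ, E) e.symm (F (t, e x)) :=
      ((contMDiffOn_extChartAt_symm (n := ∞) (I := 𝓘(ℝ, E)) x₀).contMDiffAt
        (htgt.mem_nhds (hballt hb))).mdifferentiableAt (by simp)
    have h3 := h2.hasMFDerivAt.comp t (h1.hasFDerivAt.hasMFDerivAt)
    refine h3.congr_mfderiv ?_
    ext
    have h4 : MDifferentiableAt 𝓘(ℝ, E) 𝓘(ℝ, E) e (e.symm (F (t, e x))) :=
      mdifferentiableAt_extChartAt (by simpa [he] using e.map_target (hballt hb))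
    have h5 : mfderiv 𝓘(ℝ, E) 𝓘(ℝ, E) (e.symm ∘ e) (e.symm (F (t, e x)))
        = ContinuousLinearMap.id ℝ _ := by
      rw [← mfderiv_id]
      refine Filter.EventuallyEq.mfderiv_eq ?_
      filter_upwards [(isOpen_extChartAt_source (I := 𝓘(ℝ, E)) x₀).mem_nhds
        (e.map_target (hballt hb))] with z hz
      exact e.left_inv hz
    have h6 := mfderiv_comp (I := 𝓘(ℝ, E)) (I' := 𝓘(ℝ, E)) (I'' := 𝓘(ℝ, E))
      (e.symm (F (t, e x))) (g := e.symm) (f := e)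
      (by rw [e.right_inv (hballt hb)]; exact h2) h4
    rw [h5, e.right_inv (hballt hb)] at h6
    have h7 : mfderiv 𝓘(ℝ, E) 𝓘(ℝ, E) e.symm (F (t, e x)) (w (F (t, e x)))
        = V (e.symm (F (t, e x))) :=
      (congrArg (fun A => A (V (e.symm (F (t, e x))))) h6).symm
    exact (congrArg (mfderiv 𝓘(ℝ, E) 𝓘(ℝ, E) e.symm (F (t, e x))) (one_smul ℝ _)).trans
      (h7.trans (one_smul ℝ _).symm)

/-- A compactly supported smooth vector field has smooth local flows with a common time of
existence. -/
theorem exists_uniform_local_flow [T2Space M]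
    (hV : ContMDiff 𝓘(ℝ, E) 𝓘(ℝ, E).tangent ∞ (fun x => (⟨x, V x⟩ : TangentBundle 𝓘(ℝ, E) M)))
    {K : Set M} (hK : IsCompact K) (hVK : ∀ x ∉ K, V x = 0) :
    ∃ ε > 0, ∀ x₀ : M, ∃ U ∈ 𝓝 x₀, ∃ F : ℝ × M → M, IsOpen U ∧
      ContMDiffOn (𝓘(ℝ, ℝ).prod 𝓘(ℝ, E)) 𝓘(ℝ, E) ∞ F (Ioo (-ε) ε ×ˢ U) ∧
      (∀ x ∈ U, F (0, x) = x) ∧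
      ∀ x ∈ U, IsMIntegralCurveOn (fun t => F (t, x)) V (Ioo (-ε) ε) := by
  have hind : ∃ ε > 0, ∀ x₀ ∈ K, ∃ U ∈ 𝓝 x₀, ∃ F : ℝ × M → M, IsOpen U ∧
      ContMDiffOn (𝓘(ℝ, ℝ).prod 𝓘(ℝ, E)) 𝓘(ℝ, E) ∞ F (Ioo (-ε) ε ×ˢ U) ∧
      (∀ x ∈ U, F (0, x) = x) ∧
      ∀ x ∈ U, IsMIntegralCurveOn (fun t => F (t, x)) V (Ioo (-ε) ε) := by
    have hmono : ∀ {ε ε' : ℝ}, ε' ≤ ε → Ioo (-ε') ε' ⊆ Ioo (-ε) ε := fun h =>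
      Ioo_subset_Ioo (neg_le_neg h) h
    refine hK.induction_on (p := fun K => ∃ ε > 0, ∀ x₀ ∈ K, ∃ U ∈ 𝓝 x₀, ∃ F : ℝ × M → M,
      IsOpen U ∧ ContMDiffOn (𝓘(ℝ, ℝ).prod 𝓘(ℝ, E)) 𝓘(ℝ, E) ∞ F (Ioo (-ε) ε ×ˢ U) ∧
      (∀ x ∈ U, F (0, x) = x) ∧
      ∀ x ∈ U, IsMIntegralCurveOn (fun t => F (t, x)) V (Ioo (-ε) ε)) ?_ ?_ ?_ ?_
    · exact ⟨1, one_pos, fun x hx => hx.elim⟩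
    · rintro s t hst ⟨ε, hε, h⟩
      exact ⟨ε, hε, fun x hx => h x (hst hx)⟩
    · rintro s t ⟨ε, hε, h⟩ ⟨ε', hε', h'⟩
      refine ⟨min ε ε', lt_min hε hε', fun x hx => ?_⟩
      rcases hx with hx | hx
      · obtain ⟨U, hU, F, hUo, hF, hF0, hFc⟩ := h x hx
        exact ⟨U, hU, F, hUo, hF.mono (prod_mono (hmono (min_le_left _ _)) le_rfl), hF0,
          fun y hy => (hFc y hy).mono (hmono (min_le_left _ _))⟩
      · obtain ⟨U, hU, F, hUo, hF, hF0, hFc⟩ := h' x hx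
        exact ⟨U, hU, F, hUo, hF.mono (prod_mono (hmono (min_le_right _ _)) le_rfl), hF0,
          fun y hy => (hFc y hy).mono (hmono (min_le_right _ _))⟩
    · intro x _
      obtain ⟨ε, hε, U, hU, F, hUo, hF⟩ := exists_smooth_local_flow_manifold hV x
      exact ⟨U, mem_nhdsWithin_of_mem_nhds hU, ε, hε, fun y hy =>
        ⟨U, hUo.mem_nhds hy, F, hUo, hF⟩⟩
  obtain ⟨ε, hε, h⟩ := hind
  refine ⟨ε, hε, fun x₀ => ?_⟩
  by_cases hx : x₀ ∈ K
  · exact h x₀ hx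
  · exact ⟨Kᶜ, hK.isClosed.isOpen_compl.mem_nhds hx, Prod.snd, hK.isClosed.isOpen_compl,
      contMDiffOn_snd, fun _ _ => rfl,
      fun x hx => (isMIntegralCurve_const (hVK x hx)).isMIntegralCurveOn _⟩

/-- A compactly supported smooth vector field is complete, and its flow is smooth: smoothness for
small times propagates to all times by the group law. -/
theorem exists_smooth_flow [T2Space M]
    (hV : ContMDiff 𝓘(ℝ, E) 𝓘(ℝ, E).tangent ∞ (fun x => (⟨x, V x⟩ : TangentBundle 𝓘(ℝ, E) M)))
    {K : Set M} (hK : IsCompact K) (hVK : ∀ x ∉ K, V x = 0) :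
    ∃ Φ : ℝ → M → M,
      ContMDiff (𝓘(ℝ, ℝ).prod 𝓘(ℝ, E)) 𝓘(ℝ, E) ∞ (fun z : ℝ × M => Φ z.1 z.2) ∧
      (∀ x, Φ 0 x = x) ∧ (∀ s t x, Φ (s + t) x = Φ s (Φ t x)) ∧
      ∀ x, IsMIntegralCurve (fun t => Φ t x) V := by
  have : CompleteSpace E := FiniteDimensional.complete ℝ E
  have : IsManifold 𝓘(ℝ, E) 1 M := IsManifold.of_le (n := ∞) (by norm_cast)
  have hV1 := hV.of_le (m := 1) (by norm_cast)
  obtain ⟨ε, hε, hloc⟩ := exists_uniform_local_flow hV hK hVK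
  have hglob : ∀ x : M, ∃ γ : ℝ → M, γ 0 = x ∧ IsMIntegralCurve γ V := by
    refine exists_isMIntegralCurve_of_isMIntegralCurveOn hV1 hε fun x => ?_
    obtain ⟨U, hU, F, -, -, hF0, hFc⟩ := hloc x
    exact ⟨fun t => F (t, x), hF0 x (mem_of_mem_nhds hU), hFc x (mem_of_mem_nhds hU)⟩
  choose γ hγ0 hγ using hglob
  have hgroup : ∀ s t x, γ x (s + t) = γ (γ x t) s := by
    intro s t x
    have h1 : IsMIntegralCurve (γ x ∘ (· + t)) V := (hγ x).comp_add t
    have h2 := isMIntegralCurve_Ioo_eq_of_contMDiff_boundaryless (t₀ := 0) hV1 h1 (hγ (γ x t))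
      (by simp [hγ0])
    exact congrFun h2 s
  have hsmall : ∀ x₀ : M, ∃ U ∈ 𝓝 x₀, ContMDiffOn (𝓘(ℝ, ℝ).prod 𝓘(ℝ, E)) 𝓘(ℝ, E) ∞
      (fun z : ℝ × M => γ z.2 z.1) (Ioo (-ε) ε ×ˢ U) := by
    intro x₀
    obtain ⟨U, hU, F, -, hF, hF0, hFc⟩ := hloc x₀
    refine ⟨U, hU, hF.congr ?_⟩
    rintro ⟨t, x⟩ ⟨ht, hx⟩
    exact isMIntegralCurveOn_Ioo_eqOn_of_contMDiff_boundaryless (t₀ := 0)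
      ⟨by linarith, hε⟩ hV1 ((hγ x).isMIntegralCurveOn _) (hFc x hx)
      (by rw [hF0 x hx, hγ0]) ht
  have hsm : ∀ t ∈ Ioo (-ε) ε, ContMDiff 𝓘(ℝ, E) 𝓘(ℝ, E) ∞ (fun x => γ x t) := by
    intro t ht x₀
    obtain ⟨U, hU, hF⟩ := hsmall x₀
    have h1 := hF.contMDiffAt (x := (t, x₀)) (prod_mem_nhds (Ioo_mem_nhds ht.1 ht.2) hU)
    exact h1.comp x₀ (contMDiffAt_const.prodMk contMDiffAt_id)
  have hiter : ∀ τ ∈ Ioo (-ε) ε, ∀ n : ℕ,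
      ContMDiff 𝓘(ℝ, E) 𝓘(ℝ, E) ∞ (fun x => γ x (n * τ)) := by
    intro τ hτ n
    induction n with
    | zero =>
      simp only [Nat.cast_zero, zero_mul, hγ0]
      exact contMDiff_id
    | succ n ih =>
      have : (fun x => γ x ((n + 1 : ℕ) * τ)) = (fun x => γ x τ) ∘ fun x => γ x (n * τ) := by
        funext x
        simp only [Function.comp_apply, ← hgroup]
        congr 1
        push_cast
        ring
      rw [this]
      exact (hsm τ hτ).comp ih
  have hall : ∀ t, ContMDiff 𝓘(ℝ, E) 𝓘(ℝ, E) ∞ (fun x => γ x t) := by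
    intro t
    obtain ⟨n, hn⟩ := exists_nat_gt (|t| / ε)
    have hn0 : (0 : ℝ) < n := (by positivity : 0 ≤ |t| / ε).trans_lt hn
    have h1 : t / n ∈ Ioo (-ε) ε := by
      rw [mem_Ioo, ← abs_lt, abs_div, abs_of_pos hn0, div_lt_iff₀ hn0]
      rwa [div_lt_iff₀ hε, mul_comm] at hn
    have h2 := hiter _ h1 n
    rwa [mul_div_cancel₀ t hn0.ne'] at h2
  refine ⟨fun t x => γ x t, ?_, hγ0, fun s t x => hgroup s t x, hγ⟩
  rintro ⟨t₀, x₀⟩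
  obtain ⟨U, hU, hF⟩ := hsmall (γ x₀ t₀)
  have h1 := hF.contMDiffAt (x := (0, γ x₀ t₀)) (prod_mem_nhds (Ioo_mem_nhds (by linarith) hε) hU)
  have h2 : ContMDiffAt (𝓘(ℝ, ℝ).prod 𝓘(ℝ, E)) (𝓘(ℝ, ℝ).prod 𝓘(ℝ, E)) ∞
      (fun z : ℝ × M => (z.1 - t₀, γ z.2 t₀)) (t₀, x₀) := by
    refine ContMDiffAt.prodMk ?_ ?_
    · have h3 : ContMDiffAt 𝓘(ℝ, ℝ) 𝓘(ℝ, ℝ) ∞ (fun t : ℝ => t - t₀) t₀ :=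
        (contDiff_id.sub contDiff_const).contDiffAt.contMDiffAt
      exact ContMDiffAt.comp (I := 𝓘(ℝ, ℝ).prod 𝓘(ℝ, E)) (t₀, x₀) h3
        (contMDiffAt_fst (M := ℝ) (N := M))
    · exact ContMDiffAt.comp (I := 𝓘(ℝ, ℝ).prod 𝓘(ℝ, E)) (t₀, x₀) ((hall t₀).contMDiffAt (x := x₀))
        (contMDiffAt_snd (M := ℝ) (N := M))
  rw [← sub_self t₀] at h1
  have h3 := ContMDiffAt.comp (t₀, x₀) h1 h2
  refine h3.congr_of_eventuallyEq (Eventually.of_forall fun z => ?_)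
  simp only [Function.comp_apply, ← hgroup, sub_add_cancel]

end ManifoldFlow

/-! ### Lengths of paths under Lipschitz maps -/

section Length

open scoped ENNReal

variable {E : Type*} [NormedAddCommGroup E] [NormedSpace ℝ E]
  {H : Type*} [TopologicalSpace H] {I : ModelWithCorners ℝ E H}
  {M : Type*} [TopologicalSpace M] [ChartedSpace H M] [∀ x : M, ENorm (TangentSpace I x)]
  {E' : Type*} [NormedAddCommGroup E'] [NormedSpace ℝ E']
  {H' : Type*} [TopologicalSpace H'] {I' : ModelWithCorners ℝ E' H'}
  {N : Type*} [TopologicalSpace N] [ChartedSpace H' N] [∀ x : N, ENorm (TangentSpace I' x)]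

/-- A map whose differential stretches tangent vectors along a path by at most the factor `C`
stretches the length of the path by at most `C`. -/
theorem pathELength_comp_le {Ψ : M → N} {γ : ℝ → M} {a b : ℝ} {C : ℝ≥0∞} (hC : C ≠ ⊤)
    (hΨ : MDifferentiable I I' Ψ) (hγ : ContMDiffOn 𝓘(ℝ, ℝ) I 1 γ (Icc a b))
    (h : ∀ t ∈ Icc a b, ∀ v : TangentSpace I (γ t),
      ‖mfderiv I I' Ψ (γ t) v‖ₑ ≤ C * ‖v‖ₑ) :
    pathELength I' (Ψ ∘ γ) a b ≤ C * pathELength I γ a b := by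
  rw [pathELength_eq_lintegral_mfderiv_Ioo, pathELength_eq_lintegral_mfderiv_Ioo,
    ← MeasureTheory.lintegral_const_mul' _ _ hC]
  refine MeasureTheory.setLIntegral_mono' measurableSet_Ioo fun t ht => ?_
  have h1 : MDifferentiableAt 𝓘(ℝ, ℝ) I γ t :=
    ((hγ t (Ioo_subset_Icc_self ht)).contMDiffAt (Icc_mem_nhds ht.1 ht.2)).mdifferentiableAt
      one_ne_zero
  rw [mfderiv_comp t (hΨ _) h1]
  exact h t (Ioo_subset_Icc_self ht) _

end Length

/-! ### The Hopf–Rinow theorem -/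

section HopfRinow

variable {E : Type*} [NormedAddCommGroup E] [NormedSpace ℝ E]
  {H : Type*} [TopologicalSpace H]
  {M : Type*} [MetricSpace M] [ChartedSpace H M]

theorem edist_le_pathELength (I : ModelWithCorners ℝ E H)
    [RiemannianBundle (fun x : M => TangentSpace I x)] [IsRiemannianManifold I M]
    {γ : ℝ → M} {a b : ℝ} (hab : a ≤ b)
    (hγ : ContMDiffOn 𝓘(ℝ, ℝ) I 1 γ (Icc a b)) :
    edist (γ a) (γ b) ≤ pathELength I γ a b := by
  rw [IsRiemannianManifold.out (I := I)]
  exact riemannianEDist_le_pathELength hγ rfl rfl hab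

/-- Points at distance less than `r` are joined by a path of length less than `r`, all of whose
points are at total distance less than `r` from the two endpoints. -/
theorem exists_path_of_dist_lt (I : ModelWithCorners ℝ E H)
    [RiemannianBundle (fun x : M => TangentSpace I x)] [IsRiemannianManifold I M]
    {x y : M} {r : ℝ} (h : dist x y < r) :
    ∃ γ : ℝ → M, γ 0 = x ∧ γ 1 = y ∧ ContMDiffOn 𝓘(ℝ, ℝ) I 1 γ (Icc 0 1) ∧
      pathELength I γ 0 1 < ENNReal.ofReal r ∧
      ∀ t ∈ Icc (0 : ℝ) 1, dist x (γ t) + dist (γ t) y < r := by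
  have hr : 0 < r := dist_nonneg.trans_lt h
  have h1 : riemannianEDist I x y < ENNReal.ofReal r := by
    rw [← IsRiemannianManifold.out (I := I), edist_dist]
    exact (ENNReal.ofReal_lt_ofReal_iff hr).2 h
  obtain ⟨γ, h0, h1, hγ, hlen⟩ := exists_lt_of_riemannianEDist_lt h1
  refine ⟨γ, h0, h1, hγ, hlen, fun t ht => ?_⟩
  have h2 := edist_le_pathELength I ht.1 (hγ.mono (Icc_subset_Icc le_rfl ht.2))
  have h3 := edist_le_pathELength I ht.2 (hγ.mono (Icc_subset_Icc ht.1 le_rfl))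
  have h4 := (add_le_add h2 h3).trans_lt ((pathELength_add ht.1 ht.2).trans_lt hlen)
  rw [h0, h1, edist_dist, edist_dist, ← ENNReal.ofReal_add dist_nonneg dist_nonneg] at h4
  exact (ENNReal.ofReal_lt_ofReal_iff hr).1 h4

/-- In a Riemannian manifold there are points at prescribed distance from `x` that are almost on a
shortest path from `x` to `y`. -/
theorem exists_dist_eq_of_le_dist (I : ModelWithCorners ℝ E H)
    [RiemannianBundle (fun x : M => TangentSpace I x)] [IsRiemannianManifold I M]
    {x y : M} {s r : ℝ} (hs : 0 ≤ s) (hsd : s ≤ dist x y)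
    (h : dist x y < r) : ∃ z, dist x z = s ∧ dist z y < r - s := by
  obtain ⟨γ, h0, h1, hγ, -, hd⟩ := exists_path_of_dist_lt I h
  have hc : ContinuousOn (fun t => dist x (γ t)) (Icc 0 1) :=
    (continuous_const.dist continuous_id).comp_continuousOn hγ.continuousOn
  obtain ⟨t, ht, hts⟩ := intermediate_value_Icc zero_le_one hc
    (show s ∈ Icc _ _ by simpa [h0, h1] using ⟨hs, hsd⟩)
  refine ⟨γ t, hts, ?_⟩
  have := hd t ht
  simp only at hts
  linarith

/-- **Hopf–Rinow**: closed balls of a complete Riemannian manifold are compact. -/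
theorem properSpace_of_complete (I : ModelWithCorners ℝ E H)
    [RiemannianBundle (fun x : M => TangentSpace I x)] [IsRiemannianManifold I M]
    [LocallyCompactSpace M] [CompleteSpace M] : ProperSpace M := by
  refine ⟨fun p => ?_⟩
  -- the set of radii of compact balls is open and closed
  set S : Set ℝ := {r | IsCompact (Metric.closedBall p r)} with hS
  have hdown : ∀ {r r'}, r ∈ S → r' ≤ r → r' ∈ S := fun {r r'} hr h =>
    IsCompact.of_isClosed_subset hr Metric.isClosed_closedBall
      (Metric.closedBall_subset_closedBall h)
  have h0 : (0 : ℝ) ∈ S := by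
    simp only [hS, mem_ofPred_eq, Metric.closedBall_zero]
    exact isCompact_singleton
  have hopen : IsOpen S := by
    rw [Metric.isOpen_iff]
    intro r hr
    rcases lt_or_ge r 0 with hr0 | hr0
    · refine ⟨-r, by linarith, fun r' hr' => hdown h0 ?_⟩
      rw [Real.ball_eq_Ioo] at hr'
      linarith [hr'.2]
    obtain ⟨L, hL, hrL⟩ := exists_compact_superset hr
    obtain ⟨δ, hδ, hδL⟩ := IsCompact.exists_thickening_subset_open hr isOpen_interior hrL
    refine ⟨δ / 2, by positivity, fun r' hr' => ?_⟩
    rw [Real.ball_eq_Ioo] at hr'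
    refine hL.of_isClosed_subset Metric.isClosed_closedBall fun x hx => ?_
    refine interior_subset (hδL ?_)
    rw [Metric.mem_closedBall, dist_comm] at hx
    rw [Metric.mem_thickening_iff]
    rcases le_or_gt (dist p x) r with hxr | hxr
    · exact ⟨x, by rwa [Metric.mem_closedBall, dist_comm], by simpa using hδ⟩
    · obtain ⟨z, hz, hzx⟩ := exists_dist_eq_of_le_dist I hr0 hxr.le
        (show dist p x < dist p x + δ / 2 by linarith)
      refine ⟨z, by rw [Metric.mem_closedBall, dist_comm, hz], ?_⟩
      rw [dist_comm]
      linarith [hr'.2]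
  have hclosed : IsClosed S := by
    refine isClosed_of_closure_subset fun r hr => ?_
    have hlt : ∀ r' < r, r' ∈ S := fun r' hr' => by
      obtain ⟨s, hs, hsr⟩ := Metric.mem_closure_iff.1 hr (r - r') (by linarith)
      rw [Real.dist_eq] at hsr
      exact hdown hs (by linarith [le_abs_self (r - s)])
    refine isCompact_iff_totallyBounded_isComplete.2 ⟨?_, Metric.isClosed_closedBall.isComplete⟩
    rw [Metric.totallyBounded_iff]
    intro ε hε
    -- an `ε / 2`-net of a slightly smaller, compact ball is an `ε`-net of the ball of radius `r`
    have hs : max (r - ε / 4) 0 ∈ S := by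
      rcases max_choice (r - ε / 4) 0 with h | h <;> rw [h]
      · exact hlt _ (by linarith)
      · exact h0
    obtain ⟨t, ht, htc⟩ := Metric.totallyBounded_iff.1 (IsCompact.totallyBounded hs) (ε / 2)
      (by positivity)
    refine ⟨t, ht, fun x hx => ?_⟩
    rw [Metric.mem_closedBall, dist_comm] at hx
    rcases le_or_gt (dist p x) (max (r - ε / 4) 0) with hxr | hxr
    · have := htc (show x ∈ Metric.closedBall p _ by rwa [Metric.mem_closedBall, dist_comm])
      simp only [mem_iUnion, Metric.mem_ball] at this ⊢
      obtain ⟨y, hy, hxy⟩ := this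
      exact ⟨y, hy, by linarith⟩
    · obtain ⟨z, hz, hzx⟩ := exists_dist_eq_of_le_dist I (le_max_right _ _) hxr.le
        (show dist p x < dist p x + ε / 4 by linarith)
      have := htc (show z ∈ Metric.closedBall p _ by rw [Metric.mem_closedBall, dist_comm, hz])
      simp only [mem_iUnion, Metric.mem_ball] at this ⊢
      obtain ⟨y, hy, hzy⟩ := this
      refine ⟨y, hy, ?_⟩
      have h1 := dist_triangle x z y
      rw [dist_comm x z] at h1
      linarith [le_max_left (r - ε / 4) 0]
  have huniv : S = univ := IsClopen.eq_univ ⟨hclosed, hopen⟩ ⟨0, h0⟩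
  intro r
  exact (huniv ▸ mem_univ r : r ∈ S)

end HopfRinow

/-! ### The Gauss equation in coordinates -/

section Gauss

variable {m : ℕ} {F : Type*} [NormedAddCommGroup F] [InnerProductSpace ℝ F]

/-- The `i`-th partial derivative of a map from `ℝᵐ` to a vector space. -/
def partialV (i : Fin m) (f : EuclideanSpace ℝ (Fin m) → F) (y : EuclideanSpace ℝ (Fin m)) : F :=
  fderiv ℝ f y (EuclideanSpace.single i 1)

theorem contDiffAt_partialV {f : EuclideanSpace ℝ (Fin m) → F} {y : EuclideanSpace ℝ (Fin m)}
    (hf : ContDiffAt ℝ ∞ f y) (i : Fin m) : ContDiffAt ℝ ∞ (partialV i f) y :=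
  (hf.fderiv_right (m := ∞) (by simp)).clm_apply contDiffAt_const

theorem partialV_partialV {f : EuclideanSpace ℝ (Fin m) → F} {y : EuclideanSpace ℝ (Fin m)}
    (hf : ContDiffAt ℝ ∞ f y) (i j : Fin m) : partialV i (partialV j f) y =
      fderiv ℝ (fderiv ℝ f) y (EuclideanSpace.single i 1) (EuclideanSpace.single j 1) := by
  have h1 : DifferentiableAt ℝ (fderiv ℝ f) y :=
    (hf.fderiv_right (m := ∞) (by simp)).differentiableAt (by simp)
  have h2 := h1.hasFDerivAt.clm_apply
    (hasFDerivAt_const (EuclideanSpace.single j (1 : ℝ) : EuclideanSpace ℝ (Fin m)) y)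
  unfold partialV
  rw [h2.fderiv]
  simp

theorem partialV_comm {f : EuclideanSpace ℝ (Fin m) → F} {y : EuclideanSpace ℝ (Fin m)}
    (hf : ContDiffAt ℝ ∞ f y) (i j : Fin m) :
    partialV i (partialV j f) y = partialV j (partialV i f) y := by
  rw [partialV_partialV hf, partialV_partialV hf]
  exact hf.isSymmSndFDerivAt (by simp; norm_cast) _ _

theorem partialD_inner {f h : EuclideanSpace ℝ (Fin m) → F} {y : EuclideanSpace ℝ (Fin m)}
    (hf : ContDiffAt ℝ ∞ f y) (hh : ContDiffAt ℝ ∞ h y) (i : Fin m) :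
    partialD i (fun z => inner ℝ (f z) (h z)) y
      = inner ℝ (partialV i f y) (h y) + inner ℝ (f y) (partialV i h y) := by
  have := fderiv_inner_apply ℝ (hf.differentiableAt (by simp)) (hh.differentiableAt (by simp))
    (EuclideanSpace.single i 1)
  unfold partialD partialV
  rw [this, add_comm]

theorem partialD_congr {f h : EuclideanSpace ℝ (Fin m) → ℝ} {y : EuclideanSpace ℝ (Fin m)}
    (e : f =ᶠ[𝓝 y] h) (i : Fin m) : partialD i f y = partialD i h y := by
  unfold partialD; rw [e.fderiv_eq]

theorem differentiableAt_matrix_det {ι : Type*} [Fintype ι] [DecidableEq ι]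
    {V : Type*} [NormedAddCommGroup V] [NormedSpace ℝ V]
    {g : V → Matrix ι ι ℝ} {y : V} (hg : ∀ i j, DifferentiableAt ℝ (fun z => g z i j) y) :
    DifferentiableAt ℝ (fun z => (g z).det) y := by
  simp only [Matrix.det_apply']
  refine DifferentiableAt.fun_sum fun σ _ => ?_
  refine DifferentiableAt.const_mul ?_ _
  exact (HasFDerivAt.finsetProd (g := fun i z => g z (σ i) i)
    fun i _ => (hg _ _).hasFDerivAt).differentiableAt

theorem differentiableAt_matrix_inv {ι : Type*} [Fintype ι] [DecidableEq ι]
    {V : Type*} [NormedAddCommGroup V] [NormedSpace ℝ V]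
    {g : V → Matrix ι ι ℝ} {y : V} (hg : ∀ i j, DifferentiableAt ℝ (fun z => g z i j) y)
    (hdet : (g y).det ≠ 0) (i j : ι) : DifferentiableAt ℝ (fun z => (g z)⁻¹ i j) y := by
  simp only [Matrix.inv_def, Ring.inverse_eq_inv', Matrix.smul_apply, smul_eq_mul]
  refine ((differentiableAt_matrix_det hg).inv hdet).mul ?_
  simp only [Matrix.adjugate_apply]
  refine differentiableAt_matrix_det fun k l => ?_
  simp only [Matrix.updateRow_apply]
  split_ifs
  · exact differentiableAt_const _
  · exact hg _ _

variable {ψ : EuclideanSpace ℝ (Fin m) → F} {T : Set (EuclideanSpace ℝ (Fin m))}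
  {g : EuclideanSpace ℝ (Fin m) → Matrix (Fin m) (Fin m) ℝ}

theorem isUnit_gram (hinj : ∀ z ∈ T, Function.Injective (fderiv ℝ ψ z))
    (hg : ∀ z ∈ T, ∀ i j, g z i j = inner ℝ (partialV i ψ z) (partialV j ψ z))
    {z : EuclideanSpace ℝ (Fin m)} (hz : z ∈ T) : IsUnit (g z).det := by
  rw [← Matrix.isUnit_iff_isUnit_det, ← Matrix.mulVec_injective_iff_isUnit]
  refine (injective_iff_map_eq_zero (Matrix.mulVecLin (g z))).2 fun w hw => ?_
  have h1 : inner ℝ (fderiv ℝ ψ z (WithLp.toLp 2 w)) (fderiv ℝ ψ z (WithLp.toLp 2 w)) = 0 := by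
    have h2 : (WithLp.toLp 2 w : EuclideanSpace ℝ (Fin m))
        = ∑ i, w i • EuclideanSpace.single i 1 := by
      ext k; simp [Finset.sum_apply, Pi.single_apply]
    have h3 : fderiv ℝ ψ z (WithLp.toLp 2 w) = ∑ i, w i • partialV i ψ z := by
      rw [h2, map_sum]; simp [partialV]
    rw [h3, sum_inner]
    refine Finset.sum_eq_zero fun i _ => ?_
    rw [inner_smul_left, inner_sum]
    have h4 := congrFun hw i
    simp only [Matrix.mulVecLin_apply, Matrix.mulVec, dotProduct, Pi.zero_apply] at h4
    simp only [inner_smul_right, ← hg z hz]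
    rw [← Finset.sum_congr rfl (fun j _ => mul_comm (g z i j) (w j)), h4, mul_zero]
  have h2 := hinj z hz ((inner_self_eq_zero.1 h1).trans (map_zero _).symm)
  simpa using congrArg WithLp.ofLp h2

/-- The Christoffel symbols of an induced metric are the tangential components of the second
derivatives of the immersion. -/
theorem sum_gram_mul_christoffel (hT : IsOpen T) (hψ : ContDiffOn ℝ ∞ ψ T)
    (hinj : ∀ z ∈ T, Function.Injective (fderiv ℝ ψ z))
    (hg : ∀ z ∈ T, ∀ i j, g z i j = inner ℝ (partialV i ψ z) (partialV j ψ z))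
    {z : EuclideanSpace ℝ (Fin m)} (hz : z ∈ T) (i j l : Fin m) :
    ∑ k, g z l k * christoffel g k i j z
      = inner ℝ (partialV i (partialV j ψ) z) (partialV l ψ z) := by
  have hc : ContDiffAt ℝ ∞ ψ z := hψ.contDiffAt (hT.mem_nhds hz)
  have hpd : ∀ a b c, partialD a (fun w => g w b c) z
      = inner ℝ (partialV a (partialV b ψ) z) (partialV c ψ z)
        + inner ℝ (partialV b ψ z) (partialV a (partialV c ψ) z) := by
    intro a b c
    rw [partialD_congr (h := fun w => inner ℝ (partialV b ψ w) (partialV c ψ w))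
      (by filter_upwards [hT.mem_nhds hz] with w hw using hg w hw b c),
      partialD_inner (contDiffAt_partialV hc b) (contDiffAt_partialV hc c)]
  set c : Fin m → ℝ := fun s => partialD i (fun w => g w j s) z + partialD j (fun w => g w i s) z
      - partialD s (fun w => g w i j) z with hcdef
  have hcs : c l = 2 * inner ℝ (partialV i (partialV j ψ) z) (partialV l ψ z) := by
    simp only [hcdef, hpd]
    rw [partialV_comm hc j i, partialV_comm hc l i, partialV_comm hc l j,
      real_inner_comm (partialV i (partialV l ψ) z) (partialV j ψ z)]
    ring
  have hmul : g z * (g z)⁻¹ = 1 := Matrix.mul_nonsing_inv _ (isUnit_gram hinj hg hz)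
  have h1 : ∑ k, g z l k * christoffel g k i j z = 1 / 2 * ∑ s, (g z * (g z)⁻¹) l s * c s := by
    simp only [christoffel, Matrix.mul_apply, Finset.sum_mul, Finset.mul_sum]
    rw [Finset.sum_comm]
    refine Finset.sum_congr rfl fun s _ => Finset.sum_congr rfl fun k _ => ?_
    simp only [hcdef]
    ring
  rw [h1, hmul]
  simp only [Matrix.one_apply, ite_mul, one_mul, zero_mul, Finset.sum_ite_eq, Finset.mem_univ,
    if_true]
  rw [hcs]
  ring

theorem differentiableAt_christoffel (hT : IsOpen T) (hψ : ContDiffOn ℝ ∞ ψ T)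
    (hinj : ∀ z ∈ T, Function.Injective (fderiv ℝ ψ z))
    (hg : ∀ z ∈ T, ∀ i j, g z i j = inner ℝ (partialV i ψ z) (partialV j ψ z))
    {z : EuclideanSpace ℝ (Fin m)} (hz : z ∈ T) (k i j : Fin m) :
    DifferentiableAt ℝ (christoffel g k i j) z := by
  have hc : ContDiffAt ℝ ∞ ψ z := hψ.contDiffAt (hT.mem_nhds hz)
  have hgs : ∀ a b, ContDiffAt ℝ ∞ (fun w => g w a b) z := fun a b => by
    refine ((contDiffAt_partialV hc a).inner ℝ (contDiffAt_partialV hc b)).congr_of_eventuallyEq ?_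
    filter_upwards [hT.mem_nhds hz] with w hw using hg w hw a b
  have hpd : ∀ a b c, DifferentiableAt ℝ (partialD a (fun w => g w b c)) z := fun a b c =>
    (((hgs b c).fderiv_right (m := ∞) (by simp)).clm_apply contDiffAt_const).differentiableAt
      (by simp)
  have hgi := differentiableAt_matrix_inv (fun a b => (hgs a b).differentiableAt (by simp))
    (isUnit_gram hinj hg hz).ne_zero
  unfold christoffel
  refine DifferentiableAt.const_mul (DifferentiableAt.fun_sum fun l _ => ?_) _
  exact (hgi k l).mul (((hpd i j l).add (hpd j i l)).sub (hpd l i j))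

/-- **Gauss equation**, for the coordinate expression of the Riemann tensor of an induced
metric. -/
theorem sum_gram_mul_riemannCoord (hT : IsOpen T) (hψ : ContDiffOn ℝ ∞ ψ T)
    (hinj : ∀ z ∈ T, Function.Injective (fderiv ℝ ψ z))
    (hg : ∀ z ∈ T, ∀ i j, g z i j = inner ℝ (partialV i ψ z) (partialV j ψ z))
    {y : EuclideanSpace ℝ (Fin m)} (hy : y ∈ T) {α : Fin m → Fin m → F}
    (hα : ∀ i j, α i j = partialV i (partialV j ψ) y - ∑ k, christoffel g k i j y • partialV k ψ y)
    (l k i j : Fin m) :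
    ∑ s, g y l s * riemannCoord g s k i j y
      = inner ℝ (α j k) (α i l) - inner ℝ (α i k) (α j l) := by
  have hc : ContDiffAt ℝ ∞ ψ y := hψ.contDiffAt (hT.mem_nhds hy)
  have hG : ∀ i j l, ∑ k, g y l k * christoffel g k i j y
      = inner ℝ (partialV i (partialV j ψ) y) (partialV l ψ y) := fun i j l =>
    sum_gram_mul_christoffel hT hψ hinj hg hy i j l
  have hsymm : ∀ a b, g y a b = g y b a := fun a b => by
    rw [hg y hy, hg y hy, real_inner_comm]
  have hperp : ∀ i j l, inner ℝ (α i j) (partialV l ψ y) = 0 := by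
    intro i j l
    rw [hα, inner_sub_left, sum_inner, ← hG i j l, sub_eq_zero]
    refine Finset.sum_congr rfl fun k _ => ?_
    rw [inner_smul_left, hsymm l k, hg y hy]
    simp [mul_comm]
  have hpd : ∀ a b c, partialD a (fun w => g w b c) y
      = inner ℝ (partialV a (partialV b ψ) y) (partialV c ψ y)
        + inner ℝ (partialV b ψ y) (partialV a (partialV c ψ) y) := by
    intro a b c
    rw [partialD_congr (h := fun w => inner ℝ (partialV b ψ w) (partialV c ψ w))
      (by filter_upwards [hT.mem_nhds hy] with w hw using hg w hw b c),
      partialD_inner (contDiffAt_partialV hc b) (contDiffAt_partialV hc c)]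
  have hgd : ∀ a b, DifferentiableAt ℝ (fun w => g w a b) y := fun a b => by
    refine (((contDiffAt_partialV hc a).inner ℝ
      (contDiffAt_partialV hc b)).congr_of_eventuallyEq ?_).differentiableAt (n := ∞) (by simp)
    filter_upwards [hT.mem_nhds hy] with w hw using hg w hw a b
  have hΓd := fun k i j => differentiableAt_christoffel hT hψ hinj hg hy k i j
  -- the derivative in the direction `q` of `∑ₖ gₗₖ Γᵏᵢⱼ = ⟨∂ᵢ∂ⱼψ, ∂ₗψ⟩`
  have hder : ∀ q i j l, ∑ k, (g y l k * partialD q (christoffel g k i j) y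
      + partialD q (fun w => g w l k) y * christoffel g k i j y)
      = inner ℝ (partialV q (partialV i (partialV j ψ)) y) (partialV l ψ y)
        + inner ℝ (partialV i (partialV j ψ) y) (partialV q (partialV l ψ) y) := by
    intro q i j l
    rw [← partialD_inner (contDiffAt_partialV (contDiffAt_partialV hc j) i)
      (contDiffAt_partialV hc l), partialD_congr
      (h := fun w => ∑ k, g w l k * christoffel g k i j w)
      (by filter_upwards [hT.mem_nhds hy] with w hw using
        (sum_gram_mul_christoffel hT hψ hinj hg hw i j l).symm)]
    have h1 := HasFDerivAt.fun_sum (u := Finset.univ)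
      (fun k _ => (hgd l k).hasFDerivAt.fun_mul (hΓd k i j).hasFDerivAt)
    unfold partialD
    refine Eq.trans ?_ (congrArg (fun A => A (EuclideanSpace.single q 1)) h1.fderiv).symm
    rw [sum_apply]
    refine Finset.sum_congr rfl fun k _ => ?_
    rw [add_apply, smul_apply,
      smul_apply, smul_eq_mul, smul_eq_mul,
      mul_comm (christoffel g k i j y)]
  have hααl : ∀ i j q l,
      inner ℝ (α i j) (partialV q (partialV l ψ) y) = inner ℝ (α i j) (α q l) := by
    intro i j q l
    rw [hα q l, inner_sub_right, inner_sum, Finset.sum_eq_zero (fun k _ => ?_), sub_zero]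
    rw [inner_smul_right, hperp, mul_zero]
  -- the third derivatives are symmetric in `q` and `i`, and cancel in the curvature tensor
  have hkey : ∀ q i j l, ∑ k, g y l k * partialD q (christoffel g k i j) y
      + ∑ k, (∑ s, g y l s * christoffel g s q k y) * christoffel g k i j y
      = inner ℝ (partialV q (partialV i (partialV j ψ)) y) (partialV l ψ y)
        + inner ℝ (α i j) (α q l) := by
    intro q i j l
    have h1 := hder q i j l
    rw [Finset.sum_add_distrib] at h1
    have h2 : ∑ k, partialD q (fun w => g w l k) y * christoffel g k i j y
        = ∑ k, (∑ s, g y l s * christoffel g s q k y) * christoffel g k i j y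
          + ∑ k, christoffel g k i j y *
            inner ℝ (partialV k ψ y) (partialV q (partialV l ψ) y) := by
      rw [← Finset.sum_add_distrib]
      refine Finset.sum_congr rfl fun k _ => ?_
      rw [hpd, hG q k l, real_inner_comm (partialV q (partialV k ψ) y),
        real_inner_comm (partialV k ψ y)]
      ring
    rw [← hααl i j q l, hα i j, inner_sub_left, sum_inner]
    simp only [inner_smul_left, RCLike.conj_to_real]
    linarith
  have hR : ∑ s, g y l s * riemannCoord g s k i j y
      = (∑ s, g y l s * partialD i (christoffel g s j k) y
          + ∑ q, (∑ s, g y l s * christoffel g s i q y) * christoffel g q j k y)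
        - (∑ s, g y l s * partialD j (christoffel g s i k) y
          + ∑ q, (∑ s, g y l s * christoffel g s j q y) * christoffel g q i k y) := by
    have hsw : ∀ a b, ∑ q, (∑ s, g y l s * christoffel g s a q y) * christoffel g q b k y
        = ∑ s, g y l s * ∑ q, christoffel g s a q y * christoffel g q b k y := by
      intro a b
      simp only [Finset.sum_mul, Finset.mul_sum]
      rw [Finset.sum_comm]
      exact Finset.sum_congr rfl fun s _ => Finset.sum_congr rfl fun q _ => by ring
    rw [hsw, hsw, ← Finset.sum_add_distrib, ← Finset.sum_add_distrib, ← Finset.sum_sub_distrib]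
    refine Finset.sum_congr rfl fun s _ => ?_
    simp only [riemannCoord, Finset.sum_sub_distrib]
    ring
  rw [hR, hkey i j k l, hkey j i k l, partialV_comm (contDiffAt_partialV hc k) i j]
  ring

end Gauss

/-! ### The trace of the Gauss equation -/

section GaussTrace

variable {m : ℕ} {F : Type*} [NormedAddCommGroup F] [InnerProductSpace ℝ F]
  {ψ : EuclideanSpace ℝ (Fin m) → F} {T : Set (EuclideanSpace ℝ (Fin m))}
  {g : EuclideanSpace ℝ (Fin m) → Matrix (Fin m) (Fin m) ℝ}

/-- The second fundamental form of an immersion of an open set of `ℝᵐ`. -/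
def normalHessian (ψ : EuclideanSpace ℝ (Fin m) → F) (y u w : EuclideanSpace ℝ (Fin m)) : F :=
  ((fderiv ℝ ψ y).toLinearMap.range)ᗮ.starProjection (fderiv ℝ (fderiv ℝ ψ) y u w)

theorem euclidean_eq_sum_single (u : EuclideanSpace ℝ (Fin m)) :
    u = ∑ i, u i • EuclideanSpace.single i (1 : ℝ) := by
  ext k; simp [Finset.sum_apply, Pi.single_apply]

theorem normalHessian_eq_sum (y u w : EuclideanSpace ℝ (Fin m)) :
    normalHessian ψ y u w = ∑ i, ∑ j, (u i * w j) •
      normalHessian ψ y (EuclideanSpace.single i 1) (EuclideanSpace.single j 1) := by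
  conv_lhs => rw [euclidean_eq_sum_single u, euclidean_eq_sum_single w]
  simp only [normalHessian, map_sum, map_smul, sum_apply, smul_apply, smul_smul, Finset.smul_sum]
  rw [Finset.sum_comm]
  simp only [mul_comm]

theorem inner_sum_sum_smul {ι : Type*} [Fintype ι] (c d : ι → ι → ℝ) (x : ι → ι → F) :
    inner ℝ (∑ i, ∑ j, c i j • x i j) (∑ k, ∑ l, d k l • x k l)
      = ∑ i, ∑ j, ∑ k, ∑ l, c i j * d k l * inner ℝ (x i j) (x k l) := by
  rw [sum_inner]
  refine Finset.sum_congr rfl fun i _ => ?_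
  rw [sum_inner]
  refine Finset.sum_congr rfl fun j _ => ?_
  rw [inner_sum]
  refine Finset.sum_congr rfl fun k _ => ?_
  rw [inner_sum]
  refine Finset.sum_congr rfl fun l _ => ?_
  rw [inner_smul_left, inner_smul_right, RCLike.conj_to_real]
  ring

theorem normalHessian_single (hT : IsOpen T) (hψ : ContDiffOn ℝ ∞ ψ T)
    (hinj : ∀ z ∈ T, Function.Injective (fderiv ℝ ψ z))
    (hg : ∀ z ∈ T, ∀ i j, g z i j = inner ℝ (partialV i ψ z) (partialV j ψ z))
    {y : EuclideanSpace ℝ (Fin m)} (hy : y ∈ T) (i j : Fin m) :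
    normalHessian ψ y (EuclideanSpace.single i 1) (EuclideanSpace.single j 1)
      = partialV i (partialV j ψ) y - ∑ k, christoffel g k i j y • partialV k ψ y := by
  have hc : ContDiffAt ℝ ∞ ψ y := hψ.contDiffAt (hT.mem_nhds hy)
  rw [normalHessian, ← partialV_partialV hc]
  have hmem : ∑ k, christoffel g k i j y • partialV k ψ y ∈ (fderiv ℝ ψ y).toLinearMap.range :=
    Submodule.sum_mem _ fun k _ => Submodule.smul_mem _ _ ⟨_, rfl⟩
  apply Submodule.eq_starProjection_of_mem_orthogonal
  · rw [Submodule.mem_orthogonal]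
    rintro _ ⟨u, rfl⟩
    rw [euclidean_eq_sum_single u, map_sum, sum_inner]
    refine Finset.sum_eq_zero fun l _ => ?_
    rw [map_smul, inner_smul_left]
    have h1 : inner ℝ (partialV l ψ y) (partialV i (partialV j ψ) y
        - ∑ k, christoffel g k i j y • partialV k ψ y) = 0 := by
      rw [inner_sub_right, inner_sum, real_inner_comm,
        ← sum_gram_mul_christoffel hT hψ hinj hg hy i j l, sub_eq_zero]
      refine Finset.sum_congr rfl fun k _ => ?_
      rw [inner_smul_right, hg y hy, mul_comm]
    have h2 : inner ℝ ((fderiv ℝ ψ y).toLinearMap (EuclideanSpace.single l 1))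
      (partialV i (partialV j ψ) y - ∑ k, christoffel g k i j y • partialV k ψ y) = 0 := h1
    rw [h2, mul_zero]
  · rw [sub_sub_cancel]
    exact Submodule.le_orthogonal_orthogonal _ hmem

/-- The Ricci curvature of an induced metric in terms of the second fundamental form. The columns
of `A` are the components of an orthonormal frame. -/
theorem ricciCoord_of_gram (hT : IsOpen T) (hψ : ContDiffOn ℝ ∞ ψ T)
    (hinj : ∀ z ∈ T, Function.Injective (fderiv ℝ ψ z))
    (hg : ∀ z ∈ T, ∀ i j, g z i j = inner ℝ (partialV i ψ z) (partialV j ψ z))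
    {y : EuclideanSpace ℝ (Fin m)} (hy : y ∈ T) {e : Fin m → EuclideanSpace ℝ (Fin m)}
    (he : ∀ a b, inner ℝ (fderiv ℝ ψ y (e a)) (fderiv ℝ ψ y (e b)) = if a = b then (1 : ℝ) else 0)
    (v : EuclideanSpace ℝ (Fin m)) :
    ∑ j, ∑ k, ricciCoord g j k y * v j * v k
      = ∑ a, (inner ℝ (normalHessian ψ y v v) (normalHessian ψ y (e a) (e a))
        - inner ℝ (normalHessian ψ y (e a) v) (normalHessian ψ y v (e a))) := by
  set α : Fin m → Fin m → F := fun i j =>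
    normalHessian ψ y (EuclideanSpace.single i 1) (EuclideanSpace.single j 1) with hαdef
  have hα := fun i j => normalHessian_single hT hψ hinj hg hy i j
  have hRm := sum_gram_mul_riemannCoord hT hψ hinj hg hy (α := α) hα
  have hunit := isUnit_gram hinj hg hy
  have hDψ : ∀ u, fderiv ℝ ψ y u = ∑ i, u i • partialV i ψ y := fun u => by
    conv_lhs => rw [euclidean_eq_sum_single u]
    simp [partialV]
  let A : Matrix (Fin m) (Fin m) ℝ := Matrix.of fun i a => e a i
  have hAg : A.transpose * g y * A = 1 := by
    ext a b
    have h1 := he a b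
    rw [hDψ, hDψ, sum_inner] at h1
    simp only [Matrix.mul_apply, Matrix.transpose_apply, Matrix.one_apply, ← h1, inner_sum,
      inner_smul_left, inner_smul_right, Finset.sum_mul, RCLike.conj_to_real, ← hg y hy]
    rw [Finset.sum_comm]
    refine Finset.sum_congr rfl fun i _ => Finset.sum_congr rfl fun j _ => ?_
    simp only [A, Matrix.of_apply]
    ring
  have hginv : (g y)⁻¹ = A * A.transpose := by
    have h1 : A * (A.transpose * g y) = 1 := mul_eq_one_comm.1 hAg
    rw [← Matrix.mul_assoc] at h1
    exact Matrix.inv_eq_left_inv h1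
  have hric : ∀ j k, ricciCoord g j k y
      = ∑ i, ∑ l, (g y)⁻¹ i l * (inner ℝ (α j k) (α i l) - inner ℝ (α i k) (α j l)) := by
    intro j k
    refine Finset.sum_congr rfl fun i _ => ?_
    simp only [← hRm]
    have h1 : (g y)⁻¹ * g y = 1 := Matrix.nonsing_inv_mul _ hunit
    calc riemannCoord g i k i j y
        = ∑ s, ((g y)⁻¹ * g y) i s * riemannCoord g s k i j y := by
          rw [h1]; simp [Matrix.one_apply]
      _ = _ := by
          simp only [Matrix.mul_apply, Finset.sum_mul, Finset.mul_sum]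
          rw [Finset.sum_comm]
          refine Finset.sum_congr rfl fun l _ => Finset.sum_congr rfl fun s _ => by ring
  have hsum : ∀ u w, normalHessian ψ y u w = ∑ i, ∑ j, (u i * w j) • α i j := fun u w =>
    normalHessian_eq_sum y u w
  have h1 : ∀ a, inner ℝ (normalHessian ψ y v v) (normalHessian ψ y (e a) (e a))
      = ∑ j, ∑ k, ∑ i, ∑ l, (e a i * e a l) * (v j * v k * inner ℝ (α j k) (α i l)) := by
    intro a
    rw [hsum, hsum, inner_sum_sum_smul]
    refine Finset.sum_congr rfl fun j _ => Finset.sum_congr rfl fun k _ =>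
      Finset.sum_congr rfl fun i _ => Finset.sum_congr rfl fun l _ => by ring
  have h2 : ∀ a, inner ℝ (normalHessian ψ y (e a) v) (normalHessian ψ y v (e a))
      = ∑ j, ∑ k, ∑ i, ∑ l, (e a i * e a l) * (v j * v k * inner ℝ (α i k) (α j l)) := by
    intro a
    rw [hsum, hsum, inner_sum_sum_smul]
    -- the left-hand side is summed in the order `i, k, j, l`
    rw [Finset.sum_comm]
    have : ∀ k, ∑ i, ∑ j, ∑ l, e a i * v k * (v j * e a l) * inner ℝ (α i k) (α j l)
        = ∑ j, ∑ i, ∑ l, e a i * e a l * (v j * v k * inner ℝ (α i k) (α j l)) := fun k => by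
      rw [Finset.sum_comm]
      refine Finset.sum_congr rfl fun j _ => Finset.sum_congr rfl fun i _ =>
        Finset.sum_congr rfl fun l _ => by ring
    rw [Finset.sum_congr rfl fun k _ => this k, Finset.sum_comm]
  simp only [h1, h2, ← Finset.sum_sub_distrib]
  symm
  rw [Finset.sum_comm]
  refine Finset.sum_congr rfl fun j _ => ?_
  rw [Finset.sum_comm]
  refine Finset.sum_congr rfl fun k _ => ?_
  rw [hric, hginv, Finset.sum_mul, Finset.sum_mul, Finset.sum_comm]
  refine Finset.sum_congr rfl fun i _ => ?_
  rw [Finset.sum_mul, Finset.sum_mul, Finset.sum_comm]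
  refine Finset.sum_congr rfl fun l _ => ?_
  simp only [Matrix.mul_apply, Matrix.transpose_apply, A, Matrix.of_apply, Finset.sum_mul]
  refine Finset.sum_congr rfl fun a _ => by ring

end GaussTrace

/-! ### Isometric immersions in charts and the Ricci curvature -/

section IsometricImmersion

variable {m n : ℕ} {M : Type*} [TopologicalSpace M] [ChartedSpace (EuclideanSpace ℝ (Fin m)) M]
  [IsManifold (𝓡 m) ∞ M] {φ : M → EuclideanSpace ℝ (Fin n)}

/-- The expression of a map into `ℝⁿ` in the preferred chart at `x`. -/
def chartRep (φ : M → EuclideanSpace ℝ (Fin n)) (x : M) :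
    EuclideanSpace ℝ (Fin m) → EuclideanSpace ℝ (Fin n) :=
  φ ∘ (extChartAt (𝓡 m) x).symm

theorem contDiffOn_chartRep (hφ : ContMDiff (𝓡 m) 𝓘(ℝ, EuclideanSpace ℝ (Fin n)) ∞ φ) (x : M) :
    ContDiffOn ℝ ∞ (chartRep φ x) (extChartAt (𝓡 m) x).target :=
  (hφ.comp_contMDiffOn (contMDiffOn_extChartAt_symm x)).contDiffOn

theorem mdifferentiableAt_extChartAt_symm (x : M) {z : EuclideanSpace ℝ (Fin m)}
    (hz : z ∈ (extChartAt (𝓡 m) x).target) :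
    MDifferentiableAt 𝓘(ℝ, EuclideanSpace ℝ (Fin m)) (𝓡 m) (extChartAt (𝓡 m) x).symm z :=
  ((contMDiffOn_extChartAt_symm (n := ∞) (I := 𝓡 m) x).contMDiffAt
    ((isOpen_extChartAt_target x).mem_nhds hz)).mdifferentiableAt (by simp)

theorem fderiv_chartRep (hφ : ContMDiff (𝓡 m) 𝓘(ℝ, EuclideanSpace ℝ (Fin n)) ∞ φ) (x : M)
    {z : EuclideanSpace ℝ (Fin m)} (hz : z ∈ (extChartAt (𝓡 m) x).target)
    (u : EuclideanSpace ℝ (Fin m)) :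
    fderiv ℝ (chartRep φ x) z u = differential φ ((extChartAt (𝓡 m) x).symm z)
      (mfderiv 𝓘(ℝ, EuclideanSpace ℝ (Fin m)) (𝓡 m) (extChartAt (𝓡 m) x).symm z u) := by
  have h1 := mfderiv_comp z ((hφ.mdifferentiable (by simp)) _)
    (mdifferentiableAt_extChartAt_symm x hz)
  rw [mfderiv_eq_fderiv] at h1
  exact congrArg (fun A => A u) h1

theorem mfderiv_extChartAt_comp_symm (x : M) {z : EuclideanSpace ℝ (Fin m)}
    (hz : z ∈ (extChartAt (𝓡 m) x).target) (u : EuclideanSpace ℝ (Fin m)) :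
    mfderiv (𝓡 m) 𝓘(ℝ, EuclideanSpace ℝ (Fin m)) (extChartAt (𝓡 m) x)
      ((extChartAt (𝓡 m) x).symm z)
      (mfderiv 𝓘(ℝ, EuclideanSpace ℝ (Fin m)) (𝓡 m) (extChartAt (𝓡 m) x).symm z u) = u := by
  have h1 := mfderiv_comp z (mdifferentiableAt_extChartAt (I := 𝓡 m)
      (by simpa using (extChartAt (𝓡 m) x).map_target hz))
    (mdifferentiableAt_extChartAt_symm x hz)
  have h2 : mfderiv 𝓘(ℝ, EuclideanSpace ℝ (Fin m)) 𝓘(ℝ, EuclideanSpace ℝ (Fin m))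
      (extChartAt (𝓡 m) x ∘ (extChartAt (𝓡 m) x).symm) z = ContinuousLinearMap.id ℝ _ := by
    rw [← mfderiv_id]
    refine Filter.EventuallyEq.mfderiv_eq ?_
    filter_upwards [(isOpen_extChartAt_target x).mem_nhds hz] with w hw
    exact (extChartAt (𝓡 m) x).right_inv hw
  rw [h2] at h1
  exact (congrArg (fun A => A u) h1).symm

omit [IsManifold (𝓡 m) ∞ M] in
theorem differential_eq_fderiv_chartRep
    (hφ : ContMDiff (𝓡 m) 𝓘(ℝ, EuclideanSpace ℝ (Fin n)) ∞ φ) (x : M) :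
    differential (m := m) φ x = fderiv ℝ (chartRep φ x) (extChartAt (𝓡 m) x x) := by
  refine ((hφ.mdifferentiable (by simp)) x).mfderiv.trans ?_
  simp only [writtenInExtChartAt, chartRep, mfld_simps, fderivWithin_univ]
  rfl

/-- Rewriting along an equality of subspaces, without motive problems from the instance argument. -/
theorem starProjection_congr {F : Type*} [NormedAddCommGroup F] [InnerProductSpace ℝ F]
    {S S' : Submodule ℝ F} [S.HasOrthogonalProjection] [S'.HasOrthogonalProjection] (h : S = S')
    (u : F) : S.starProjection u = S'.starProjection u := by
  subst h; rfl

omit [IsManifold (𝓡 m) ∞ M] in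
theorem secondFundamentalForm_eq_normalHessian
    (hφ : ContMDiff (𝓡 m) 𝓘(ℝ, EuclideanSpace ℝ (Fin n)) ∞ φ) (x : M)
    (v w : TangentSpace (𝓡 m) x) :
    secondFundamentalForm φ x v w
      = normalHessian (chartRep φ x) (extChartAt (𝓡 m) x x) v w := by
  exact starProjection_congr (congrArg
    (fun A : EuclideanSpace ℝ (Fin m) →L[ℝ] EuclideanSpace ℝ (Fin n) => (A.toLinearMap.range)ᗮ)
    (differential_eq_fderiv_chartRep hφ x)) _

variable [RiemannianBundle (fun x : M => TangentSpace (𝓡 m) x)]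

omit [IsManifold (𝓡 m) ∞ M] in
theorem norm_differential (hφ : IsIsometricImmersion (m := m) φ) (x : M)
    (v : TangentSpace (𝓡 m) x) : ‖differential (m := m) φ x v‖ = ‖v‖ := by
  rw [norm_eq_sqrt_real_inner, norm_eq_sqrt_real_inner, hφ.2]

theorem injective_fderiv_chartRep (hφ : IsIsometricImmersion (m := m) φ) (x : M)
    {z : EuclideanSpace ℝ (Fin m)} (hz : z ∈ (extChartAt (𝓡 m) x).target) :
    Function.Injective (fderiv ℝ (chartRep φ x) z) := by
  rw [injective_iff_map_eq_zero]
  intro u hu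
  rw [fderiv_chartRep hφ.1 x hz] at hu
  have h1 := norm_differential hφ _
    (mfderiv 𝓘(ℝ, EuclideanSpace ℝ (Fin m)) (𝓡 m) (extChartAt (𝓡 m) x).symm z u)
  rw [hu, norm_zero] at h1
  have h2 := norm_eq_zero.1 h1.symm
  have h3 := mfderiv_extChartAt_comp_symm x hz u
  rw [h2] at h3
  exact h3.symm.trans (map_zero _)

theorem metricCoord_eq (hφ : IsIsometricImmersion (m := m) φ) (x : M)
    {z : EuclideanSpace ℝ (Fin m)} (hz : z ∈ (extChartAt (𝓡 m) x).target) (i j : Fin m) :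
    metricCoord x z i j
      = inner ℝ (partialV i (chartRep φ x) z) (partialV j (chartRep φ x) z) := by
  unfold partialV
  rw [fderiv_chartRep hφ.1 x hz, fderiv_chartRep hφ.1 x hz, hφ.2]
  rfl

/-- For a minimal immersion the trace of the Gauss equation is `Ric(v, v) = - ∑ₐ |α(v, eₐ)|²`. -/
theorem ricci_eq_neg_sum (hφ : IsIsometricImmersion (m := m) φ)
    (hmin : IsMinimalImmersion (m := m) φ) (x : M)
    (e : OrthonormalBasis (Fin m) ℝ (TangentSpace (𝓡 m) x)) (v : TangentSpace (𝓡 m) x) :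
    ricci x v v = - ∑ a, ‖secondFundamentalForm φ x v (e a)‖ ^ 2 := by
  set ψ := chartRep (m := m) φ x
  set y := extChartAt (𝓡 m) x x
  have hy : y ∈ (extChartAt (𝓡 m) x).target := mem_extChartAt_target x
  have hT : IsOpen (extChartAt (𝓡 m) x).target := isOpen_extChartAt_target x
  have hψ : ContDiffOn ℝ ∞ ψ (extChartAt (𝓡 m) x).target := contDiffOn_chartRep hφ.1 x
  have hc : ContDiffAt ℝ ∞ ψ y := hψ.contDiffAt (hT.mem_nhds hy)
  have he : ∀ a b, inner ℝ (fderiv ℝ ψ y (e a)) (fderiv ℝ ψ y (e b))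
      = if a = b then (1 : ℝ) else 0 := fun a b => by
    have h1 := orthonormal_iff_ite.1 e.orthonormal a b
    rw [← hφ.2, differential_eq_fderiv_chartRep hφ.1] at h1
    exact h1
  have h1 := ricciCoord_of_gram hT hψ (fun z hz => injective_fderiv_chartRep hφ x hz)
    (fun z hz => metricCoord_eq hφ x hz) hy (e := fun a => e a) he v
  have hsymm : ∀ u w, normalHessian ψ y u w = normalHessian ψ y w u := fun u w => by
    unfold normalHessian
    rw [hc.isSymmSndFDerivAt (by simp; norm_cast) u w]
  have hH : ∑ a, normalHessian ψ y (e a) (e a) = 0 := by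
    have := hmin x e
    simpa only [secondFundamentalForm_eq_normalHessian hφ.1] using this
  refine Eq.trans h1 ?_
  rw [Finset.sum_sub_distrib, ← inner_sum, hH, inner_zero_right, zero_sub]
  congr 1
  refine Finset.sum_congr rfl fun a _ => ?_
  exact (congrArg (fun q => inner ℝ q (normalHessian ψ y v (e a))) (hsymm (e a) v)).trans
    ((real_inner_self_eq_norm_sq _).trans (congrArg (fun q => ‖q‖ ^ 2)
      (secondFundamentalForm_eq_normalHessian hφ.1 x v (e a)).symm))

/-- The term of `ricci_eq_neg_sum` for an orthonormal frame that starts with the unit vector `v`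
bounds `|α(v, v)|²`. -/
theorem norm_secondFundamentalForm_sq_le (hφ : IsIsometricImmersion (m := m) φ)
    (hmin : IsMinimalImmersion (m := m) φ) (x : M) (v : TangentSpace (𝓡 m) x) (hv : ‖v‖ = 1) :
    ‖secondFundamentalForm φ x v v‖ ^ 2 ≤ - ricci x v v := by
  have : FiniteDimensional ℝ (TangentSpace (𝓡 m) x) :=
    inferInstanceAs (FiniteDimensional ℝ (EuclideanSpace ℝ (Fin m)))
  have hdim : Module.finrank ℝ (TangentSpace (𝓡 m) x) = m :=
    finrank_euclideanSpace_fin (𝕜 := ℝ) (n := m)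
  let e : OrthonormalBasis (Fin m) ℝ (TangentSpace (𝓡 m) x) :=
    (stdOrthonormalBasis ℝ _).reindex (finCongr hdim)
  rw [ricci_eq_neg_sum hφ hmin x e, neg_neg]
  have h1 : secondFundamentalForm φ x v v
      = ∑ a, inner ℝ (e a) v • secondFundamentalForm φ x v (e a) := by
    let Λ : TangentSpace (𝓡 m) x →L[ℝ] EuclideanSpace ℝ (Fin n) :=
      ((differential (m := m) φ x).toLinearMap.range)ᗮ.starProjection ∘L
        (fderiv ℝ (fderiv ℝ (φ ∘ (extChartAt (𝓡 m) x).symm)) (extChartAt (𝓡 m) x x) v)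
    exact (congrArg Λ (e.sum_repr' v).symm).trans ((map_sum Λ _ _).trans
      (Finset.sum_congr rfl fun a _ => map_smul Λ _ _))
  have h2 : ∑ a, (inner ℝ (e a) v) ^ 2 = (1 : ℝ) := by
    have := e.sum_sq_norm_inner_right v
    simpa [hv] using this
  rw [h1]
  calc ‖∑ a, inner ℝ (e a) v • secondFundamentalForm φ x v (e a)‖ ^ 2
      ≤ (∑ a, |inner ℝ (e a) v| * ‖secondFundamentalForm φ x v (e a)‖) ^ 2 := by
        gcongr
        refine (norm_sum_le _ _).trans (Finset.sum_le_sum fun a _ => ?_)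
        rw [norm_smul, Real.norm_eq_abs]
    _ ≤ (∑ a, |inner ℝ (e a) v| ^ 2) * ∑ a, ‖secondFundamentalForm φ x v (e a)‖ ^ 2 :=
        Finset.sum_mul_sq_le_sq_mul_sq _ _ _
    _ = _ := by simp only [sq_abs, h2, one_mul]

end IsometricImmersion

/-! ### The gradient of the squared distance in the ambient space -/

section Gradient

theorem contDiff_compL_flip {E F : Type*} [NormedAddCommGroup E] [NormedSpace ℝ E]
    [NormedAddCommGroup F] [NormedSpace ℝ F] :
    ContDiff ℝ ∞ (ContinuousLinearMap.compL ℝ E F ℝ).flip :=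
  ContinuousLinearMap.contDiff _

set_option synthInstance.maxHeartbeats 200000 in
/-- The tangential part of a smooth vector field along an immersion `ψ` of an open set of a vector
space is the image under `Dψ` of a smooth vector field. -/
theorem exists_contDiffOn_tangential {E F : Type*} [NormedAddCommGroup E] [NormedSpace ℝ E]
    [FiniteDimensional ℝ E] [NormedAddCommGroup F] [InnerProductSpace ℝ F] {ψ h : E → F}
    {T : Set E} (hT : IsOpen T) (hψ : ContDiffOn ℝ ∞ ψ T) (hh : ContDiffOn ℝ ∞ h T)
    (hinj : ∀ z ∈ T, Function.Injective (fderiv ℝ ψ z)) :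
    ∃ w : E → E, ContDiffOn ℝ ∞ w T ∧ ∀ z ∈ T, ∀ u,
      inner ℝ (fderiv ℝ ψ z (w z)) (fderiv ℝ ψ z u) = inner ℝ (h z) (fderiv ℝ ψ z u) := by
  have : CompleteSpace E := FiniteDimensional.complete ℝ E
  let β : F →L[ℝ] F →L[ℝ] ℝ := (isBoundedBilinearMap_inner (𝕜 := ℝ) (E := F)).toContinuousLinearMap
  have hβ : ∀ a b, β a b = inner ℝ a b := fun a b => rfl
  let P : (E →L[ℝ] F) →L[ℝ] (F →L[ℝ] ℝ) →L[ℝ] (E →L[ℝ] ℝ) :=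
    (ContinuousLinearMap.compL ℝ E F ℝ).flip
  have hP : ContDiff ℝ ∞ P := contDiff_compL_flip
  let B : E → E →L[ℝ] (E →L[ℝ] ℝ) := fun z => (P (fderiv ℝ ψ z)).comp (β.comp (fderiv ℝ ψ z))
  have hB : ∀ z u v, B z u v = inner ℝ (fderiv ℝ ψ z u) (fderiv ℝ ψ z v) := fun z u v => rfl
  have hfd : ContDiffOn ℝ ∞ (fderiv ℝ ψ) T := hψ.fderiv_of_isOpen hT (by simp)
  have hBs : ContDiffOn ℝ ∞ B T :=
    (hP.comp_contDiffOn hfd).clm_comp (contDiffOn_const.clm_comp hfd)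
  have hBe : ∀ z ∈ T, ∃ e : E ≃L[ℝ] (E →L[ℝ] ℝ), (e : E →L[ℝ] (E →L[ℝ] ℝ)) = B z := by
    intro z hz
    have hi : Function.Injective (B z).toLinearMap := by
      rw [injective_iff_map_eq_zero]
      intro u hu
      have h1 : B z u u = 0 := by
        have := congrArg (fun A : E →L[ℝ] ℝ => A u) hu
        exact this
      rw [hB] at h1
      exact hinj z hz ((inner_self_eq_zero.1 h1).trans (map_zero _).symm)
    have hd : Module.finrank ℝ E = Module.finrank ℝ (E →L[ℝ] ℝ) := by
      rw [← (LinearMap.toContinuousLinearMap (𝕜 := ℝ) (E := E) (F' := ℝ)).finrank_eq]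
      exact (Subspace.dual_finrank_eq (K := ℝ) (V := E)).symm
    exact ⟨(LinearMap.linearEquivOfInjective _ hi hd).toContinuousLinearEquiv, by ext; rfl⟩
  refine ⟨fun z => (B z).inverse (P (fderiv ℝ ψ z) (β (h z))), fun z hz => ?_, fun z hz u => ?_⟩
  · refine ContDiffAt.contDiffWithinAt ?_
    obtain ⟨e, he⟩ := hBe z hz
    have h1 : ContDiffAt ℝ ∞ (fun z => (B z).inverse) z := by
      have h2 := contDiffAt_map_inverse (n := ∞) e
      rw [he] at h2
      exact h2.comp z (hBs.contDiffAt (hT.mem_nhds hz))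
    exact h1.clm_apply (((hP.comp_contDiffOn hfd).contDiffAt (hT.mem_nhds hz)).clm_apply
      (β.contDiff.contDiffAt.comp z (hh.contDiffAt (hT.mem_nhds hz))))
  · obtain ⟨e, he⟩ := hBe z hz
    rw [← hB]
    simp only
    rw [← he, ContinuousLinearMap.inverse_equiv]
    simp only [ContinuousLinearEquiv.coe_coe, ContinuousLinearEquiv.apply_symm_apply]
    rfl

variable {m n : ℕ} {M : Type*} [TopologicalSpace M] [ChartedSpace (EuclideanSpace ℝ (Fin m)) M]
  [IsManifold (𝓡 m) ∞ M] {φ : M → EuclideanSpace ℝ (Fin n)}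

theorem surjective_mfderiv_extChartAt_symm (x : M) {z : EuclideanSpace ℝ (Fin m)}
    (hz : z ∈ (extChartAt (𝓡 m) x).target) : Function.Surjective
      (mfderiv 𝓘(ℝ, EuclideanSpace ℝ (Fin m)) (𝓡 m) (extChartAt (𝓡 m) x).symm z) := by
  let A : EuclideanSpace ℝ (Fin m) →L[ℝ] EuclideanSpace ℝ (Fin m) :=
    mfderiv 𝓘(ℝ, EuclideanSpace ℝ (Fin m)) (𝓡 m) (extChartAt (𝓡 m) x).symm z
  have hA : Function.Injective A.toLinearMap :=
    Function.LeftInverse.injective (mfderiv_extChartAt_comp_symm x hz)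
  have h := (LinearMap.injective_iff_surjective (K := ℝ) (V := EuclideanSpace ℝ (Fin m))).1 hA
  exact h

variable [RiemannianBundle (fun x : M => TangentSpace (𝓡 m) x)]

/-- The gradient of `½|φ - c|²`, that is, the tangential part of the position vector. -/
theorem exists_gradient (hφ : IsIsometricImmersion (m := m) φ) (c : EuclideanSpace ℝ (Fin n)) :
    ∃ V : ∀ x : M, TangentSpace (𝓡 m) x,
      ContMDiff (𝓡 m) (𝓡 m).tangent ∞ (fun x => (⟨x, V x⟩ : TangentBundle (𝓡 m) M)) ∧
      ∀ (x : M) (v : TangentSpace (𝓡 m) x),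
        inner ℝ (V x) v = inner ℝ (φ x - c) (differential (m := m) φ x v) := by
  have hw := fun x : M => exists_contDiffOn_tangential (isOpen_extChartAt_target x)
    (contDiffOn_chartRep hφ.1 x) ((contDiffOn_chartRep hφ.1 x).sub contDiffOn_const)
    (h := fun z => chartRep φ x z - c)
    (fun z hz => injective_fderiv_chartRep hφ x hz)
  choose w hws hwi using hw
  let V : ∀ x : M, TangentSpace (𝓡 m) x := fun x => w x (extChartAt (𝓡 m) x x)
  have hV : ∀ (x : M) (v : TangentSpace (𝓡 m) x),
      inner ℝ (V x) v = inner ℝ (φ x - c) (differential (m := m) φ x v) := by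
    intro x v
    rw [← hφ.2, differential_eq_fderiv_chartRep hφ.1]
    have h1 : chartRep φ x (extChartAt (𝓡 m) x x) = φ x :=
      congrArg φ (extChartAt_to_inv (I := 𝓡 m) x)
    rw [← h1]
    exact hwi x _ (mem_extChartAt_target x) v
  have hVw : ∀ (x₀ : M), ∀ z ∈ (extChartAt (𝓡 m) x₀).target, V ((extChartAt (𝓡 m) x₀).symm z)
      = mfderiv 𝓘(ℝ, EuclideanSpace ℝ (Fin m)) (𝓡 m) (extChartAt (𝓡 m) x₀).symm z (w x₀ z) := by
    intro x₀ z hz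
    refine ext_inner_right ℝ fun v => ?_
    obtain ⟨u, rfl⟩ := surjective_mfderiv_extChartAt_symm x₀ hz v
    have h1 := hwi x₀ z hz u
    rw [fderiv_chartRep hφ.1 x₀ hz, fderiv_chartRep hφ.1 x₀ hz u] at h1
    exact (hV _ _).trans (h1.symm.trans (hφ.2 _ _ _))
  refine ⟨V, fun x₀ => ?_, hV⟩
  rw [contMDiffAt_section]
  have h1 : ContMDiffAt (𝓡 m) 𝓘(ℝ, EuclideanSpace ℝ (Fin m)) ∞
      (fun x => w x₀ (extChartAt (𝓡 m) x₀ x)) x₀ :=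
    ((hws x₀).contDiffAt ((isOpen_extChartAt_target x₀).mem_nhds
      (mem_extChartAt_target x₀))).contMDiffAt.comp x₀ (contMDiffAt_extChartAt)
  refine h1.congr_of_eventuallyEq ?_
  filter_upwards [extChartAt_source_mem_nhds (I := 𝓡 m) x₀] with x hx
  have hx' : x ∈ (chartAt (EuclideanSpace ℝ (Fin m)) x₀).source := by simpa using hx
  obtain ⟨z, hz, rfl⟩ : ∃ z ∈ (extChartAt (𝓡 m) x₀).target, (extChartAt (𝓡 m) x₀).symm z = x :=
    ⟨_, (extChartAt (𝓡 m) x₀).map_source hx, (extChartAt (𝓡 m) x₀).left_inv hx⟩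
  have h2 := TangentBundle.continuousLinearMapAt_trivializationAt (I := 𝓡 m) hx'
  have h3 := congrArg (fun A => A (V ((extChartAt (𝓡 m) x₀).symm z))) h2
  rw [Trivialization.continuousLinearMapAt_apply, Trivialization.coe_linearMapAt_of_mem] at h3
  · refine h3.trans ?_
    simp only [hVw x₀ z hz, (extChartAt (𝓡 m) x₀).right_inv hz]
    exact mfderiv_extChartAt_comp_symm x₀ hz _
  · simpa using hx'

end Gradient

/-! ### Exponential contraction and the Hessian of the squared distance -/

section Contraction

/-- If the logarithmic derivative of `s ↦ ‖A(s, y₀) u‖` at `s = 0` exceeds `l` for every `u ≠ 0`,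
then, backwards in time, `‖A(s, y) u‖` decays at least like `exp (l s)`, locally uniformly
in `y`. -/
theorem exists_exp_contraction {E G F : Type*} [NormedAddCommGroup E] [NormedSpace ℝ E]
    [NormedAddCommGroup G] [NormedSpace ℝ G] [FiniteDimensional ℝ G]
    [NormedAddCommGroup F] [InnerProductSpace ℝ F] {A : ℝ × E → G →L[ℝ] F} {y₀ : E}
    (hA : ContDiffAt ℝ ∞ A (0, y₀)) {l : ℝ}
    (h : ∀ u, u ≠ 0 → l * ‖A (0, y₀) u‖ ^ 2
      < inner ℝ (A (0, y₀) u) (fderiv ℝ A (0, y₀) (1, 0) u)) :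
    ∃ s₀ > 0, ∀ᶠ y in 𝓝 y₀, ∀ s ∈ Icc (-s₀) 0, ∀ u,
      ‖A (s, y) u‖ ≤ Real.exp (l * s) * ‖A (0, y) u‖ := by
  have hA1 : ContDiffAt ℝ 1 A (0, y₀) := hA.of_le (by norm_cast)
  have hDc : ContinuousAt (fun p => fderiv ℝ A p) (0, y₀) :=
    (hA.fderiv_right (m := ∞) (by simp)).continuousAt
  have hsph : IsCompact (Metric.sphere (0 : G) 1) := isCompact_sphere 0 1
  -- by compactness of the unit sphere, the strict inequality persists near `(0, y₀)`
  have h1 : ∀ᶠ p in 𝓝 ((0 : ℝ), y₀), ∀ u ∈ Metric.sphere (0 : G) 1,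
      0 < inner ℝ (A p u) (fderiv ℝ A p (1, 0) u) - l * ‖A p u‖ ^ 2 := by
    refine hsph.eventually_forall_of_forall_eventually fun u hu => ?_
    have hu0 : u ≠ 0 := by
      rintro rfl; simp at hu
    have ha : ContinuousAt (fun z : (ℝ × E) × G => A z.1 z.2) ((0, y₀), u) :=
      (hA.continuousAt.comp (f := fun z : (ℝ × E) × G => z.1) (x := ((0, y₀), u))
        continuousAt_fst).clm_apply continuousAt_snd
    have hd : ContinuousAt (fun z : (ℝ × E) × G => fderiv ℝ A z.1 (1, 0) z.2) ((0, y₀), u) :=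
      ((hDc.comp (f := fun z : (ℝ × E) × G => z.1) (x := ((0, y₀), u))
        continuousAt_fst).clm_apply continuousAt_const).clm_apply continuousAt_snd
    have hq := (ha.inner (𝕜 := ℝ) hd).sub ((ha.norm.pow 2).const_mul l)
    exact hq.eventually (lt_mem_nhds (sub_pos.2 (h u hu0)))
  have h2 := h1.and (hA1.eventually (by simp))
  rw [nhds_prod_eq, eventually_prod_iff] at h2
  obtain ⟨pa, hpa, pb, hpb, hab⟩ := h2
  obtain ⟨s₀, hs₀, hs⟩ := Metric.nhds_basis_closedBall.eventually_iff.1 hpa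
  refine ⟨s₀, hs₀, hpb.mono fun y hy s hsI u => ?_⟩
  have hmem : ∀ t ∈ Icc (-s₀) 0, pa t := fun t ht => hs (by
    rw [Metric.mem_closedBall, Real.dist_eq, sub_zero, abs_le]
    exact ⟨ht.1, ht.2.trans hs₀.le⟩)
  have hder : ∀ t ∈ Icc (-s₀) 0,
      HasDerivAt (fun t => A (t, y) u) (fderiv ℝ A (t, y) (1, 0) u) t := by
    intro t ht
    have h3 := ((hab (hmem t ht) hy).2.differentiableAt (by simp)).hasFDerivAt
    have h4 : HasDerivAt (fun t : ℝ => (t, y)) ((1 : ℝ), (0 : E)) t :=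
      (hasDerivAt_id t).prodMk (hasDerivAt_const t y)
    have h5 := h3.comp_hasDerivAt t h4
    exact h5.clm_apply (hasDerivAt_const t u) |>.congr_deriv (by simp)
  have hpos : ∀ t ∈ Icc (-s₀) 0,
      0 ≤ inner ℝ (A (t, y) u) (fderiv ℝ A (t, y) (1, 0) u) - l * ‖A (t, y) u‖ ^ 2 := by
    intro t ht
    rcases eq_or_ne u 0 with rfl | hu
    · simp
    have h6 := (hab (hmem t ht) hy).1 (‖u‖⁻¹ • u) (by
      rw [mem_sphere_zero_iff_norm, norm_smul, norm_inv, norm_norm, inv_mul_cancel₀ (by simpa)])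
    have h7 : inner ℝ (A (t, y) (‖u‖⁻¹ • u)) (fderiv ℝ A (t, y) (1, 0) (‖u‖⁻¹ • u))
        - l * ‖A (t, y) (‖u‖⁻¹ • u)‖ ^ 2 = (‖u‖⁻¹) ^ 2 *
        (inner ℝ (A (t, y) u) (fderiv ℝ A (t, y) (1, 0) u) - l * ‖A (t, y) u‖ ^ 2) := by
      rw [map_smul, map_smul, real_inner_smul_left, real_inner_smul_right, norm_smul, norm_inv,
        norm_norm]
      ring
    rw [h7] at h6
    exact (pos_of_mul_pos_right h6 (by positivity)).le
  -- `exp (-2 l t) ‖A(t, y) u‖²` is monotone in `t`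
  have hmono : MonotoneOn (fun t => Real.exp (-(2 * l * t)) * ‖A (t, y) u‖ ^ 2) (Icc (-s₀) 0) := by
    have hd : ∀ t ∈ Icc (-s₀) 0, HasDerivAt (fun t => Real.exp (-(2 * l * t)) * ‖A (t, y) u‖ ^ 2)
        (Real.exp (-(2 * l * t)) * (2 *
          (inner ℝ (A (t, y) u) (fderiv ℝ A (t, y) (1, 0) u) - l * ‖A (t, y) u‖ ^ 2))) t := by
      intro t ht
      have h8 : HasDerivAt (fun t : ℝ => Real.exp (-(2 * l * t)))
          (Real.exp (-(2 * l * t)) * (-(2 * l * 1))) t :=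
        (((hasDerivAt_id t).const_mul (2 * l)).neg).exp
      refine (h8.mul (hder t ht).norm_sq).congr_deriv ?_
      ring
    refine monotoneOn_of_deriv_nonneg (convex_Icc _ _)
      (fun t ht => (hd t ht).continuousAt.continuousWithinAt) (fun t ht => ?_) fun t ht => ?_
    · rw [interior_Icc] at ht
      exact (hd t (Ioo_subset_Icc_self ht)).differentiableAt.differentiableWithinAt
    · rw [interior_Icc] at ht
      rw [(hd t (Ioo_subset_Icc_self ht)).deriv]
      have := hpos t (Ioo_subset_Icc_self ht)
      positivity
  have h9 := hmono hsI (right_mem_Icc.2 (by linarith)) hsI.2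
  simp only [mul_zero, neg_zero, Real.exp_zero, one_mul] at h9
  refine (pow_le_pow_iff_left₀ (norm_nonneg _) (by positivity) two_ne_zero).1 ?_
  have h10 : Real.exp (l * s) ^ 2 * Real.exp (-(2 * l * s)) = 1 := by
    rw [← Real.exp_nat_mul, ← Real.exp_add]
    simp only [Nat.cast_ofNat]
    rw [show 2 * (l * s) + -(2 * l * s) = 0 by ring, Real.exp_zero]
  calc ‖A (s, y) u‖ ^ 2
      = Real.exp (l * s) ^ 2 * (Real.exp (-(2 * l * s)) * ‖A (s, y) u‖ ^ 2) := by
        rw [← mul_assoc, h10, one_mul]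
    _ ≤ Real.exp (l * s) ^ 2 * ‖A (0, y) u‖ ^ 2 := by gcongr
    _ = _ := by ring

/-- If `τ` is the tangential part of the position vector `ψ - c`, then the derivative of `τ` along
`ψ` is the Hessian of `½|ψ - c|²`, which is `|v|² + ⟨ψ - c, α(v, v)⟩`. -/
theorem inner_fderiv_tangential {m : ℕ} {F : Type*} [NormedAddCommGroup F] [InnerProductSpace ℝ F]
    [FiniteDimensional ℝ F]
    {ψ τ : EuclideanSpace ℝ (Fin m) → F} {y : EuclideanSpace ℝ (Fin m)} {c : F}
    (hψ : ContDiffAt ℝ ∞ ψ y) (hτ : DifferentiableAt ℝ τ y)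
    (h : ∀ᶠ z in 𝓝 y, ∀ u, inner ℝ (τ z) (fderiv ℝ ψ z u) = inner ℝ (ψ z - c) (fderiv ℝ ψ z u))
    (hr : τ y ∈ (fderiv ℝ ψ y).toLinearMap.range) (u : EuclideanSpace ℝ (Fin m)) :
    inner ℝ (fderiv ℝ ψ y u) (fderiv ℝ τ y u)
      = ‖fderiv ℝ ψ y u‖ ^ 2 + inner ℝ (ψ y - c) (normalHessian ψ y u u) := by
  have h1 : DifferentiableAt ℝ (fderiv ℝ ψ) y :=
    (hψ.fderiv_right (m := ∞) (by simp)).differentiableAt (by simp)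
  have h2 : HasFDerivAt (fun z => fderiv ℝ ψ z u) ((fderiv ℝ (fderiv ℝ ψ) y).flip u) y := by
    have := h1.hasFDerivAt.clm_apply (hasFDerivAt_const u y)
    refine this.congr_fderiv ?_
    ext w; simp
  have hd := hψ.differentiableAt (by simp)
  have h3 : (fun z => inner ℝ (τ z) (fderiv ℝ ψ z u)) =ᶠ[𝓝 y]
      fun z => inner ℝ (ψ z - c) (fderiv ℝ ψ z u) := h.mono fun z hz => hz u
  have h4 := congrArg (fun A : EuclideanSpace ℝ (Fin m) →L[ℝ] ℝ => A u) h3.fderiv_eq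
  rw [fderiv_inner_apply ℝ hτ h2.differentiableAt, fderiv_inner_apply ℝ (hd.sub_const c)
    h2.differentiableAt, h2.fderiv, fderiv_sub_const] at h4
  have h5 : inner ℝ (ψ y - c - τ y) (fderiv ℝ (fderiv ℝ ψ) y u u)
      = inner ℝ (ψ y - c) (normalHessian ψ y u u) := by
    have hmem : ψ y - c - τ y ∈ ((fderiv ℝ ψ y).toLinearMap.range)ᗮ := by
      rw [Submodule.mem_orthogonal']
      rintro _ ⟨w, rfl⟩
      rw [inner_sub_left]
      have := h.self_of_nhds w
      exact sub_eq_zero.2 this.symm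
    have h6 : inner ℝ (τ y) (normalHessian ψ y u u) = 0 :=
      (Submodule.mem_orthogonal _ _).1 (Submodule.starProjection_apply_mem _ _) _ hr
    rw [← sub_zero (inner ℝ (ψ y - c) (normalHessian ψ y u u)), ← h6, ← inner_sub_left]
    unfold normalHessian
    rw [← Submodule.inner_starProjection_left_eq_right,
      Submodule.starProjection_eq_self_iff.2 hmem]
  rw [← h5, inner_sub_left, ← real_inner_self_eq_norm_sq, real_inner_comm]
  simp only [ContinuousLinearMap.flip_apply] at h4
  linarith

end Contraction

/-! ### Contraction of tangent vectors by the gradient flow -/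

section FlowContraction

variable {m n : ℕ} {M : Type*} [TopologicalSpace M] [ChartedSpace (EuclideanSpace ℝ (Fin m)) M]
  [IsManifold (𝓡 m) ∞ M] {φ : M → EuclideanSpace ℝ (Fin n)}
  [RiemannianBundle (fun x : M => TangentSpace (𝓡 m) x)]

omit [IsManifold (𝓡 m) ∞ M] [RiemannianBundle (fun x : M => TangentSpace (𝓡 m) x)] in
theorem differential_comp (hφ : ContMDiff (𝓡 m) 𝓘(ℝ, EuclideanSpace ℝ (Fin n)) ∞ φ) {g : M → M}
    (hg : ContMDiff (𝓡 m) (𝓡 m) ∞ g) (x : M) (v : TangentSpace (𝓡 m) x) :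
    differential (m := m) (φ ∘ g) x v
      = differential (m := m) φ (g x) (mfderiv (𝓡 m) (𝓡 m) g x v) := by
  have h := mfderiv_comp x (hφ.mdifferentiable (by simp) _) (hg.mdifferentiable (by simp) x)
  exact congrArg (fun A => A v) h

theorem norm_fderiv_chartRep_comp (hφ : IsIsometricImmersion (m := m) φ) {g : M → M}
    (hg : ContMDiff (𝓡 m) (𝓡 m) ∞ g) (x₀ : M) {y : EuclideanSpace ℝ (Fin m)}
    (hy : y ∈ (extChartAt (𝓡 m) x₀).target) (u : EuclideanSpace ℝ (Fin m)) :
    ‖fderiv ℝ (chartRep (φ ∘ g) x₀) y u‖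
      = ‖mfderiv (𝓡 m) (𝓡 m) g ((extChartAt (𝓡 m) x₀).symm y) (mfderiv
        𝓘(ℝ, EuclideanSpace ℝ (Fin m)) (𝓡 m) (extChartAt (𝓡 m) x₀).symm y u)‖ := by
  rw [fderiv_chartRep (hφ.1.comp hg) x₀ hy u, ← norm_differential hφ]
  rw [differential_comp hφ.1 hg]

/-- If the Hessian of `½|φ - c|²`, whose gradient is `V`, exceeds `l` times the metric at `x₀`, then
the flow of any vector field that agrees with `V` near `x₀` contracts tangent vectors near `x₀`,
backwards in time, at least by the factor `exp (l s)`. -/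
theorem exists_flow_contraction_near (hφ : IsIsometricImmersion (m := m) φ)
    {c : EuclideanSpace ℝ (Fin n)} {V W : ∀ x : M, TangentSpace (𝓡 m) x}
    (hV : ∀ (x : M) (v : TangentSpace (𝓡 m) x),
      inner ℝ (V x) v = inner ℝ (φ x - c) (differential (m := m) φ x v))
    {Φ : ℝ → M → M}
    (hΦ : ContMDiff (𝓘(ℝ, ℝ).prod (𝓡 m)) (𝓡 m) ∞ (fun z : ℝ × M => Φ z.1 z.2))
    (hΦ0 : ∀ x, Φ 0 x = x) (hΦW : ∀ x, IsMIntegralCurve (fun t => Φ t x) W)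
    {x₀ : M} (hW : ∀ᶠ x in 𝓝 x₀, W x = V x) {l : ℝ}
    (hl : ∀ v : TangentSpace (𝓡 m) x₀, v ≠ 0 →
      l * ‖v‖ ^ 2 < ‖v‖ ^ 2 + inner ℝ (φ x₀ - c) (secondFundamentalForm φ x₀ v v)) :
    ∃ s₀ > 0, ∀ᶠ x in 𝓝 x₀, ∀ s ∈ Icc (-s₀) 0, ∀ v : TangentSpace (𝓡 m) x,
      ‖mfderiv (𝓡 m) (𝓡 m) (Φ s) x v‖ ≤ Real.exp (l * s) * ‖v‖ := by
  set e := extChartAt (𝓡 m) x₀ with he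
  set y₀ := e x₀ with hy₀
  set ψ := chartRep (m := m) φ x₀ with hψdef
  have hTo : IsOpen e.target := isOpen_extChartAt_target x₀
  have hyT : y₀ ∈ e.target := mem_extChartAt_target x₀
  have hψ : ContDiffOn ℝ ∞ ψ e.target := contDiffOn_chartRep hφ.1 x₀
  let H : ℝ × EuclideanSpace ℝ (Fin m) → EuclideanSpace ℝ (Fin n) :=
    fun p => φ (Φ p.1 (e.symm p.2))
  have hH : ContDiffOn ℝ ∞ H (univ ×ˢ e.target) := by
    have h1 : ContMDiffOn 𝓘(ℝ, ℝ × EuclideanSpace ℝ (Fin m)) (𝓘(ℝ, ℝ).prod (𝓡 m)) ∞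
        (fun p : ℝ × EuclideanSpace ℝ (Fin m) => (p.1, e.symm p.2)) (univ ×ˢ e.target) := by
      refine ContMDiffOn.prodMk contDiff_fst.contMDiff.contMDiffOn ?_
      exact (contMDiffOn_extChartAt_symm x₀).comp contDiff_snd.contMDiff.contMDiffOn
        fun p hp => hp.2
    have h2 := (hφ.1.comp hΦ).comp_contMDiffOn h1
    exact h2.contDiffOn
  have hopen : IsOpen ((univ : Set ℝ) ×ˢ e.target) := isOpen_univ.prod hTo
  have hHat : ∀ s, ∀ y ∈ e.target, ContDiffAt ℝ ∞ H (s, y) := fun s y hy =>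
    hH.contDiffAt (hopen.mem_nhds ⟨mem_univ _, hy⟩)
  -- the differential in space of the flow, as seen in `ℝⁿ`
  let A : ℝ × EuclideanSpace ℝ (Fin m) → EuclideanSpace ℝ (Fin m) →L[ℝ] EuclideanSpace ℝ (Fin n) :=
    fun p => (fderiv ℝ H p).comp (ContinuousLinearMap.inr ℝ ℝ (EuclideanSpace ℝ (Fin m)))
  have hfH : ContDiffAt ℝ ∞ (fderiv ℝ H) (0, y₀) := (hHat 0 y₀ hyT).fderiv_right (by simp)
  have hA : ContDiffAt ℝ ∞ A (0, y₀) := hfH.clm_comp contDiffAt_const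
  have hAfd : ∀ s, ∀ y ∈ e.target, A (s, y) = fderiv ℝ (fun z => H (s, z)) y := by
    intro s y hy
    have h1 := ((hHat s y hy).differentiableAt (by simp)).hasFDerivAt.comp y
      (hasFDerivAt_prodMk_right s y)
    exact h1.fderiv.symm
  have hAs : ∀ s, ∀ y ∈ e.target, ∀ u, ‖A (s, y) u‖ = ‖mfderiv (𝓡 m) (𝓡 m) (Φ s) (e.symm y)
      (mfderiv 𝓘(ℝ, EuclideanSpace ℝ (Fin m)) (𝓡 m) e.symm y u)‖ := by
    intro s y hy u
    rw [hAfd s y hy]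
    have hΦs : ContMDiff (𝓡 m) (𝓡 m) ∞ (Φ s) :=
      ContMDiff.comp (I' := 𝓘(ℝ, ℝ).prod (𝓡 m)) (g := fun z : ℝ × M => Φ z.1 z.2)
        (f := fun x => (s, x)) hΦ (contMDiff_const.prodMk contMDiff_id)
    exact norm_fderiv_chartRep_comp hφ hΦs x₀ hy u
  have hH0 : (fun z => H (0, z)) = ψ := by
    funext z; simp only [H, hΦ0]; rfl
  have hA0 : ∀ y ∈ e.target, A (0, y) = fderiv ℝ ψ y := fun y hy => by
    rw [hAfd 0 y hy, hH0]
  -- the velocity of the flow at time `0`, in `ℝⁿ`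
  let τ : EuclideanSpace ℝ (Fin m) → EuclideanSpace ℝ (Fin n) := fun y => fderiv ℝ H (0, y) (1, 0)
  have hτ : ∀ y ∈ e.target, τ y = differential (m := m) φ (e.symm y) (W (e.symm y)) := by
    intro y hy
    have h1 : HasDerivAt (fun s : ℝ => H (s, y)) (τ y) 0 := by
      have h3 : HasDerivAt (fun s : ℝ => (s, y)) ((1 : ℝ), (0 : EuclideanSpace ℝ (Fin m))) 0 :=
        (hasDerivAt_id _).prodMk (hasDerivAt_const _ _)
      exact ((hHat 0 y hy).differentiableAt (by simp)).hasFDerivAt.comp_hasDerivAt 0 h3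
    have h2 := (hφ.1.mdifferentiable (by simp) _).hasMFDerivAt.comp 0 (hΦW (e.symm y) 0)
    let D : ℝ →L[ℝ] EuclideanSpace ℝ (Fin n) :=
      (differential (m := m) φ (Φ 0 (e.symm y))).comp
        ((1 : ℝ →L[ℝ] ℝ).smulRight (W (Φ 0 (e.symm y))))
    have h3 : HasFDerivAt (fun s : ℝ => H (s, y)) D 0 := h2.hasFDerivAt
    refine (h1.unique h3.hasDerivAt).trans ?_
    have h4 : (fun x : M => (differential (m := m) φ x (W x) : EuclideanSpace ℝ (Fin n)))
      (Φ 0 (e.symm y)) = differential (m := m) φ (e.symm y) (W (e.symm y)) := by rw [hΦ0]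
    refine Eq.trans ?_ h4
    exact congrArg (differential (m := m) φ (Φ 0 (e.symm y))) (one_smul ℝ _)
  have hτd : HasFDerivAt τ ((fderiv ℝ (fderiv ℝ H) (0, y₀)).flip (1, 0) |>.comp
      (ContinuousLinearMap.inr ℝ ℝ (EuclideanSpace ℝ (Fin m)))) y₀ := by
    have h1 := (hfH.differentiableAt (by simp)).hasFDerivAt.comp y₀ (hasFDerivAt_prodMk_right 0 y₀)
    have h2 := h1.clm_apply
      (hasFDerivAt_const ((1 : ℝ), (0 : EuclideanSpace ℝ (Fin m))) y₀)
    refine h2.congr_fderiv ?_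
    ext u; simp
  -- exchange of the time derivative and the space derivative
  have hAd : ∀ u, fderiv ℝ A (0, y₀) (1, 0) u = fderiv ℝ τ y₀ u := by
    intro u
    have h1 := (hfH.differentiableAt (by simp)).hasFDerivAt.clm_comp
      (hasFDerivAt_const (ContinuousLinearMap.inr ℝ ℝ (EuclideanSpace ℝ (Fin m))) (0, y₀))
    rw [h1.fderiv, hτd.fderiv]
    have h2 := (hHat 0 y₀ hyT).isSymmSndFDerivAt (by simp; norm_cast) (1, 0) (0, u)
    simpa using h2
  have hWV : ∀ᶠ z in 𝓝 y₀, z ∈ e.target ∧ W (e.symm z) = V (e.symm z) := by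
    refine Filter.Eventually.and (hTo.mem_nhds hyT) ?_
    have h1 : Tendsto e.symm (𝓝 y₀) (𝓝 x₀) := by
      have := (continuousAt_extChartAt_symm (I := 𝓡 m) x₀)
      rwa [ContinuousAt, extChartAt_to_inv] at this
    exact h1.eventually hW
  obtain ⟨s₀, hs₀, hs⟩ := exists_exp_contraction hA (l := l) (by
    intro u hu
    have h1 := inner_fderiv_tangential (ψ := ψ) (τ := τ) (y := y₀) (c := c)
      (hψ.contDiffAt (hTo.mem_nhds hyT)) hτd.differentiableAt (by
        filter_upwards [hWV] with z hz u
        rw [hτ z hz.1, hz.2, hψdef, fderiv_chartRep hφ.1 x₀ hz.1]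
        exact (hφ.2 _ _ _).trans (hV _ _))
      (by
        rw [hτ y₀ hyT]
        obtain ⟨u, hu⟩ := surjective_mfderiv_extChartAt_symm x₀ hyT (W (e.symm y₀))
        rw [← hu]
        exact ⟨u, fderiv_chartRep hφ.1 x₀ hyT u⟩) u
    rw [hAd, hA0 y₀ hyT, h1]
    let v : TangentSpace (𝓡 m) x₀ := u
    have h2 := hl v hu
    have h4 : ‖v‖ = ‖fderiv ℝ ψ y₀ u‖ := by
      rw [← norm_differential hφ, differential_eq_fderiv_chartRep hφ.1]
      rfl
    rw [secondFundamentalForm_eq_normalHessian hφ.1 x₀ v v, h4] at h2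
    have h3 : ψ y₀ = φ x₀ := congrArg φ (extChartAt_to_inv (I := 𝓡 m) x₀)
    rw [h3]
    exact h2)
  refine ⟨s₀, hs₀, ?_⟩
  have h1 : Tendsto e (𝓝 x₀) (𝓝 y₀) := continuousAt_extChartAt (I := 𝓡 m) x₀
  filter_upwards [h1.eventually hs, extChartAt_source_mem_nhds (I := 𝓡 m) x₀] with x hx hxs s hsI v
  have hyx : e x ∈ e.target := e.map_source hxs
  have hex : e.symm (e x) = x := e.left_inv hxs
  generalize hy : e x = y at hx hyx hex
  subst hex
  obtain ⟨u, rfl⟩ := surjective_mfderiv_extChartAt_symm x₀ hyx v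
  have h2 := hx s hsI u
  have h3 := hAs s y hyx u
  have h4 : ‖A (0, y) u‖ = ‖mfderiv 𝓘(ℝ, EuclideanSpace ℝ (Fin m)) (𝓡 m) e.symm y u‖ := by
    rw [hA0 y hyx, ← norm_differential hφ]
    exact congrArg _ (fderiv_chartRep hφ.1 x₀ hyx u)
  rw [h3, h4] at h2
  exact h2

/-- The conclusion of `exists_flow_contraction_near`, uniformly on a compact set. -/
theorem exists_flow_contraction_on (hφ : IsIsometricImmersion (m := m) φ)
    {c : EuclideanSpace ℝ (Fin n)} {V W : ∀ x : M, TangentSpace (𝓡 m) x}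
    (hV : ∀ (x : M) (v : TangentSpace (𝓡 m) x),
      inner ℝ (V x) v = inner ℝ (φ x - c) (differential (m := m) φ x v))
    {Φ : ℝ → M → M}
    (hΦ : ContMDiff (𝓘(ℝ, ℝ).prod (𝓡 m)) (𝓡 m) ∞ (fun z : ℝ × M => Φ z.1 z.2))
    (hΦ0 : ∀ x, Φ 0 x = x) (hΦW : ∀ x, IsMIntegralCurve (fun t => Φ t x) W)
    {C : Set M} (hC : IsCompact C) (hW : ∀ x₀ ∈ C, ∀ᶠ x in 𝓝 x₀, W x = V x) {l : ℝ}
    (hl : ∀ x ∈ C, ∀ v : TangentSpace (𝓡 m) x, v ≠ 0 →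
      l * ‖v‖ ^ 2 < ‖v‖ ^ 2 + inner ℝ (φ x - c) (secondFundamentalForm φ x v v)) :
    ∃ s₀ > 0, ∀ x ∈ C, ∀ s ∈ Icc (-s₀) 0, ∀ v : TangentSpace (𝓡 m) x,
      ‖mfderiv (𝓡 m) (𝓡 m) (Φ s) x v‖ ≤ Real.exp (l * s) * ‖v‖ := by
  refine hC.induction_on (p := fun C => ∃ s₀ > 0, ∀ x ∈ C, ∀ s ∈ Icc (-s₀) 0,
    ∀ v : TangentSpace (𝓡 m) x, ‖mfderiv (𝓡 m) (𝓡 m) (Φ s) x v‖ ≤ Real.exp (l * s) * ‖v‖)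
    ⟨1, one_pos, by simp⟩ ?_ ?_ ?_
  · rintro s t hst ⟨r, hr, h⟩
    exact ⟨r, hr, fun x hx => h x (hst hx)⟩
  · rintro s t ⟨r, hr, h⟩ ⟨r', hr', h'⟩
    refine ⟨min r r', lt_min hr hr', ?_⟩
    rintro x (hx | hx) q hq
    · exact h x hx q ⟨(neg_le_neg (min_le_left _ _)).trans hq.1, hq.2⟩
    · exact h' x hx q ⟨(neg_le_neg (min_le_right _ _)).trans hq.1, hq.2⟩
  · intro x hx
    obtain ⟨s₀, hs₀, h⟩ := exists_flow_contraction_near hφ hV hΦ hΦ0 hΦW (hW x hx) (hl x hx)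
    exact ⟨_, mem_nhdsWithin_of_mem_nhds h, s₀, hs₀, fun x hx => hx⟩

end FlowContraction

/-! ### Monotonicity of the gradient -/

section Monotonicity

variable {m n : ℕ} {M : Type*} [MetricSpace M] [ChartedSpace (EuclideanSpace ℝ (Fin m)) M]
  {φ : M → EuclideanSpace ℝ (Fin n)}

theorem hasDerivAt_comp_integralCurve
    (hφ : ContMDiff (𝓡 m) 𝓘(ℝ, EuclideanSpace ℝ (Fin n)) ∞ φ)
    {W : ∀ x : M, TangentSpace (𝓡 m) x} {γ : ℝ → M} (hγ : IsMIntegralCurve γ W) (t : ℝ) :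
    HasDerivAt (fun t => φ (γ t)) (differential (m := m) φ (γ t) (W (γ t))) t := by
  have h2 := (hφ.mdifferentiable (by simp) (γ t)).hasMFDerivAt.comp t (hγ t)
  let D : ℝ →L[ℝ] EuclideanSpace ℝ (Fin n) :=
    (differential (m := m) φ (γ t)).comp ((1 : ℝ →L[ℝ] ℝ).smulRight (W (γ t)))
  have h3 : HasFDerivAt (fun t => φ (γ t)) D t := h2.hasFDerivAt
  refine h3.hasDerivAt.congr_deriv ?_
  exact congrArg (differential (m := m) φ (γ t)) (one_smul ℝ _)

variable [RiemannianBundle (fun x : M => TangentSpace (𝓡 m) x)]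

theorem continuous_norm_integralCurve (hφ : IsIsometricImmersion (m := m) φ)
    {W : ∀ x : M, TangentSpace (𝓡 m) x} {γ : ℝ → M} (hγ : IsMIntegralCurve γ W)
    (hγs : ContMDiff 𝓘(ℝ, ℝ) (𝓡 m) ∞ γ) : Continuous fun t => ‖W (γ t)‖ := by
  have h1 : ContDiff ℝ ∞ (fun t => φ (γ t)) := (hφ.1.comp hγs).contDiff
  have h2 : Continuous (deriv (fun t => φ (γ t))) := h1.continuous_deriv (by simp)
  have h3 : (fun t => ‖W (γ t)‖) = fun t => ‖deriv (fun t => φ (γ t)) t‖ := by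
    funext t
    rw [(hasDerivAt_comp_integralCurve hφ.1 hγ t).deriv, norm_differential hφ]
  rw [h3]
  exact h2.norm

variable [IsRiemannianManifold (𝓡 m) M]

/-- For short times, an integral curve moves at most slightly faster than its initial speed. -/
theorem exists_dist_integralCurve_le (hφ : IsIsometricImmersion (m := m) φ)
    {W : ∀ x : M, TangentSpace (𝓡 m) x} {γ : ℝ → M} (hγ : IsMIntegralCurve γ W)
    (hγs : ContMDiff 𝓘(ℝ, ℝ) (𝓡 m) ∞ γ) {ε : ℝ} (hε : 0 < ε) :
    ∃ s₀ > 0, ∀ s ∈ Icc 0 s₀, dist (γ (-s)) (γ 0) ≤ s * (‖W (γ 0)‖ + ε) := by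
  have hc := (continuous_norm_integralCurve hφ hγ hγs).continuousAt (x := 0)
  have h1 : ∀ᶠ t in 𝓝 (0 : ℝ), ‖W (γ t)‖ < ‖W (γ 0)‖ + ε :=
    hc.eventually (gt_mem_nhds (by linarith))
  obtain ⟨s₀, hs₀, h2⟩ := Metric.nhds_basis_closedBall.eventually_iff.1 h1
  refine ⟨s₀, hs₀, fun s hs => ?_⟩
  have h3 := edist_le_pathELength (𝓡 m) (neg_nonpos.2 hs.1)
    ((hγs.of_le (m := 1) (by norm_cast)).contMDiffOn (s := Icc (-s) 0))
  have hB : 0 ≤ ‖W (γ 0)‖ + ε := by positivity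
  have h4 : pathELength (𝓡 m) γ (-s) 0 ≤ ENNReal.ofReal (s * (‖W (γ 0)‖ + ε)) := by
    rw [pathELength_eq_lintegral_mfderiv_Icc]
    calc _ ≤ ∫⁻ _t in Icc (-s) 0, ENNReal.ofReal (‖W (γ 0)‖ + ε) := by
          refine MeasureTheory.setLIntegral_mono' measurableSet_Icc fun t ht => ?_
          have h5 : mfderiv 𝓘(ℝ, ℝ) (𝓡 m) γ t 1 = W (γ t) := by
            rw [(hγ t).mfderiv]
            exact one_smul ℝ (W (γ t))
          refine (congrArg (‖·‖ₑ) h5).trans_le ?_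
          rw [← ofReal_norm]
          refine ENNReal.ofReal_le_ofReal (h2 ?_).le
          rw [Metric.mem_closedBall, Real.dist_eq, sub_zero, abs_le]
          exact ⟨by linarith [ht.1, hs.2], ht.2.trans hs₀.le⟩
      _ = _ := by
          rw [MeasureTheory.setLIntegral_const, Real.volume_Icc, zero_sub, neg_neg,
            ← ENNReal.ofReal_mul hB, mul_comm]
  have h6 := h3.trans h4
  rw [edist_dist] at h6
  exact (ENNReal.ofReal_le_ofReal_iff (mul_nonneg hs.1 hB)).1 h6

variable [IsManifold (𝓡 m) ∞ M] [ProperSpace M]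

/-- **Monotonicity of a gradient field**: if the Hessian of `f = ½|φ - c|²`, whose gradient is `V`,
is at least `l` times the metric on a ball around `x`, then `|V(x)| + |V(z)| ≥ l dist(z, x)` for
every `z` in the ball. On a minimal geodesic `σ` from `z` to `x` this would follow by
integrating `(f ∘ σ)'' ≥ l`; the proof compares the triangle inequality with the contraction of
distances by the flow of `V` instead. -/
theorem mul_dist_le_norm_add_norm (hφ : IsIsometricImmersion (m := m) φ)
    {c : EuclideanSpace ℝ (Fin n)} {V : ∀ x : M, TangentSpace (𝓡 m) x}
    (hVs : ContMDiff (𝓡 m) (𝓡 m).tangent ∞ (fun x => (⟨x, V x⟩ : TangentBundle (𝓡 m) M)))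
    (hV : ∀ (x : M) (v : TangentSpace (𝓡 m) x),
      inner ℝ (V x) v = inner ℝ (φ x - c) (differential (m := m) φ x v))
    {x z : M} {r l : ℝ} (hz : dist z x < r)
    (hl : ∀ y ∈ Metric.closedBall x r, ∀ v : TangentSpace (𝓡 m) y,
      l * ‖v‖ ^ 2 ≤ ‖v‖ ^ 2 + inner ℝ (φ y - c) (secondFundamentalForm φ y v v)) :
    l * dist z x ≤ ‖V x‖ + ‖V z‖ := by
  by_contra! hcon
  set d := dist z x with hd
  set B := ‖V x‖ + ‖V z‖ with hB
  have hB0 : 0 ≤ B := by positivity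
  have hd0 : 0 < d := by
    rcases (dist_nonneg (x := z) (y := x)).lt_or_eq with h | h
    · exact h
    · rw [hd, ← h, mul_zero] at hcon; linarith
  obtain ⟨l', hl'1, hl'2⟩ : ∃ l', B / d < l' ∧ l' < l :=
    exists_between ((div_lt_iff₀ hd0).2 hcon)
  have hl'0 : 0 < l' := (div_nonneg hB0 hd0.le).trans_lt hl'1
  have hl'd : B < l' * d := (div_lt_iff₀ hd0).1 hl'1
  set ε := (l' * d - B) / 4 with hεdef
  have hε : 0 < ε := by rw [hεdef]; linarith
  -- a compactly supported field that agrees with `V` near the ball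
  obtain ⟨χ, hχ1, hχ0, -⟩ := exists_contMDiffMap_one_nhds_of_subset_interior (𝓡 m) (n := (⊤ : ℕ∞))
    (s := Metric.closedBall x r) (t := Metric.closedBall x (r + 1)) Metric.isClosed_closedBall
    ((Metric.closedBall_subset_ball (by linarith)).trans Metric.ball_subset_interior_closedBall)
  let W : ∀ x : M, TangentSpace (𝓡 m) x := fun x => χ x • V x
  have hWs : ContMDiff (𝓡 m) (𝓡 m).tangent ∞
      (fun x => (⟨x, W x⟩ : TangentBundle (𝓡 m) M)) := χ.contMDiff.smul_section hVs
  obtain ⟨Φ, hΦ, hΦ0, -, hΦW⟩ := exists_smooth_flow hWs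
    (isCompact_closedBall x (r + 1)) (fun y hy => by simp [W, hχ0 y hy])
  have hWV : ∀ y ∈ Metric.closedBall x r, ∀ᶠ z in 𝓝 y, W z = V z := fun y hy => by
    filter_upwards [Filter.Eventually.filter_mono (nhds_le_nhdsSet hy) hχ1] with z hz
    simp [W, hz]
  obtain ⟨s₀, hs₀, hcontr⟩ := exists_flow_contraction_on hφ hV hΦ hΦ0 hΦW
    (isCompact_closedBall x r) hWV (l := l') (fun y hy v hv => by
      have h1 := hl y hy v
      have h2 : 0 < ‖v‖ ^ 2 := by positivity
      nlinarith)
  have hΦs : ∀ s, ContMDiff (𝓡 m) (𝓡 m) ∞ (Φ s) := fun s =>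
    ContMDiff.comp (I' := 𝓘(ℝ, ℝ).prod (𝓡 m)) (g := fun z : ℝ × M => Φ z.1 z.2)
      (f := fun x => (s, x)) hΦ (contMDiff_const.prodMk contMDiff_id)
  have hΦx : ∀ y, ContMDiff 𝓘(ℝ, ℝ) (𝓡 m) ∞ (fun t => Φ t y) := fun y =>
    ContMDiff.comp (I' := 𝓘(ℝ, ℝ).prod (𝓡 m)) (g := fun z : ℝ × M => Φ z.1 z.2)
      (f := fun s => (s, y)) hΦ (contMDiff_id.prodMk contMDiff_const)
  -- the flow contracts the almost shortest paths from `z` to `x`, which stay in the ball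
  have hdist : ∀ s ∈ Icc 0 s₀, dist (Φ (-s) z) (Φ (-s) x) ≤ Real.exp (-(l' * s)) * d := by
    intro s hs
    have hexp := Real.exp_pos (-(l' * s))
    rw [← div_le_iff₀' hexp]
    refine le_of_forall_gt_imp_ge_of_dense fun r' hr' => ?_
    rw [div_le_iff₀' hexp]
    have h1 : d < min r' r := lt_min hr' hz
    obtain ⟨γ, h0, h1, hγ, hlen, hγr⟩ := exists_path_of_dist_lt (𝓡 m) h1
    have h2 := pathELength_comp_le (I' := 𝓡 m) (Ψ := Φ (-s)) (a := 0) (b := 1)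
      (C := ENNReal.ofReal (Real.exp (-(l' * s)))) ENNReal.ofReal_ne_top
      ((hΦs (-s)).mdifferentiable (by simp)) hγ (fun t ht v => by
        have h3 : γ t ∈ Metric.closedBall x r := by
          rw [Metric.mem_closedBall]
          have := hγr t ht
          have h4 := min_le_right r' r
          have h5 := dist_nonneg (x := z) (y := γ t)
          linarith
        have h4 := hcontr _ h3 (-s) ⟨neg_le_neg hs.2, neg_nonpos.2 hs.1⟩ v
        rw [← ofReal_norm, ← ofReal_norm, ← ENNReal.ofReal_mul hexp.le]
        refine ENNReal.ofReal_le_ofReal (h4.trans_eq ?_)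
        rw [mul_neg])
    have h3 := edist_le_pathELength (𝓡 m) zero_le_one
      (((hΦs (-s)).of_le (m := 1) (by norm_cast)).comp_contMDiffOn hγ)
    have h4 : edist (Φ (-s) z) (Φ (-s) x) ≤ ENNReal.ofReal (Real.exp (-(l' * s)) * r') := by
      rw [ENNReal.ofReal_mul hexp.le]
      simp only [Function.comp_apply, h0, h1] at h3
      refine (h3.trans h2).trans ?_
      gcongr
      exact hlen.le.trans (ENNReal.ofReal_le_ofReal (min_le_left _ _))
    rw [edist_dist] at h4
    have hr'0 : 0 ≤ r' := hd0.le.trans hr'.le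
    exact (ENNReal.ofReal_le_ofReal_iff (by positivity)).1 h4
  obtain ⟨s₁, hs₁, hx⟩ := exists_dist_integralCurve_le hφ (hΦW x) (hΦx x) hε
  obtain ⟨s₂, hs₂, hz'⟩ := exists_dist_integralCurve_le hφ (hΦW z) (hΦx z) hε
  simp only [hΦ0] at hx hz'
  have hrr : 0 < r := hd0.trans hz
  have hWx : W x = V x := (hWV x (Metric.mem_closedBall_self hrr.le)).self_of_nhds
  have hWz : W z = V z := (hWV z (Metric.mem_closedBall.2 hz.le)).self_of_nhds
  have hW0 : ∀ y, ‖W (Φ 0 y)‖ = ‖W y‖ := fun y => congrArg (fun q => ‖W q‖) (hΦ0 y)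
  rw [hW0, hWx] at hx
  rw [hW0, hWz] at hz'
  -- the triangle inequality along `z`, `Φ₋ₛ z`, `Φ₋ₛ x`, `x`, with `exp (-l' s) ≤ 1 / (1 + l' s)`,
  -- divided by `s`
  have key : ∀ s, 0 < s → s ≤ min s₀ (min s₁ s₂) → l' * d ≤ (B + 2 * ε) * (1 + l' * s) := by
    intro s hs hs'
    have e0 := hdist s ⟨hs.le, hs'.trans (min_le_left _ _)⟩
    have e1 := hx s ⟨hs.le, hs'.trans ((min_le_right _ _).trans (min_le_left _ _))⟩
    have e2 := hz' s ⟨hs.le, hs'.trans ((min_le_right _ _).trans (min_le_right _ _))⟩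
    have e3 : d ≤ dist (Φ (-s) z) z + dist (Φ (-s) z) (Φ (-s) x) + dist (Φ (-s) x) x := by
      have := dist_triangle4 z (Φ (-s) z) (Φ (-s) x) x
      rwa [dist_comm z (Φ (-s) z)] at this
    have hu : 0 < l' * s := by positivity
    have e4 : Real.exp (-(l' * s)) * (1 + l' * s) ≤ 1 := by
      have := Real.add_one_le_exp (l' * s)
      rw [Real.exp_neg, inv_mul_le_iff₀ (Real.exp_pos _)]
      linarith
    have e5 : d ≤ s * (B + 2 * ε) + Real.exp (-(l' * s)) * d := by
      rw [hB]; nlinarith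
    have e6 : d * (1 + l' * s) ≤ s * (B + 2 * ε) * (1 + l' * s) + d := by
      calc d * (1 + l' * s) ≤ (s * (B + 2 * ε) + Real.exp (-(l' * s)) * d) * (1 + l' * s) := by
            gcongr
        _ = s * (B + 2 * ε) * (1 + l' * s) + (Real.exp (-(l' * s)) * (1 + l' * s)) * d := by ring
        _ ≤ s * (B + 2 * ε) * (1 + l' * s) + 1 * d := by gcongr
        _ = _ := by ring
    have e7 : s * (l' * d) ≤ s * ((B + 2 * ε) * (1 + l' * s)) := by linarith
    exact le_of_mul_le_mul_left e7 hs
  have hlim : Tendsto (fun s : ℝ => (B + 2 * ε) * (1 + l' * s)) (𝓝[>] 0)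
      (𝓝 ((B + 2 * ε) * (1 + l' * 0))) :=
    (Continuous.tendsto (by fun_prop) 0).mono_left nhdsWithin_le_nhds
  have hmin : 0 < min s₀ (min s₁ s₂) := lt_min hs₀ (lt_min hs₁ hs₂)
  have := ge_of_tendsto hlim (by
    filter_upwards [Ioc_mem_nhdsGT hmin] with s hs using key s hs.1 hs.2)
  rw [hεdef] at this
  linarith

end Monotonicity

/-! ### Growth of the gradient and properness -/

section Properness

variable {m n : ℕ} {M : Type*} [MetricSpace M] [ChartedSpace (EuclideanSpace ℝ (Fin m)) M]
  {φ : M → EuclideanSpace ℝ (Fin n)} [RiemannianBundle (fun x : M => TangentSpace (𝓡 m) x)]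

/-- An isometric immersion does not increase distances. -/
theorem norm_sub_le_dist [IsRiemannianManifold (𝓡 m) M] (hφ : IsIsometricImmersion (m := m) φ)
    (x y : M) : ‖φ x - φ y‖ ≤ dist x y := by
  rw [← dist_eq_norm]
  refine le_of_forall_gt_imp_ge_of_dense fun r hr => ?_
  obtain ⟨γ, h0, h1, hγ, hlen, -⟩ := exists_path_of_dist_lt (𝓡 m) hr
  have h2 := pathELength_comp_le (I' := 𝓘(ℝ, EuclideanSpace ℝ (Fin n))) (Ψ := φ) (a := 0) (b := 1)
    (C := 1) ENNReal.one_ne_top (hφ.1.mdifferentiable (by simp)) hγ (fun t _ v => by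
      rw [one_mul, ← ofReal_norm, ← ofReal_norm]
      refine ENNReal.ofReal_le_ofReal (le_of_eq ?_)
      refine Eq.trans ?_ (norm_differential hφ (γ t) v)
      exact norm_tangentSpace_vectorSpace)
  have h3 := edist_le_pathELength 𝓘(ℝ, EuclideanSpace ℝ (Fin n)) zero_le_one
    ((hφ.1.of_le (m := 1) (by norm_cast)).comp_contMDiffOn hγ)
  rw [one_mul] at h2
  have h4 := (h3.trans h2).trans hlen.le
  simp only [Function.comp_apply, h0, h1] at h4
  rw [edist_dist] at h4
  exact (ENNReal.ofReal_le_ofReal_iff (dist_nonneg.trans hr.le)).1 h4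

omit [RiemannianBundle (fun x : M => TangentSpace (𝓡 m) x)] in
theorem secondFundamentalForm_smul (x : M) (a : ℝ) (v : TangentSpace (𝓡 m) x) :
    secondFundamentalForm φ x (a • v) (a • v) = (a * a) • secondFundamentalForm φ x v v := by
  let P := ((differential (m := m) φ x).toLinearMap.range)ᗮ.starProjection
  let B := fderiv ℝ (fderiv ℝ (φ ∘ (extChartAt (𝓡 m) x).symm)) (extChartAt (𝓡 m) x x)
  let u : EuclideanSpace ℝ (Fin m) := v
  have h : P (B (a • u) (a • u)) = (a * a) • P (B u u) := by
    rw [map_smul, map_smul, map_smul, smul_apply, map_smul, smul_smul]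
  exact h

/-- The gradient of `½|φ - c|²` is the tangential part of `φ - c`, hence not longer. -/
theorem norm_le_of_isGradient {c : EuclideanSpace ℝ (Fin n)} (hφ : IsIsometricImmersion (m := m) φ)
    {V : ∀ x : M, TangentSpace (𝓡 m) x}
    (hV : ∀ (x : M) (v : TangentSpace (𝓡 m) x),
      inner ℝ (V x) v = inner ℝ (φ x - c) (differential (m := m) φ x v)) (x : M) :
    ‖V x‖ ≤ ‖φ x - c‖ := by
  have h1 := hV x (V x)
  rw [real_inner_self_eq_norm_sq] at h1
  have h2 := real_inner_le_norm (φ x - c) (differential (m := m) φ x (V x))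
  rw [norm_differential hφ] at h2
  rcases (norm_nonneg (V x)).eq_or_lt with h | h
  · rw [← h]; positivity
  · refine le_of_mul_le_mul_right ?_ h
    rw [← h1, sq] at h2
    exact h2

variable [IsManifold (𝓡 m) ∞ M] [IsRiemannianManifold (𝓡 m) M]

/-- The curvature hypothesis bounds the Hessian of `½|φ - φ(p)|²` from below, away from a ball:
by the Gauss equation `|α(ν, ν)|² ≤ -Ric(ν, ν) ≤ q / ρ²` with `q < 1`, while `|φ - φ(p)| ≤ ρ`. -/
theorem exists_hessian_lower_bound (hφ : IsIsometricImmersion (m := m) φ)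
    (hmin : IsMinimalImmersion (m := m) φ)
    (p : M) (K : CompactExhaustion M) (hb : (-1 : EReal) < ricciDecay (m := m) p K) :
    ∃ l > 0, ∃ R ≥ 0, ∀ x, R < dist p x → ∀ v : TangentSpace (𝓡 m) x,
      l * ‖v‖ ^ 2 ≤ ‖v‖ ^ 2 + inner ℝ (φ x - φ p) (secondFundamentalForm φ x v v) := by
  obtain ⟨a, ha1, ha2⟩ := EReal.lt_iff_exists_real_btwn.1 hb
  have ha : -1 < a := by
    rw [← EReal.coe_one, ← EReal.coe_neg] at ha1
    exact EReal.coe_lt_coe_iff.1 ha1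
  obtain ⟨i, hi⟩ := ((tendsto_ricciDecaySeq (m := m) p K).eventually (lt_mem_nhds ha2)).exists
  obtain ⟨R, hR⟩ := (K.isCompact i).isBounded.subset_closedBall p
  set q := max 0 (-a) with hq
  have hq0 : 0 ≤ q := le_max_left _ _
  have hq1 : q < 1 := max_lt one_pos (by linarith)
  have hsq : √q < 1 := by rw [Real.sqrt_lt' one_pos]; simpa
  refine ⟨1 - √q, by linarith, max R 0, le_max_right _ _, fun x hx v => ?_⟩
  have hρ : 0 < dist p x := (le_max_right R 0).trans_lt hx
  have hxK : x ∉ K i := fun h => by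
    have := hR h
    rw [Metric.mem_closedBall, dist_comm] at this
    linarith [le_max_left R 0]
  have hunit : ∀ ν : TangentSpace (𝓡 m) x, ‖ν‖ = 1 →
      -√q ≤ inner ℝ (φ x - φ p) (secondFundamentalForm φ x ν ν) := by
    intro ν hν
    have h1 : (a : EReal) ≤ ((dist p x ^ 2 * ricci x ν ν : ℝ) : EReal) :=
      hi.le.trans (sInf_le ⟨x, ν, hxK, hν, rfl⟩)
    have h2 : a ≤ dist p x ^ 2 * ricci x ν ν := by exact_mod_cast h1
    have h3 := norm_secondFundamentalForm_sq_le hφ hmin x ν hν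
    have h4 : (dist p x * ‖secondFundamentalForm φ x ν ν‖) ^ 2 ≤ q := by
      have : dist p x ^ 2 * ‖secondFundamentalForm φ x ν ν‖ ^ 2 ≤ dist p x ^ 2 * -ricci x ν ν := by
        gcongr
      rw [mul_pow]
      linarith [le_max_right 0 (-a)]
    have h5 : dist p x * ‖secondFundamentalForm φ x ν ν‖ ≤ √q := Real.le_sqrt_of_sq_le h4
    have h6 := neg_le_of_abs_le (abs_real_inner_le_norm (φ x - φ p) (secondFundamentalForm φ x ν ν))
    have h7 : ‖φ x - φ p‖ * ‖secondFundamentalForm φ x ν ν‖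
        ≤ dist p x * ‖secondFundamentalForm φ x ν ν‖ := by
      gcongr
      rw [dist_comm]
      exact norm_sub_le_dist hφ x p
    linarith
  rcases eq_or_ne v 0 with rfl | hv
  · have h0 := secondFundamentalForm_smul (φ := φ) x 0 (0 : TangentSpace (𝓡 m) x)
    rw [zero_smul, mul_zero, zero_smul] at h0
    rw [h0, inner_zero_right]
    simp
  have hv0 : 0 < ‖v‖ := norm_pos_iff.2 hv
  have h1 := hunit (‖v‖⁻¹ • v) (by rw [norm_smul, norm_inv, norm_norm, inv_mul_cancel₀ hv0.ne'])
  rw [secondFundamentalForm_smul, real_inner_smul_right] at h1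
  have h2 := mul_le_mul_of_nonneg_left h1 (sq_nonneg ‖v‖)
  rw [← mul_assoc, show ‖v‖ ^ 2 * (‖v‖⁻¹ * ‖v‖⁻¹) = 1 by field_simp, one_mul] at h2
  linarith

/-- The distance to `p` is bounded, up to constants, by the length of the gradient of
`½|φ - φ(p)|²`. -/
theorem exists_linear_lower_bound [ProperSpace M] (hφ : IsIsometricImmersion (m := m) φ)
    (hmin : IsMinimalImmersion (m := m) φ)
    (p : M) (K : CompactExhaustion M) (hb : (-1 : EReal) < ricciDecay (m := m) p K)
    {V : ∀ x : M, TangentSpace (𝓡 m) x}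
    (hVs : ContMDiff (𝓡 m) (𝓡 m).tangent ∞ (fun x => (⟨x, V x⟩ : TangentBundle (𝓡 m) M)))
    (hV : ∀ (x : M) (v : TangentSpace (𝓡 m) x),
      inner ℝ (V x) v = inner ℝ (φ x - φ p) (differential (m := m) φ x v)) :
    ∃ l > 0, ∃ C, ∀ x, l * dist p x - C ≤ ‖V x‖ := by
  obtain ⟨l, hl, R₀, hR₀, hH⟩ := exists_hessian_lower_bound hφ hmin p K hb
  refine ⟨l, hl, l * (R₀ + 1) + (R₀ + 1), fun x => ?_⟩
  rcases le_or_gt (dist p x) (R₀ + 1) with hx | hx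
  · have := mul_le_mul_of_nonneg_left hx hl.le
    linarith [norm_nonneg (V x)]
  obtain ⟨z, hz, hzx⟩ := exists_dist_eq_of_le_dist (𝓡 m) (by linarith) hx.le
    (show dist p x < dist p x + 1 / 2 by linarith)
  have h1 := mul_dist_le_norm_add_norm hφ hVs hV (x := x) (z := z)
    (r := dist p x - (R₀ + 1) + 3 / 4) (l := l) (by linarith) (fun y hy v => by
      refine hH y ?_ v
      rw [Metric.mem_closedBall] at hy
      linarith [dist_triangle p y x])
  have h2 : ‖V z‖ ≤ R₀ + 1 := by
    refine (norm_le_of_isGradient hφ hV z).trans ((norm_sub_le_dist hφ z p).trans ?_)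
    rw [dist_comm, hz]
  have h3 : dist p x - (R₀ + 1) ≤ dist z x := by linarith [dist_triangle p z x]
  have h4 := mul_le_mul_of_nonneg_left h3 hl.le
  linarith

omit [IsManifold (𝓡 m) ∞ M] [IsRiemannianManifold (𝓡 m) M] in
theorem isProperMap_of_linear_lower_bound [ProperSpace M] (hφ : IsIsometricImmersion (m := m) φ)
    {p : M} {V : ∀ x : M, TangentSpace (𝓡 m) x}
    (hV : ∀ (x : M) (v : TangentSpace (𝓡 m) x),
      inner ℝ (V x) v = inner ℝ (φ x - φ p) (differential (m := m) φ x v))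
    {l C : ℝ} (hl : 0 < l) (h : ∀ x, l * dist p x - C ≤ ‖V x‖) : IsProperMap φ := by
  refine isProperMap_iff_isCompact_preimage.2 ⟨hφ.1.continuous, fun S hS => ?_⟩
  obtain ⟨r, hr⟩ := hS.isBounded.subset_closedBall (φ p)
  refine (isCompact_closedBall p ((r + C) / l)).of_isClosed_subset
    (hS.isClosed.preimage hφ.1.continuous) fun x hx => ?_
  have h1 := hr hx
  rw [Metric.mem_closedBall, dist_eq_norm] at h1
  rw [Metric.mem_closedBall, dist_comm, le_div_iff₀ hl]
  have h2 := h x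
  have h3 := norm_le_of_isGradient hφ hV x
  linarith

end Properness

/-! ### Subsets with adapted half-space charts -/

section Boundary

variable {m : ℕ} [NeZero m] {M : Type*} [TopologicalSpace M] {S T : Set M}

theorem halfSpace_val_symm {z : EuclideanSpace ℝ (Fin m)} (hz : 0 ≤ z 0) :
    ((𝓡∂ m).symm z).1 = z :=
  (𝓡∂ m).right_inv (by rw [range_modelWithCornersEuclideanHalfSpace]; exact hz)

open Classical in
/-- A chart `e` of `M` in which the subset `S` is a half-space induces a chart of `S`. The point
`x₀` only serves as the junk value of the inverse. -/
def halfSpaceChart (e : OpenPartialHomeomorph M (EuclideanSpace ℝ (Fin m)))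
    (h : ∀ y ∈ e.source, y ∈ S ↔ 0 ≤ e y 0) (x₀ : S) :
    OpenPartialHomeomorph S (EuclideanHalfSpace m) where
  toFun x := (𝓡∂ m).symm (e x)
  invFun y := if hy : e.symm y.1 ∈ S then ⟨_, hy⟩ else x₀
  source := Subtype.val ⁻¹' e.source
  target := Subtype.val ⁻¹' e.target
  map_source' x hx := by
    rw [mem_preimage, halfSpace_val_symm ((h x hx).1 x.2)]
    exact e.map_source hx
  map_target' y hy := by
    have h1 : e.symm y.1 ∈ S := (h _ (e.map_target hy)).2 (by rw [e.right_inv hy]; exact y.2)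
    rw [dif_pos h1]
    exact e.map_target hy
  left_inv' x hx := by
    have h1 : ((𝓡∂ m).symm (e x)).1 = e x := halfSpace_val_symm ((h x hx).1 x.2)
    have h2 : e.symm ((𝓡∂ m).symm (e x)).1 = x := by rw [h1, e.left_inv hx]
    have h3 : e.symm ((𝓡∂ m).symm (e x)).1 ∈ S := by rw [h2]; exact x.2
    rw [dif_pos h3]
    exact Subtype.ext h2
  right_inv' y hy := by
    have h1 : e.symm y.1 ∈ S := (h _ (e.map_target hy)).2 (by rw [e.right_inv hy]; exact y.2)
    rw [dif_pos h1, e.right_inv hy]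
    exact Subtype.ext (halfSpace_val_symm y.2)
  open_source := e.open_source.preimage continuous_subtype_val
  open_target := e.open_target.preimage continuous_subtype_val
  continuousOn_toFun := (𝓡∂ m).continuous_symm.comp_continuousOn
    (e.continuousOn.comp continuous_subtype_val.continuousOn fun x hx => hx)
  continuousOn_invFun := by
    rw [Topology.IsInducing.subtypeVal.continuousOn_iff]
    refine (e.continuousOn_symm.comp continuous_subtype_val.continuousOn
      fun x hx => hx).congr fun y hy => ?_
    have h1 : e.symm y.1 ∈ S := (h _ (e.map_target hy)).2 (by rw [e.right_inv hy]; exact y.2)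
    simp only [Function.comp_apply, dif_pos h1]

theorem coe_halfSpaceChart_symm (e : OpenPartialHomeomorph M (EuclideanSpace ℝ (Fin m)))
    (h : ∀ y ∈ e.source, y ∈ S ↔ 0 ≤ e y 0) (x₀ : S) {y : EuclideanHalfSpace m}
    (hy : y.1 ∈ e.target) : ((halfSpaceChart e h x₀).symm y : M) = e.symm y.1 := by
  have h1 : e.symm y.1 ∈ S := (h _ (e.map_target hy)).2 (by rw [e.right_inv hy]; exact y.2)
  exact congrArg Subtype.val (dif_pos h1)

theorem halfSpaceChart_val (e : OpenPartialHomeomorph M (EuclideanSpace ℝ (Fin m)))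
    (h : ∀ y ∈ e.source, y ∈ S ↔ 0 ≤ e y 0) (x₀ : S) {x : S} (hx : x.1 ∈ e.source) :
    (halfSpaceChart e h x₀ x).1 = e x :=
  halfSpace_val_symm ((h x hx).1 x.2)

variable [ChartedSpace (EuclideanSpace ℝ (Fin m)) M]

/-- Around every point of `S` there is a smooth chart of `M` in which `S` is the closed half-space
`0 ≤ y₀` and `T` is the open one. -/
def HasAdaptedCharts (S T : Set M) : Prop :=
  ∀ x ∈ S, ∃ e ∈ IsManifold.maximalAtlas (𝓡 m) ∞ M, x ∈ e.source ∧
    (∀ y ∈ e.source, y ∈ S ↔ 0 ≤ e y 0) ∧ ∀ y ∈ e.source, y ∈ T ↔ 0 < e y 0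

namespace HasAdaptedCharts

variable (H : HasAdaptedCharts (m := m) S T)

/-- The chosen adapted chart of `M` around a point of `S`. -/
def chart (x : S) : OpenPartialHomeomorph M (EuclideanSpace ℝ (Fin m)) := (H x x.2).choose

theorem chart_mem (x : S) : H.chart x ∈ IsManifold.maximalAtlas (𝓡 m) ∞ M :=
  (H x x.2).choose_spec.1

theorem mem_chart_source (x : S) : x.1 ∈ (H.chart x).source := (H x x.2).choose_spec.2.1

theorem mem_iff_nonneg (x : S) : ∀ y ∈ (H.chart x).source, y ∈ S ↔ 0 ≤ H.chart x y 0 :=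
  (H x x.2).choose_spec.2.2.1

theorem mem_iff_pos (x : S) : ∀ y ∈ (H.chart x).source, y ∈ T ↔ 0 < H.chart x y 0 :=
  (H x x.2).choose_spec.2.2.2

/-- The structure of a manifold with boundary on `S`. -/
@[reducible] def chartedSpace : ChartedSpace (EuclideanHalfSpace m) S where
  atlas := range fun x => halfSpaceChart (H.chart x) (H.mem_iff_nonneg x) x
  chartAt x := halfSpaceChart (H.chart x) (H.mem_iff_nonneg x) x
  mem_chart_source x := H.mem_chart_source x
  chart_mem_atlas x := mem_range_self x

theorem isManifold : @IsManifold _ _ _ _ _ _ _ (𝓡∂ m) ∞ S _ H.chartedSpace := by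
  let _ := H.chartedSpace
  refine isManifold_of_contDiffOn (𝓡∂ m) ∞ S ?_
  rintro _ _ ⟨x, rfl⟩ ⟨x', rfl⟩
  have h1 : ContDiffOn ℝ ∞ (H.chart x' ∘ (H.chart x).symm)
      ((H.chart x).target ∩ (H.chart x).symm ⁻¹' (H.chart x').source) := by
    have := (contMDiffOn_of_mem_maximalAtlas (H.chart_mem x')).comp'
      (contMDiffOn_symm_of_mem_maximalAtlas (H.chart_mem x))
    exact this.contDiffOn
  have key : ∀ y ∈ (𝓡∂ m).symm ⁻¹' ((halfSpaceChart (H.chart x) (H.mem_iff_nonneg x) x).symm ≫ₕ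
      halfSpaceChart (H.chart x') (H.mem_iff_nonneg x') x').source ∩ range (𝓡∂ m),
      ((halfSpaceChart (H.chart x) (H.mem_iff_nonneg x) x).symm ((𝓡∂ m).symm y) : M)
        = (H.chart x).symm y ∧ y ∈ (H.chart x).target ∧
          (H.chart x).symm y ∈ (H.chart x').source := by
    rintro y ⟨⟨hy1, hy2⟩, hy3⟩
    rw [range_modelWithCornersEuclideanHalfSpace] at hy3
    have e1 : ((𝓡∂ m).symm y).1 = y := halfSpace_val_symm hy3
    have e2 : ((𝓡∂ m).symm y).1 ∈ (H.chart x).target := hy1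
    have e3 := coe_halfSpaceChart_symm (H.chart x) (H.mem_iff_nonneg x) x e2
    rw [e1] at e2 e3
    refine ⟨e3, e2, ?_⟩
    rw [← e3]
    exact hy2
  refine (h1.mono fun y hy => ⟨(key y hy).2.1, (key y hy).2.2⟩).congr fun y hy => ?_
  obtain ⟨k1, -, k3⟩ := key y hy
  have k4 := halfSpaceChart_val (H.chart x') (H.mem_iff_nonneg x') x'
    (x := (halfSpaceChart (H.chart x) (H.mem_iff_nonneg x) x).symm ((𝓡∂ m).symm y))
    (by rw [k1]; exact k3)
  rw [k1] at k4
  exact k4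

theorem interior_eq : @ModelWithCorners.interior _ _ _ _ _ _ _ (𝓡∂ m) S _ H.chartedSpace
    = Subtype.val ⁻¹' T := by
  let _ := H.chartedSpace
  ext x
  have h1 : extChartAt (𝓡∂ m) x x = H.chart x x :=
    halfSpaceChart_val (H.chart x) (H.mem_iff_nonneg x) x (H.mem_chart_source x)
  change extChartAt (𝓡∂ m) x x ∈ interior (range (𝓡∂ m)) ↔ x.1 ∈ T
  rw [h1, interior_range_modelWithCornersEuclideanHalfSpace,
    H.mem_iff_pos x x (H.mem_chart_source x)]
  rfl

theorem contMDiff_val : @ContMDiff _ _ _ _ _ _ _ (𝓡∂ m) S _ H.chartedSpace _ _ _ _ _ (𝓡 m) M _ _ ∞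
    (Subtype.val : S → M) := by
  let _ := H.chartedSpace
  have := H.isManifold
  intro x
  have h1 : ContMDiffAt (𝓡∂ m) 𝓘(ℝ, EuclideanSpace ℝ (Fin m)) ∞ (extChartAt (𝓡∂ m) x) x :=
    contMDiffAt_extChartAt
  have hx : extChartAt (𝓡∂ m) x x = H.chart x x :=
    halfSpaceChart_val (H.chart x) (H.mem_iff_nonneg x) x (H.mem_chart_source x)
  have h2 : ContMDiffAt (𝓡 m) (𝓡 m) ∞ (H.chart x).symm (extChartAt (𝓡∂ m) x x) := by
    rw [hx]
    exact contMDiffAt_symm_of_mem_maximalAtlas (H.chart_mem x)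
      ((H.chart x).map_source (H.mem_chart_source x))
  refine (h2.comp x h1).congr_of_eventuallyEq ?_
  filter_upwards [(continuous_subtype_val.continuousAt (x := x)).eventually
    ((H.chart x).open_source.mem_nhds (H.mem_chart_source x))] with y hy
  have h3 : extChartAt (𝓡∂ m) x y = H.chart x y :=
    halfSpaceChart_val (H.chart x) (H.mem_iff_nonneg x) x hy
  rw [Function.comp_apply, h3, (H.chart x).left_inv hy]

theorem contMDiff_of_val_comp {g : M → S}
    (hg : ContMDiff (𝓡 m) (𝓡 m) ∞ (fun x => (g x : M))) :
    @ContMDiff _ _ _ _ _ _ _ (𝓡 m) M _ _ _ _ _ _ _ (𝓡∂ m) S _ H.chartedSpace ∞ g := by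
  let _ := H.chartedSpace
  have := H.isManifold
  intro x
  rw [contMDiffAt_iff_target]
  refine ⟨(Topology.IsInducing.subtypeVal.continuous_iff.2 hg.continuous).continuousAt, ?_⟩
  have h1 : ContMDiffAt (𝓡 m) (𝓡 m) ∞ (H.chart (g x)) (g x : M) :=
    contMDiffAt_of_mem_maximalAtlas (H.chart_mem (g x)) (H.mem_chart_source (g x))
  refine (h1.comp x (hg x)).congr_of_eventuallyEq ?_
  filter_upwards [hg.continuous.continuousAt.eventually
    ((H.chart (g x)).open_source.mem_nhds (H.mem_chart_source (g x)))] with y hy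
  exact halfSpaceChart_val (H.chart (g x)) (H.mem_iff_nonneg (g x)) (g x) hy

end HasAdaptedCharts

/-- If `M` is smoothly diffeomorphic to the open half `T` of a compact set `S` with adapted charts,
then `M` is the interior of a compact manifold. -/
theorem isInteriorOfCompactManifold_of_adapted [IsManifold (𝓡 m) ∞ M] [T2Space M]
    (hS : IsCompact S) (H : HasAdaptedCharts (m := m) S T) (hT : IsOpen T) (hTS : T ⊆ S)
    {g k : M → M} (hg : ContMDiff (𝓡 m) (𝓡 m) ∞ g) (hgT : ∀ x, g x ∈ T)
    (hk : ContMDiffOn (𝓡 m) (𝓡 m) ∞ k T) (hkg : ∀ x, k (g x) = x) (hgk : ∀ y ∈ T, g (k y) = y) :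
    IsInteriorOfCompactManifold m M := by
  let _ := H.chartedSpace
  have := H.isManifold
  let U : TopologicalSpace.Opens S := ⟨Subtype.val ⁻¹' T, hT.preimage continuous_subtype_val⟩
  let G : M → U := fun x => ⟨⟨g x, hTS (hgT x)⟩, hgT x⟩
  let K : U → M := fun y => k y.1.1
  have hG : ContMDiff (𝓡 m) (𝓡∂ m) ∞ G := by
    rw [← ContMDiff.subtypeVal_comp_iff]
    exact H.contMDiff_of_val_comp hg
  have hK : ContMDiff (𝓡∂ m) (𝓡 m) ∞ K := by
    have h1 : ContMDiff (𝓡∂ m) (𝓡 m) ∞ (fun y : U => (y.1.1 : M)) :=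
      H.contMDiff_val.comp contMDiff_subtype_val
    exact fun y => ((hk y.1.1 y.2).contMDiffAt (hT.mem_nhds y.2)).comp y (h1 y)
  exact ⟨S, inferInstance, H.chartedSpace, U, H.isManifold, inferInstance,
    isCompact_iff_compactSpace.1 hS, H.interior_eq.symm,
    ⟨⟨⟨G, K, hkg, fun y => Subtype.ext (Subtype.ext (hgk _ y.2))⟩, hG, hK⟩⟩⟩

end Boundary

/-! ### Sublevel sets of regular values -/

section RegularSublevel

/-- The inverse function theorem, with both directions smooth on their whole domains. -/
theorem exists_openPartialHomeomorph_of_hasFDerivAt {E : Type*} [NormedAddCommGroup E]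
    [NormedSpace ℝ E] [CompleteSpace E] {G : E → E} {T : Set E} (hT : IsOpen T)
    (hG : ContDiffOn ℝ ∞ G T) {y₀ : E} (hy₀ : y₀ ∈ T) {A : E ≃L[ℝ] E}
    (hA : HasFDerivAt G (A : E →L[ℝ] E) y₀) :
    ∃ g : OpenPartialHomeomorph E E, y₀ ∈ g.source ∧ g.source ⊆ T ∧ (∀ y, g y = G y) ∧
      ContDiffOn ℝ ∞ g g.source ∧ ContDiffOn ℝ ∞ g.symm g.target := by
  have hc : ContDiffAt ℝ ∞ G y₀ := hG.contDiffAt (hT.mem_nhds hy₀)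
  let g₀ := hc.toOpenPartialHomeomorph G hA (by simp)
  have hg₀ : ∀ y, g₀ y = G y := fun y => rfl
  let W : Set E := T ∩ fderiv ℝ G ⁻¹' (range ((↑) : (E ≃L[ℝ] E) → E →L[ℝ] E))
  have hW : IsOpen W :=
    (hG.continuousOn_fderiv_of_isOpen hT (by simp)).isOpen_inter_preimage hT
      ContinuousLinearEquiv.isOpen
  let g := g₀.restrOpen W hW
  have hs : g.source ⊆ W := by
    rw [OpenPartialHomeomorph.restrOpen_source]; exact inter_subset_right
  refine ⟨g, ?_, hs.trans inter_subset_left, fun y => rfl, ?_, ?_⟩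
  · rw [OpenPartialHomeomorph.restrOpen_source]
    exact ⟨hc.mem_toOpenPartialHomeomorph_source hA (by simp), hy₀, A, hA.fderiv.symm⟩
  · exact (hG.mono (hs.trans inter_subset_left)).congr fun y _ => rfl
  · intro z hz
    obtain ⟨h1, B, hB⟩ := hs (g.map_target hz)
    have h2 : ContDiffAt ℝ ∞ G (g.symm z) := hG.contDiffAt (hT.mem_nhds h1)
    have h3 : HasFDerivAt G (B : E →L[ℝ] E) (g.symm z) := by
      rw [hB]; exact (h2.differentiableAt (by simp)).hasFDerivAt
    exact (g.contDiffAt_symm hz h3 h2).contDiffWithinAt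

variable {m : ℕ} [NeZero m]

/-- A function without critical points is, locally, the coordinate `0` of a chart. -/
theorem exists_openPartialHomeomorph_coord_zero {F : EuclideanSpace ℝ (Fin m) → ℝ}
    {T : Set (EuclideanSpace ℝ (Fin m))} (hT : IsOpen T) (hF : ContDiffOn ℝ ∞ F T)
    {y₀ : EuclideanSpace ℝ (Fin m)} (hy₀ : y₀ ∈ T) (h0 : fderiv ℝ F y₀ ≠ 0) :
    ∃ g : OpenPartialHomeomorph (EuclideanSpace ℝ (Fin m)) (EuclideanSpace ℝ (Fin m)),
      y₀ ∈ g.source ∧ g.source ⊆ T ∧ (∀ y, g y 0 = F y) ∧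
      ContDiffOn ℝ ∞ g g.source ∧ ContDiffOn ℝ ∞ g.symm g.target := by
  set L := fderiv ℝ F y₀ with hL
  obtain ⟨i, hi⟩ : ∃ i, L (EuclideanSpace.single i 1) ≠ 0 := by
    by_contra! hcon
    refine h0 (ContinuousLinearMap.ext fun u => ?_)
    rw [euclidean_eq_sum_single u, map_sum]
    simp [hcon]
  let σ : Equiv.Perm (Fin m) := Equiv.swap 0 i
  -- permute the coordinates so that coordinate `i` can be replaced by `F`
  let A₀ : EuclideanSpace ℝ (Fin m) →ₗ[ℝ] EuclideanSpace ℝ (Fin m) :=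
    (WithLp.linearEquiv 2 ℝ (Fin m → ℝ)).symm.toLinearMap ∘ₗ
      LinearMap.pi (fun k => if k = 0 then L.toLinearMap else
        (EuclideanSpace.proj (𝕜 := ℝ) (σ k)).toLinearMap)
  have hA0 : ∀ u, A₀ u 0 = L u := fun u => by simp [A₀]
  have hAk : ∀ u k, k ≠ 0 → A₀ u k = u (σ k) := fun u k hk => by simp [A₀, hk]
  have hinj : Function.Injective A₀ := by
    rw [injective_iff_map_eq_zero]
    intro u hu
    have h1 : ∀ j, j ≠ i → u j = 0 := by
      intro j hj
      have h2 : σ j ≠ 0 := fun h => hj (by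
        rw [← σ.symm_apply_apply j, h]; simp [σ])
      have h3 := hAk u (σ j) h2
      rw [hu, show σ (σ j) = j from Equiv.swap_apply_self 0 i j] at h3
      exact h3.symm
    have h2 : u = u i • EuclideanSpace.single i (1 : ℝ) := by
      ext j
      rcases eq_or_ne j i with rfl | hj
      · simp
      · simp [h1 j hj, hj]
    have h3 := hA0 u
    rw [hu, h2, map_smul, smul_eq_mul] at h3
    rw [h2, (mul_eq_zero.1 h3.symm).resolve_right hi, zero_smul]
  let A := (LinearEquiv.ofInjectiveEndo A₀ hinj).toContinuousLinearEquiv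
  have hA : ∀ u, A u = A₀ u := fun u => rfl
  let G : EuclideanSpace ℝ (Fin m) → EuclideanSpace ℝ (Fin m) :=
    fun y => A y + (F y - L y) • EuclideanSpace.single 0 (1 : ℝ)
  have hGd : HasFDerivAt G (A : EuclideanSpace ℝ (Fin m) →L[ℝ] EuclideanSpace ℝ (Fin m)) y₀ := by
    have h1 : HasFDerivAt F L y₀ :=
      ((hF.contDiffAt (hT.mem_nhds hy₀)).differentiableAt (by simp)).hasFDerivAt
    have h2 := A.hasFDerivAt.add
      ((h1.sub L.hasFDerivAt).smul_const (EuclideanSpace.single 0 (1 : ℝ)))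
    refine h2.congr_fderiv ?_
    ext1 u
    simp
  have hGs : ContDiffOn ℝ ∞ G T :=
    A.contDiff.contDiffOn.add ((hF.sub L.contDiff.contDiffOn).smul contDiffOn_const)
  obtain ⟨g, hg1, hg2, hg3, hg4, hg5⟩ := exists_openPartialHomeomorph_of_hasFDerivAt hT hGs hy₀ hGd
  refine ⟨g, hg1, hg2, fun y => ?_, hg4, hg5⟩
  rw [hg3]
  simp [G, hA, hA0]

variable {M : Type*} [TopologicalSpace M] [ChartedSpace (EuclideanSpace ℝ (Fin m)) M]
  [IsManifold (𝓡 m) ∞ M]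

omit [NeZero m] in
theorem chartAt_trans_mem_maximalAtlas (x : M)
    {g : OpenPartialHomeomorph (EuclideanSpace ℝ (Fin m)) (EuclideanSpace ℝ (Fin m))}
    (hg : ContDiffOn ℝ ∞ g g.source) (hg' : ContDiffOn ℝ ∞ g.symm g.target) :
    (chartAt (EuclideanSpace ℝ (Fin m)) x).trans g ∈ IsManifold.maximalAtlas (𝓡 m) ∞ M := by
  refine OpenPartialHomeomorph.mem_maximalAtlas_of_contMDiffOn _ ?_ ?_
  · exact hg.contMDiffOn.comp (contMDiffOn_chart.mono (by
      rw [OpenPartialHomeomorph.trans_source]; exact inter_subset_left)) fun y hy => by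
        rw [OpenPartialHomeomorph.trans_source] at hy; exact hy.2
  · exact contMDiffOn_chart_symm.comp (hg'.contMDiffOn.mono (by
      rw [OpenPartialHomeomorph.trans_target]; exact inter_subset_left)) fun y hy => by
        rw [OpenPartialHomeomorph.trans_target] at hy; exact hy.2

/-- A sublevel set of a regular value is a submanifold with boundary. -/
theorem hasAdaptedCharts_sublevel {f : M → ℝ} (hf : ContMDiff (𝓡 m) 𝓘(ℝ, ℝ) ∞ f) {a : ℝ}
    (ha : ∀ x, f x = a → mfderiv (𝓡 m) 𝓘(ℝ, ℝ) f x ≠ 0) :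
    HasAdaptedCharts (m := m) {x | f x ≤ a} {x | f x < a} := by
  intro x hx
  set e := chartAt (EuclideanSpace ℝ (Fin m)) x with he
  have hxs : x ∈ e.source := mem_chart_source _ x
  rcases (show f x ≤ a from hx).lt_or_eq with hlt | heq
  · -- near an interior point, translate the chart into the open half-space
    let c : EuclideanSpace ℝ (Fin m) := EuclideanSpace.single 0 (1 : ℝ) - e x
    let τ := (Homeomorph.addRight c).toOpenPartialHomeomorph
    let W : Set (EuclideanSpace ℝ (Fin m)) :=
      (e.target ∩ e.symm ⁻¹' {y | f y < a}) ∩ {y | 0 < (y + c) 0}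
    have hW : IsOpen W := by
      refine IsOpen.inter (e.continuousOn_symm.isOpen_inter_preimage e.open_target
        (isOpen_lt hf.continuous continuous_const)) (isOpen_lt continuous_const ?_)
      fun_prop
    let g := τ.restrOpen W hW
    have hgs : g.source = W := by
      rw [OpenPartialHomeomorph.restrOpen_source]; simp [τ]
    have hgc : ∀ y, g y = y + c := fun y => rfl
    have hgm : e.trans g ∈ IsManifold.maximalAtlas (𝓡 m) ∞ M :=
      chartAt_trans_mem_maximalAtlas x (contDiff_id.add contDiff_const).contDiffOn
        (contDiff_id.add contDiff_const).contDiffOn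
    have hsrc : ∀ y ∈ (e.trans g).source, f y < a ∧ 0 < (e.trans g) y 0 := by
      intro y hy
      rw [OpenPartialHomeomorph.trans_source, hgs] at hy
      obtain ⟨h1, ⟨-, h2⟩, h3⟩ := hy
      refine ⟨?_, h3⟩
      have h4 : f (e.symm (e y)) < a := h2
      rwa [e.left_inv h1] at h4
    refine ⟨e.trans g, hgm, ?_, fun y hy => ?_, fun y hy => ?_⟩
    · rw [OpenPartialHomeomorph.trans_source, hgs]
      refine ⟨hxs, ⟨e.map_source hxs, ?_⟩, ?_⟩
      · change f (e.symm (e x)) < a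
        rwa [e.left_inv hxs]
      · change 0 < (e x + c) 0
        simp [c]
    · exact iff_of_true (hsrc y hy).1.le (hsrc y hy).2.le
    · exact iff_of_true (hsrc y hy).1 (hsrc y hy).2
  · let F : EuclideanSpace ℝ (Fin m) → ℝ := fun y => a - f (e.symm y)
    have hF : ContDiffOn ℝ ∞ F e.target :=
      contDiffOn_const.sub (hf.comp_contMDiffOn contMDiffOn_chart_symm).contDiffOn
    have hF0 : fderiv ℝ F (e x) ≠ 0 := by
      intro h0
      refine ha x heq ?_
      have h1 : fderiv ℝ F (e x) = - fderiv ℝ (fun y => f (e.symm y)) (e x) :=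
        fderiv_const_sub a
      have h2 : mfderiv (𝓡 m) 𝓘(ℝ, ℝ) f x = fderiv ℝ (fun y => f (e.symm y)) (e x) := by
        refine (hf.mdifferentiable (by simp) x).mfderiv.trans ?_
        simp only [writtenInExtChartAt, mfld_simps, fderivWithin_univ]
        rfl
      rw [h0] at h1
      exact h2.trans (neg_eq_zero.1 h1.symm)
    obtain ⟨g, hg1, hg2, hg3, hg4, hg5⟩ :=
      exists_openPartialHomeomorph_coord_zero e.open_target hF (e.map_source hxs) hF0
    have hv : ∀ y ∈ (e.trans g).source, (e.trans g) y 0 = a - f y := by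
      intro y hy
      rw [OpenPartialHomeomorph.trans_source] at hy
      have h1 : (e.trans g) y 0 = a - f (e.symm (e y)) := hg3 (e y)
      rw [h1, e.left_inv hy.1]
    refine ⟨e.trans g, chartAt_trans_mem_maximalAtlas x hg4 hg5, ?_, fun y hy => ?_,
      fun y hy => ?_⟩
    · rw [OpenPartialHomeomorph.trans_source]
      exact ⟨hxs, hg1⟩
    · rw [hv y hy]
      exact (sub_nonneg (a := a) (b := f y)).symm
    · rw [hv y hy]
      exact (sub_pos (a := a) (b := f y)).symm

end RegularSublevel

/-! ### A diffeomorphism from a half-line to the line -/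

section Compression

/-- A smooth diffeomorphism `h` from `(-∞, b + 1)` to `ℝ`, with inverse `θ`, that is the identity on
`(-∞, b]`. -/
theorem exists_compression (b : ℝ) : ∃ h θ : ℝ → ℝ, ContDiffOn ℝ ∞ h (Iio (b + 1)) ∧
    ContDiff ℝ ∞ θ ∧ (∀ t, θ t < b + 1) ∧ (∀ t, h (θ t) = t) ∧ (∀ t < b + 1, θ (h t) = t) ∧
    (∀ t ≤ b, h t = t) ∧ ∀ t < b + 1, t ≤ h t := by
  -- `h t = t + exp (-1 / (t - b)) / (b + 1 - t)` for `b < t < b + 1`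
  let q : ℝ → ℝ := fun t => expNegInvGlue (t - b)
  let h : ℝ → ℝ := fun t => t + q t / (b + 1 - t)
  have hq0 : ∀ t, 0 ≤ q t := fun t => expNegInvGlue.nonneg _
  have hqs : ContDiff ℝ ∞ q := expNegInvGlue.contDiff.comp (contDiff_id.sub contDiff_const)
  have hqm : Monotone q := expNegInvGlue.monotone.comp fun s t hst => by linarith
  have hs : ContDiffOn ℝ ∞ h (Iio (b + 1)) :=
    contDiffOn_id.add (hqs.contDiffOn.div (contDiffOn_const.sub contDiffOn_id) fun t ht => by
      have : t < b + 1 := ht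
      linarith)
  have hle : ∀ t < b + 1, t ≤ h t := fun t ht =>
    le_add_of_nonneg_right (div_nonneg (hq0 t) (by linarith))
  have hid : ∀ t ≤ b, h t = t := fun t ht => by
    simp [h, q, expNegInvGlue.zero_of_nonpos (sub_nonpos.2 ht)]
  have hder : ∀ t < b + 1, ∃ d, 0 < d ∧ HasDerivAt h d t := by
    intro t ht
    have h1 : HasDerivAt q (deriv q t) t := (hqs.differentiable (by simp) t).hasDerivAt
    have h2 : HasDerivAt (fun t => b + 1 - t) (-1) t := (hasDerivAt_id t).const_sub (b + 1)
    have h3 := (hasDerivAt_id t).add (h1.div h2 (by linarith))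
    refine ⟨_, ?_, h3⟩
    have h4 : 0 ≤ deriv q t := hqm.deriv_nonneg
    have h5 : 0 < b + 1 - t := by linarith
    have h6 := hq0 t
    have h7 : 0 ≤ (deriv q t * (b + 1 - t) - q t * -1) / (b + 1 - t) ^ 2 := by
      refine div_nonneg ?_ (by positivity)
      rw [mul_neg_one, sub_neg_eq_add]
      positivity
    linarith
  have hmono : StrictMonoOn h (Iio (b + 1)) := by
    intro s hs t ht hst
    have ht' : t < b + 1 := ht
    have h1 : q s / (b + 1 - s) ≤ q t / (b + 1 - t) :=
      div_le_div₀ (hq0 t) (hqm hst.le) (by linarith) (by linarith)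
    simp only [h]
    linarith
  have hsurj : ∀ t, ∃ s < b + 1, h s = t := by
    intro t
    rcases le_or_gt t b with ht | ht
    · exact ⟨t, by linarith, hid t ht⟩
    have hc : 0 < q (b + 1 / 2) := expNegInvGlue.pos_of_pos (by linarith)
    set δ := min (1 / 2) (q (b + 1 / 2) / (t - b)) with hδ
    have hδ0 : 0 < δ := lt_min (by norm_num) (div_pos hc (by linarith))
    have hδ1 : δ ≤ 1 / 2 := min_le_left _ _
    have hδ2 : δ * (t - b) ≤ q (b + 1 / 2) := by
      rw [← le_div_iff₀ (by linarith)]; exact min_le_right _ _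
    have h1 : t ≤ h (b + 1 - δ) := by
      have h2 : q (b + 1 / 2) ≤ q (b + 1 - δ) := hqm (by linarith)
      have h3 : t - b ≤ q (b + 1 - δ) / δ := by
        rw [le_div_iff₀ hδ0]; linarith
      simp only [h]
      rw [show b + 1 - (b + 1 - δ) = δ by ring]
      linarith
    have h4 : ContinuousOn h (Icc b (b + 1 - δ)) := hs.continuousOn.mono fun s hs => by
      have := hs.2
      exact (show s < b + 1 by linarith)
    obtain ⟨s, hs1, hs2⟩ := intermediate_value_Icc (by linarith) h4
      (show t ∈ Icc _ _ from ⟨by rw [hid b le_rfl]; exact ht.le, h1⟩)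
    exact ⟨s, by linarith [hs1.2], hs2⟩
  choose θ hθ1 hθ2 using hsurj
  refine ⟨h, θ, hs, contDiff_iff_contDiffAt.2 fun t => ?_, hθ1, hθ2,
    fun t ht => hmono.injOn (hθ1 _) ht (hθ2 _), hid, hle⟩
  obtain ⟨d, hd0, hd⟩ := hder (θ t) (hθ1 t)
  have h1 : ContDiffAt ℝ ∞ h (θ t) := hs.contDiffAt (Iio_mem_nhds (hθ1 t))
  have hF : HasFDerivAt h ((ContinuousLinearEquiv.unitsEquivAut ℝ (Units.mk0 d hd0.ne') :
      ℝ ≃L[ℝ] ℝ) : ℝ →L[ℝ] ℝ) (θ t) := by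
    refine hd.hasFDerivAt.congr_fderiv ?_
    ext; simp
  have hne : (∞ : WithTop ℕ∞) ≠ 0 := by simp
  have h2 := h1.to_localInverse hF hne
  rw [hθ2] at h2
  refine h2.congr_of_eventuallyEq ?_
  have h3 : ∀ᶠ s in 𝓝 t, h (h1.localInverse hF hne s) = s := by
    have := (h1.hasStrictFDerivAt' hF hne).eventually_right_inverse
    rwa [hθ2] at this
  have h4 : ∀ᶠ s in 𝓝 t, h1.localInverse hF hne s < b + 1 := by
    have h5 : h1.localInverse hF hne t = θ t := by
      have := h1.localInverse_apply_image hF hne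
      rwa [hθ2] at this
    exact h2.continuousAt.eventually (gt_mem_nhds (by rw [h5]; exact hθ1 t))
  filter_upwards [h3, h4] with s hs3 hs4
  exact hmono.injOn (hθ1 s) hs4 ((hθ2 s).trans hs3.symm)

end Compression

/-! ### Completeness of vector fields along proper functions -/

section ProperFlow

variable {E : Type*} [NormedAddCommGroup E] [NormedSpace ℝ E]
  {M : Type*} [TopologicalSpace M] [ChartedSpace E M]

theorem hasDerivAt_comp_of_isMIntegralCurve {f : M → ℝ} (hf : ContMDiff 𝓘(ℝ, E) 𝓘(ℝ, ℝ) ∞ f)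
    {Y : ∀ x : M, TangentSpace 𝓘(ℝ, E) x} {d : M → ℝ}
    (hd : ∀ x, mfderiv 𝓘(ℝ, E) 𝓘(ℝ, ℝ) f x (Y x) = d x) {γ : ℝ → M} (hγ : IsMIntegralCurve γ Y)
    (t : ℝ) : HasDerivAt (fun t => f (γ t)) (d (γ t)) t := by
  have h2 := (hf.mdifferentiable (by simp) (γ t)).hasMFDerivAt.comp t (hγ t)
  let A : E →L[ℝ] ℝ := mfderiv 𝓘(ℝ, E) 𝓘(ℝ, ℝ) f (γ t)
  let y : E := Y (γ t)
  let D : ℝ →L[ℝ] ℝ := A.comp ((1 : ℝ →L[ℝ] ℝ).smulRight y)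
  have h3 : HasFDerivAt (fun t => f (γ t)) D t := h2.hasFDerivAt
  refine h3.hasDerivAt.congr_deriv ?_
  have h4 : D 1 = A y := by simp [D]
  exact h4.trans (hd (γ t))

theorem mfderiv_smul_vectorField {f : M → ℝ} {Y : ∀ x : M, TangentSpace 𝓘(ℝ, E) x} {d : M → ℝ}
    (hd : ∀ x, mfderiv 𝓘(ℝ, E) 𝓘(ℝ, ℝ) f x (Y x) = d x) (c : M → ℝ) (x : M) :
    mfderiv 𝓘(ℝ, E) 𝓘(ℝ, ℝ) f x (c x • Y x) = c x * d x :=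
  (map_smul (mfderiv 𝓘(ℝ, E) 𝓘(ℝ, ℝ) f x) (c x) (Y x)).trans (congrArg (c x • ·) (hd x))

theorem abs_sub_le_of_isMIntegralCurve {f : M → ℝ} (hf : ContMDiff 𝓘(ℝ, E) 𝓘(ℝ, ℝ) ∞ f)
    {Y : ∀ x : M, TangentSpace 𝓘(ℝ, E) x} {d : M → ℝ}
    (hd : ∀ x, mfderiv 𝓘(ℝ, E) 𝓘(ℝ, ℝ) f x (Y x) = d x) (hd1 : ∀ x, |d x| ≤ 1)
    {γ : ℝ → M} (hγ : IsMIntegralCurve γ Y) (s t : ℝ) : |f (γ s) - f (γ t)| ≤ |s - t| := by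
  have h1 := Convex.norm_image_sub_le_of_norm_hasDerivWithin_le (C := 1) (s := univ)
    (f := fun t => f (γ t)) (f' := fun t => d (γ t)) (x := t) (y := s)
    (fun x _ => (hasDerivAt_comp_of_isMIntegralCurve hf hd hγ x).hasDerivWithinAt)
    (fun x _ => hd1 _) convex_univ (mem_univ _) (mem_univ _)
  simpa using h1

variable [FiniteDimensional ℝ E] [IsManifold 𝓘(ℝ, E) ∞ M] [T2Space M]

/-- A smooth vector field along which a proper function is `1`-Lipschitz is complete, and its flow
is smooth. -/
theorem exists_smooth_flow_of_proper {Y : ∀ x : M, TangentSpace 𝓘(ℝ, E) x}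
    (hY : ContMDiff 𝓘(ℝ, E) 𝓘(ℝ, E).tangent ∞ (fun x => (⟨x, Y x⟩ : TangentBundle 𝓘(ℝ, E) M)))
    {f : M → ℝ} (hf : ContMDiff 𝓘(ℝ, E) 𝓘(ℝ, ℝ) ∞ f) (hfc : ∀ b, IsCompact {x | f x ≤ b})
    {d : M → ℝ} (hd : ∀ x, mfderiv 𝓘(ℝ, E) 𝓘(ℝ, ℝ) f x (Y x) = d x) (hd1 : ∀ x, |d x| ≤ 1) :
    ∃ Φ : ℝ → M → M,
      ContMDiff (𝓘(ℝ, ℝ).prod 𝓘(ℝ, E)) 𝓘(ℝ, E) ∞ (fun z : ℝ × M => Φ z.1 z.2) ∧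
      (∀ x, Φ 0 x = x) ∧ (∀ s t x, Φ (s + t) x = Φ s (Φ t x)) ∧
      ∀ x, IsMIntegralCurve (fun t => Φ t x) Y := by
  have : CompleteSpace E := FiniteDimensional.complete ℝ E
  have : IsManifold 𝓘(ℝ, E) 1 M := IsManifold.of_le (n := ∞) (by norm_cast)
  have hY1 := hY.of_le (m := 1) (by norm_cast)
  -- cut-off functions, equal to `1` on `{f ≤ k}`
  let χ : ℕ → M → ℝ := fun k x => Real.smoothTransition (k + 1 - f x)
  have hχs : ∀ k, ContMDiff 𝓘(ℝ, E) 𝓘(ℝ, ℝ) ∞ (χ k) := fun k =>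
    (Real.smoothTransition.contDiff.comp (contDiff_const.sub contDiff_id)).contMDiff.comp hf
  have hχ1 : ∀ (k : ℕ) (x : M), f x ≤ k → χ k x = 1 := fun k x hx =>
    Real.smoothTransition.one_of_one_le (by linarith)
  have hχabs : ∀ k x, |χ k x| ≤ 1 := fun k x => by
    rw [abs_of_nonneg (Real.smoothTransition.nonneg _)]
    exact Real.smoothTransition.le_one _
  have hflow := fun k : ℕ => exists_smooth_flow (V := fun x => χ k x • Y x)
    ((hχs k).smul_section hY) (hfc (k + 1)) (fun x hx => by
      have h1 : χ k x = 0 := Real.smoothTransition.zero_of_nonpos (by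
        have : ¬ f x ≤ k + 1 := hx
        linarith)
      simp only [h1, zero_smul])
  choose Φ hΦs hΦ0 _ hΦc using hflow
  have hgrow : ∀ k x t, f (Φ k t x) ≤ f x + |t| := by
    intro k x t
    have h1 := abs_sub_le_of_isMIntegralCurve hf (d := fun x => χ k x * d x)
      (mfderiv_smul_vectorField hd (χ k)) (fun x => by
        rw [abs_mul]
        exact mul_le_one₀ (hχabs k x) (abs_nonneg _) (hd1 x)) (hΦc k x) t 0
    rw [hΦ0, sub_zero] at h1
    linarith [le_abs_self (f (Φ k t x) - f x)]
  have hcurve : ∀ (k : ℕ) (x : M) (t : ℝ), f x + |t| < k →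
      HasMFDerivAt 𝓘(ℝ, ℝ) 𝓘(ℝ, E) (fun t => Φ k t x) t
      ((1 : ℝ →L[ℝ] ℝ).smulRight (Y (Φ k t x))) := by
    intro k x t ht
    have h1 := hΦc k x t
    have h2 : χ k (Φ k t x) • Y (Φ k t x) = Y (Φ k t x) := by
      rw [hχ1 k _ ((hgrow k x t).trans ht.le), one_smul]
    rwa [← h2]
  -- the truncated flows agree until they leave the set where the cut-off functions are `1`
  have hagree : ∀ (j k : ℕ) (x : M) (t : ℝ), f x + |t| < j → f x + |t| < k → Φ j t x = Φ k t x := by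
    intro j k x t hj hk
    obtain ⟨T, hT1, hT2⟩ := exists_between (show |t| < min (j - f x) (k - f x) from
      lt_min (by linarith) (by linarith))
    have hT0 : 0 < T := (abs_nonneg t).trans_lt hT1
    have hTj := hT2.trans_le (min_le_left _ _)
    have hTk := hT2.trans_le (min_le_right _ _)
    refine isMIntegralCurveOn_Ioo_eqOn_of_contMDiff_boundaryless (t₀ := 0) (v := Y)
      (γ := fun t => Φ j t x) (γ' := fun t => Φ k t x) (a := -T) (b := T)
      ⟨by linarith, hT0⟩ hY1 (fun s hs => ?_) (fun s hs => ?_) (by simp only [hΦ0]) (abs_lt.1 hT1)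
    · exact (hcurve j x s (by linarith [abs_lt.2 hs])).hasMFDerivWithinAt
    · exact (hcurve k x s (by linarith [abs_lt.2 hs])).hasMFDerivWithinAt
  have hN : ∀ (x : M) (t : ℝ), ∃ k : ℕ, f x + |t| < k := fun x t => exists_nat_gt _
  choose N hN using hN
  let Ψ : ℝ → M → M := fun t x => Φ (N x t) t x
  have hΨ : ∀ (k : ℕ) (x : M) (t : ℝ), f x + |t| < k → Ψ t x = Φ k t x := fun k x t h =>
    hagree _ _ _ _ (hN x t) h
  have hΨ0 : ∀ x, Ψ 0 x = x := fun x => hΦ0 _ _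
  have hΨc : ∀ x, IsMIntegralCurve (fun t => Ψ t x) Y := by
    intro x t
    have h1 := hcurve (N x t) x t (hN x t)
    have h2 : (fun s => Ψ s x) =ᶠ[𝓝 t] fun s => Φ (N x t) s x := by
      have hc : Continuous fun s : ℝ => f x + |s| := continuous_const.add continuous_abs
      have h3 : ∀ᶠ s in 𝓝 t, f x + |s| < N x t :=
        hc.continuousAt.eventually (gt_mem_nhds (hN x t))
      filter_upwards [h3] with s hs using hΨ _ _ _ hs
    exact h1.congr_of_eventuallyEq h2
  refine ⟨Ψ, ?_, hΨ0, fun s t x => ?_, hΨc⟩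
  · rintro ⟨t, x⟩
    refine (hΦs (N x t) (t, x)).congr_of_eventuallyEq ?_
    have h3 : ∀ᶠ z : ℝ × M in 𝓝 (t, x), f z.2 + |z.1| < N x t := by
      have hc : Continuous fun z : ℝ × M => f z.2 + |z.1| :=
        (hf.continuous.comp continuous_snd).add (continuous_abs.comp continuous_fst)
      exact hc.continuousAt.eventually (gt_mem_nhds (hN x t))
    filter_upwards [h3] with z hz using hΨ _ _ _ hz
  · have h1 : IsMIntegralCurve ((fun s => Ψ s x) ∘ (· + t)) Y := (hΨc x).comp_add t
    have h2 := isMIntegralCurve_Ioo_eq_of_contMDiff_boundaryless (t₀ := 0) hY1 h1 (hΨc (Ψ t x))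
      (by simp [hΨ0])
    exact congrFun h2 s

end ProperFlow

/-! ### Manifolds with a proper function and few critical points -/

section Interior

variable {m : ℕ} [NeZero m] {M : Type*} [TopologicalSpace M] [T2Space M]
  [ChartedSpace (EuclideanSpace ℝ (Fin m)) M] [IsManifold (𝓡 m) ∞ M]

/-- A manifold with a proper function bounded below, that has no critical points outside a compact
set, is the interior of a compact manifold with boundary. A point at height `f x` is moved along the
normalized gradient-like field to height `θ (f x)`, where `θ` maps the line onto a half-line; this
maps the manifold diffeomorphically onto an open sublevel set of a regular value. -/
theorem isInteriorOfCompactManifold_of_proper {f d : M → ℝ}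
    (hf : ContMDiff (𝓡 m) 𝓘(ℝ, ℝ) ∞ f) (hfc : ∀ b, IsCompact {x | f x ≤ b})
    {V : ∀ x : M, TangentSpace (𝓡 m) x}
    (hV : ContMDiff (𝓡 m) (𝓡 m).tangent ∞ (fun x => (⟨x, V x⟩ : TangentBundle (𝓡 m) M)))
    (hd : ∀ x, mfderiv (𝓡 m) 𝓘(ℝ, ℝ) f x (V x) = d x) (hds : ContMDiff (𝓡 m) 𝓘(ℝ, ℝ) ∞ d)
    {b₀ : ℝ} (hpos : ∀ x, b₀ ≤ f x → 0 < d x) : IsInteriorOfCompactManifold m M := by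
  -- a multiple `Y` of `V` with `df(Y) = χ(f)`, where `χ = 0` on `(-∞, b₀]` and `χ = 1` on `[b, ∞)`
  set b := b₀ + 1 with hb
  let χ : ℝ → ℝ := fun t => Real.smoothTransition (t - b₀)
  have hχs : ContDiff ℝ ∞ χ := Real.smoothTransition.contDiff.comp (contDiff_id.sub contDiff_const)
  have hχ1 : ∀ t, b ≤ t → χ t = 1 := fun t ht =>
    Real.smoothTransition.one_of_one_le (by linarith)
  have hχ0 : ∀ t, t ≤ b₀ → χ t = 0 := fun t ht =>
    Real.smoothTransition.zero_of_nonpos (by linarith)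
  let c : M → ℝ := fun x => χ (f x) / d x
  have hc : ContMDiff (𝓡 m) 𝓘(ℝ, ℝ) ∞ c := by
    intro x
    rcases lt_or_ge (f x) b₀ with hx | hx
    · refine (contMDiffAt_const (c := (0 : ℝ))).congr_of_eventuallyEq ?_
      filter_upwards [hf.continuous.continuousAt.eventually (gt_mem_nhds hx)] with y hy
      simp only [c, hχ0 _ hy.le, zero_div]
    · exact (hχs.contMDiff.comp hf x).div₀ (hds x) (hpos x hx).ne'
  let Y : ∀ x : M, TangentSpace (𝓡 m) x := fun x => c x • V x
  have hY : ContMDiff (𝓡 m) (𝓡 m).tangent ∞ (fun x => (⟨x, Y x⟩ : TangentBundle (𝓡 m) M)) :=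
    hc.smul_section hV
  have hdY : ∀ x, mfderiv (𝓡 m) 𝓘(ℝ, ℝ) f x (Y x) = χ (f x) := by
    intro x
    refine (mfderiv_smul_vectorField hd c x).trans ?_
    rcases lt_or_ge (f x) b₀ with hx | hx
    · simp only [c, hχ0 _ hx.le, zero_div, zero_mul]
      rfl
    · exact div_mul_cancel₀ _ (hpos x hx).ne'
  obtain ⟨Φ, hΦs, hΦ0, hΦadd, hΦc⟩ := exists_smooth_flow_of_proper hY hf hfc hdY (fun x => by
    rw [abs_of_nonneg (Real.smoothTransition.nonneg _)]
    exact Real.smoothTransition.le_one _)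
  have hder : ∀ x t, HasDerivAt (fun t => f (Φ t x)) (χ (f (Φ t x))) t := fun x t =>
    hasDerivAt_comp_of_isMIntegralCurve hf (d := fun x => χ (f x)) hdY (hΦc x) t
  -- above the level `b`, the flow raises `f` at unit speed
  have hheight : ∀ x s, b ≤ f x → b ≤ f x + s → f (Φ s x) = f x + s := by
    intro x s hx hxs
    have hmono : Monotone fun t => f (Φ t x) :=
      monotone_of_deriv_nonneg (fun t => (hder x t).differentiableAt) fun t => by
        rw [(hder x t).deriv]; exact Real.smoothTransition.nonneg _
    have hder' : ∀ t, HasDerivAt (fun t => f (Φ t x) - t) (χ (f (Φ t x)) - 1) t := fun t =>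
      (hder x t).sub (hasDerivAt_id t)
    have hanti : Antitone fun t => f (Φ t x) - t :=
      antitone_of_deriv_nonpos (fun t => (hder' t).differentiableAt) fun t => by
        rw [(hder' t).deriv, sub_nonpos]; exact Real.smoothTransition.le_one _
    have hge : ∀ t ∈ uIcc 0 s, b ≤ f (Φ t x) := by
      intro t ht
      rcases le_total 0 t with h | h
      · have := hmono h
        simp only [hΦ0] at this
        exact hx.trans this
      · have h1 := hanti h
        simp only [hΦ0, sub_zero] at h1
        have h2 : b ≤ f x + t := by
          rcases le_total 0 s with h' | h'
          · rw [uIcc_of_le h'] at ht; linarith [ht.1]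
          · rw [uIcc_of_ge h'] at ht; linarith [ht.1]
        linarith
    have h1 := Convex.norm_image_sub_le_of_norm_hasDerivWithin_le (C := 0) (s := uIcc 0 s)
      (x := 0) (y := s) (fun t _ => (hder' t).hasDerivWithinAt)
      (fun t ht => by rw [hχ1 _ (hge t ht), sub_self, norm_zero]) (convex_uIcc 0 s)
      left_mem_uIcc right_mem_uIcc
    rw [zero_mul, norm_le_zero_iff, hΦ0] at h1
    linarith
  obtain ⟨h, θ, hhs, hθs, hθlt, hhθ, hθh, hid, hle⟩ := exists_compression b
  have hθid : ∀ t ≤ b, θ t = t := fun t ht => by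
    have := hθh t (by linarith)
    rwa [hid t ht] at this
  have hθge : ∀ t, b ≤ t → b ≤ θ t := by
    intro t ht
    by_contra! hlt
    have := hid _ hlt.le
    rw [hhθ] at this
    linarith
  have hgf : ∀ x, f (Φ (θ (f x) - f x) x) = θ (f x) := by
    intro x
    rcases le_total (f x) b with hx | hx
    · rw [hθid _ hx, sub_self, hΦ0]
    · rw [hheight x _ hx (by linarith [hθge _ hx])]
      ring
  have hkf : ∀ y, f y < b + 1 → f (Φ (h (f y) - f y) y) = h (f y) := by
    intro y hy
    rcases le_total (f y) b with hx | hx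
    · rw [hid _ hx, sub_self, hΦ0]
    · rw [hheight y _ hx (by linarith [hle _ hy])]
      ring
  have hT : IsOpen {x : M | f x < b + 1} := isOpen_lt hf.continuous continuous_const
  refine isInteriorOfCompactManifold_of_adapted (S := {x | f x ≤ b + 1}) (T := {x | f x < b + 1})
    (g := fun x => Φ (θ (f x) - f x) x) (k := fun y => Φ (h (f y) - f y) y) (hfc _)
    (hasAdaptedCharts_sublevel hf fun x hx h0 => ?_) hT
    (fun x hx => show f x ≤ b + 1 from le_of_lt hx) ?_ (fun x => ?_)
    ?_ (fun x => ?_) (fun y hy => ?_)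
  · have h1 := hpos x (by rw [hx, hb]; linarith)
    have h2 := hd x
    rw [h0] at h2
    exact h1.ne h2
  · have h1 : ContMDiff (𝓡 m) 𝓘(ℝ, ℝ) ∞ (fun x => θ (f x) - f x) :=
      (hθs.sub contDiff_id).contMDiff.comp hf
    exact ContMDiff.comp (I' := 𝓘(ℝ, ℝ).prod (𝓡 m)) (g := fun z : ℝ × M => Φ z.1 z.2)
      (f := fun x => (θ (f x) - f x, x)) hΦs (h1.prodMk contMDiff_id)
  · change f _ < b + 1
    rw [hgf]
    exact hθlt _
  · have h1 : ContMDiffOn (𝓡 m) 𝓘(ℝ, ℝ) ∞ (fun x => h (f x) - f x) {x : M | f x < b + 1} :=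
      (hhs.sub contDiffOn_id).contMDiffOn.comp hf.contMDiffOn fun x hx => hx
    exact ContMDiff.comp_contMDiffOn (I' := 𝓘(ℝ, ℝ).prod (𝓡 m)) (g := fun z : ℝ × M => Φ z.1 z.2)
      (f := fun x => (h (f x) - f x, x)) hΦs (h1.prodMk contMDiffOn_id)
  · rw [hgf, hhθ, ← hΦadd, sub_add_sub_cancel, sub_self, hΦ0]
  · have hy' : f y < b + 1 := hy
    change Φ (θ (f (Φ (h (f y) - f y) y)) - f (Φ (h (f y) - f y) y)) _ = y
    rw [hkf y hy', hθh _ hy', ← hΦadd, sub_add_sub_cancel, sub_self, hΦ0]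

end Interior

/-! ### The differential of the squared distance -/

section PositionFunction

variable {m n : ℕ} {M : Type*} [MetricSpace M] [ChartedSpace (EuclideanSpace ℝ (Fin m)) M]
  {φ : M → EuclideanSpace ℝ (Fin n)}

theorem mfderiv_half_norm_sq (hφ : ContMDiff (𝓡 m) 𝓘(ℝ, EuclideanSpace ℝ (Fin n)) ∞ φ)
    (c : EuclideanSpace ℝ (Fin n)) (x : M) (v : TangentSpace (𝓡 m) x) :
    mfderiv (𝓡 m) 𝓘(ℝ, ℝ) (fun y => (1 / 2 : ℝ) * ‖φ y - c‖ ^ 2) x v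
      = (inner ℝ (φ x - c) (differential (m := m) φ x v) : ℝ) := by
  let q : EuclideanSpace ℝ (Fin n) → ℝ := fun z => (1 / 2 : ℝ) * ‖z - c‖ ^ 2
  have hq : HasFDerivAt q (innerSL ℝ (φ x - c)) (φ x) := by
    have h1 := (((hasFDerivAt_id (𝕜 := ℝ) (φ x)).sub_const c).norm_sq).const_mul (1 / 2 : ℝ)
    refine h1.congr_fderiv ?_
    ext u
    simp
  have h2 := hq.hasMFDerivAt.comp x (hφ.mdifferentiable (by simp) x).hasMFDerivAt
  exact congrArg (fun A : TangentSpace (𝓡 m) x →L[ℝ] ℝ => A v) h2.mfderiv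

end PositionFunction

end

theorem theorem2 {m n : ℕ} [NeZero m] {M : Type*} [MetricSpace M] [ConnectedSpace M]
    [ChartedSpace (EuclideanSpace ℝ (Fin m)) M] [IsManifold (𝓡 m) ∞ M]
    [RiemannianBundle (fun x : M => TangentSpace (𝓡 m) x)]
    [IsContMDiffRiemannianBundle (𝓡 m) ∞ (EuclideanSpace ℝ (Fin m))
      (fun x : M => TangentSpace (𝓡 m) x)]
    [IsRiemannianManifold (𝓡 m) M] [CompleteSpace M]
    (φ : M → EuclideanSpace ℝ (Fin n)) (hφ : IsIsometricImmersion (m := m) φ)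
    (hmin : IsMinimalImmersion (m := m) φ)
    (p : M) (K : CompactExhaustion M) (hb : (-1 : EReal) < ricciDecay (m := m) p K) :
    IsProperMap φ ∧ IsInteriorOfCompactManifold m M := by
  have : LocallyCompactSpace M := Manifold.locallyCompact_of_finiteDimensional (𝓡 m)
  have : ProperSpace M := properSpace_of_complete (𝓡 m)
  obtain ⟨V, hVs, hV⟩ := exists_gradient hφ (φ p)
  obtain ⟨l, hl, C, hlC⟩ := exists_linear_lower_bound hφ hmin p K hb hVs hV
  have hproper : IsProperMap φ := isProperMap_of_linear_lower_bound hφ hV hl hlC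
  refine ⟨hproper, ?_⟩
  let f : M → ℝ := fun x => (1 / 2 : ℝ) * ‖φ x - φ p‖ ^ 2
  let d : M → ℝ := fun x => inner ℝ (V x) (V x)
  have hf : ContMDiff (𝓡 m) 𝓘(ℝ, ℝ) ∞ f :=
    ContMDiff.comp (g := fun z => (1 / 2 : ℝ) * ‖z - φ p‖ ^ 2)
      (contDiff_const.mul ((contDiff_id.sub contDiff_const).norm_sq ℝ)).contMDiff hφ.1
  have hfc : ∀ b, IsCompact {x | f x ≤ b} := by
    intro b
    refine (hproper.isCompact_preimage (isCompact_closedBall (φ p) (√(2 * b)))).of_isClosed_subset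
      (isClosed_le hf.continuous continuous_const) fun x hx => ?_
    have hx' : (1 / 2 : ℝ) * ‖φ x - φ p‖ ^ 2 ≤ b := hx
    rw [mem_preimage, Metric.mem_closedBall, dist_eq_norm]
    exact Real.le_sqrt_of_sq_le (by linarith)
  have hd : ∀ x, mfderiv (𝓡 m) 𝓘(ℝ, ℝ) f x (V x) = d x := fun x =>
    (mfderiv_half_norm_sq hφ.1 (φ p) x (V x)).trans (hV x (V x)).symm
  have hds : ContMDiff (𝓡 m) 𝓘(ℝ, ℝ) ∞ d := hVs.inner_bundle hVs
  -- outside the ball of radius `C / l` the gradient does not vanish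
  obtain ⟨b, hb⟩ := (isCompact_closedBall p (C / l)).bddAbove_image hf.continuous.continuousOn
  refine isInteriorOfCompactManifold_of_proper hf hfc hVs hd hds (b₀ := b + 1) fun x hx => ?_
  have hx' : C / l < dist p x := by
    by_contra! hcon
    have := hb (mem_image_of_mem f (show x ∈ Metric.closedBall p (C / l) by
      rwa [Metric.mem_closedBall, dist_comm]))
    linarith
  rw [div_lt_iff₀' hl] at hx'
  have hVx : V x ≠ 0 := norm_pos_iff.1 ((sub_pos.2 hx').trans_le (hlC x))
  exact real_inner_self_pos.2 hVx
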